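/- **Setting.** Let $k$ be an algebraically closed field of characteristic $p>0$. Let $X,Y,H$ be the standard basis of $\mathfrak{sl}_2(\mathbb C)$, let $\mathcal U_{\mathbb Z}$ be the subring of the universal enveloping algebra generated by all $X^{(m)}=X^m/m!$ and $Y^{(m)}=Y^m/m!$ $(m\ge 0)$, and let $\mathcal U=\mathcal U_{\mathbb Z}\otimes_{\mathbb Z}k$, the hyperalgebra of $\mathrm{SL}_2$. It contains $\binom{H+c}{m}=\frac{(H+c)(H+c-1)\cdots(H+c-m+1)}{m!}$ for $c\in\mathbb Z$, $m\ge 0$, and has the $k$-basis $Y^{(m)}\binom Hn X^{(m')}$ $(m,n,m'\ge 0)$. Let $\mathrm{Fr}':\mathcal U\to\mathcal U$ be the $k$-linear map with $Y^{(m)}\binom Hn X^{(m')}\mapsto Y^{(mp)}\binom H{np}X^{(m'p)}$. Fix $r\ge 1$. Let $\mathcal U_r$ be the subalgebra generated by $X^{(p^i)},Y^{(p^i)}$ for $0\le i\le r-1$, let $\mathcal A$ be the subalgebra generated by $\binom H{p^i}$ and $Y^{(p^i)}X^{(p^i)}$ for $i\ge 0$, and put $\mathcal A_r=\mathcal A\cap\mathcal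 U_r$. Put $\mu_a=\binom{H-a-1}{p-1}$ for $a\in\mathbb Z$. **The elements $B^{(\varepsilon)}(a,j)$.** If $p$ is odd, let $\mathcal P=\{0,\dots,p-1\}\times\{0,\dots,(p-1)/2\}$; if $p=2$, let $\mathcal P=\{(0,1/2),(1,0),(1,1)\}$. Let $\varepsilon\in\{0,1\}$ and $(a,j)\in\mathcal P$. For $p$ odd put, in $\mathbb F_p[x]$, $\psi(x)=\prod_{i\in\mathbb F_p}(x-i^2)$, $\psi_j^{(1)}(x)=\psi(x)/(x-j^2)$, $\psi_0^{(0)}(x)=\prod_{i\in\mathbb F_p^\times}(x-i^2)$, $\psi_s^{(0)}(x)=2x(x+s^2)\prod_{i\in\mathbb F_p^\times\setminus\{s,-s\}}(x-i^2)$ for $s\ne 0$, and $$B^{(\varepsilon)}(a,j)=\psi_j^{(\varepsilon)}\Big(\mu_aYX+\big(\tfrac{a+1}2\big)^2\Big)\mu_a .$$ For $p=2$ put $B^{(0)}(0,1/2)=\mu_0$, $B^{(1)}(0,1/2)=\mu_0YX$, $B^{(0)}(1,0)=B^{(1)}(1,0)=\mu_1YX$ and $B^{(0)}(1,1)=B^{(1)}(1,1)=\mu_1YX+\mu_1$.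 For $p$ odd let $n^{(\varepsilon)}(a,j)$ be the largest $n\ge 0$ such that $\prod_{i=0}^{n-1}(x-i(i+a+1))$ divides $\psi_j^{(\varepsilon)}\big(x+(\frac{a+1}2)^2\big)$; for $p=2$ put $n^{(0)}(0,1/2)=0$, $n^{(1)}(0,1/2)=1$, $n^{(\varepsilon)}(1,0)=1$, $n^{(\varepsilon)}(1,1)=0$. There are unique $c_m^{(\varepsilon)}\in\mathbb F_p$ with $B^{(\varepsilon)}(a,j)=\mu_a\sum_{m=n^{(\varepsilon)}(a,j)}^{p-1}c_m^{(\varepsilon)}Y^mX^m$. If either $a$ is even and $(p-a+1)/2\le j\le (p-1)/2$, or $a$ is odd and $0\le j\le (a-1)/2$, let $s=1$ if $p=2$, $s=(p-a+1)/2$ if $p$ is odd and $a$ even, $s=(p-a)/2$ if $p$ and $a$ are odd, and put for $z\in\mathcal U$ $$Z^{(\varepsilon)}(z;(a,j))=\mu_a\sum_{m=n^{(\varepsilon)}(a,j)}^{p-1}c_m^{(\varepsilon)}\,Y^mX^{m-s}\,\mathrm{Fr}'(z)\,X^s ;$$ for the other $(a,j)\in\mathcal P$ put $Z^{(\varepsilon)}(z;(a,j))=\mathrm{Fr}'(z)B^{(\varepsilon)}(a,j)$.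 For $\boldsymbol\varepsilon\in\{0,1\}^r$ and $(\boldsymbol a,\boldsymbol j)=((a_i,j_i))_{i=0}^{r-1}\in\mathcal P^r$ define recursively $B^{(\boldsymbol\varepsilon)}(\boldsymbol a,\boldsymbol j)=B^{(\varepsilon_0)}(a_0,j_0)$ if $r=1$, and $$B^{(\boldsymbol\varepsilon)}(\boldsymbol a,\boldsymbol j)=Z^{(\varepsilon_0)}\Big(B^{(\varepsilon_1,\dots,\varepsilon_{r-1})}\big((a_1,\dots,a_{r-1}),(j_1,\dots,j_{r-1})\big);(a_0,j_0)\Big)$$ if $r\ge 2$. Put $E(\boldsymbol a,\boldsymbol j)=B^{(0,\dots,0)}(\boldsymbol a,\boldsymbol j)$. Let $\mathcal X_r(\boldsymbol a,\boldsymbol j)$ be the set of all $\boldsymbol\varepsilon\in\{0,1\}^r$ such that $\varepsilon_i=0$ whenever $j_i=0$ (for $p$ odd), respectively whenever $a_i=1$ (for $p=2$). Let $\mathcal W(\boldsymbol m)$ be the number of nonzero entries of $\boldsymbol m$, and put $w=\mathcal W(\boldsymbol j)$ if $p$ is odd and $w=r-\mathcal W(\boldsymbol a)$ if $p=2$. **Proposition.**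 Let $(\boldsymbol a,\boldsymbol j)\in\mathcal P^r$. The element $E(\boldsymbol a,\boldsymbol j)$ is a central idempotent of $\mathcal A_r$, and for every integer $i\ge 1$ the $i$-th power of the Jacobson radical of the algebra $\mathcal A_r\cdot E(\boldsymbol a,\boldsymbol j)$ (with identity $E(\boldsymbol a,\boldsymbol j)$) is $$\big(\mathrm{rad}(\mathcal A_r\cdot E(\boldsymbol a,\boldsymbol j))\big)^i=\sum_{\substack{\boldsymbol\theta\in\mathcal X_r(\boldsymbol a,\boldsymbol j)\\ \mathcal W(\boldsymbol\theta)=i}}\mathcal A_r\cdot B^{(\boldsymbol\theta)}(\boldsymbol a,\boldsymbol j)=\sum_{\substack{\boldsymbol\theta\in\mathcal X_r(\boldsymbol a,\boldsymbol j)\\ \mathcal W(\boldsymbol\theta)\ge i}}k\cdot B^{(\boldsymbol\theta)}(\boldsymbol a,\boldsymbol j).$$ In particular, $\big(\mathrm{rad}(\mathcal A_r\cdot E(\boldsymbol a,\boldsymbol j))\big)^i=0$ if and only if $i>w$. -/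

import Mathlib

noncomputable section

namespace HyperSL2

open Polynomial
open scoped TensorProduct

/-- The Lie algebra `sl₂(ℂ)` of traceless complex `2 × 2` matrices. -/
abbrev Sl2 : Type := LieAlgebra.SpecialLinear.sl (Fin 2) ℂ

/-- The matrix `X = (0 1; 0 0)`. -/
def matX : Sl2 := ⟨!![0, 1; 0, 0], by simp [LieAlgebra.SpecialLinear.sl, Matrix.trace_fin_two]⟩

/-- The matrix `Y = (0 0; 1 0)`. -/
def matY : Sl2 := ⟨!![0, 0; 1, 0], by simp [LieAlgebra.SpecialLinear.sl, Matrix.trace_fin_two]⟩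

/-- The matrix `H = (1 0; 0 -1)`. -/
def matH : Sl2 := ⟨!![1, 0; 0, -1], by simp [LieAlgebra.SpecialLinear.sl, Matrix.trace_fin_two]⟩

/-- The universal enveloping algebra of `sl₂(ℂ)`. -/
abbrev UC : Type := UniversalEnvelopingAlgebra ℂ Sl2

/-- The image of `X` in the enveloping algebra. -/
def xC : UC := UniversalEnvelopingAlgebra.ι ℂ matX

/-- The image of `Y` in the enveloping algebra. -/
def yC : UC := UniversalEnvelopingAlgebra.ι ℂ matY

/-- The image of `H` in the enveloping algebra. -/
def hC : UC := UniversalEnvelopingAlgebra.ι ℂ matH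

/-- The divided power `t^m / m!`. -/
def divPow (t : UC) (m : ℕ) : UC := ((m.factorial : ℂ)⁻¹) • t ^ m

/-- The binomial polynomial `x (x - 1) ⋯ (x - m + 1) / m!`. -/
def binPoly (m : ℕ) : ℂ[X] := C ((m.factorial : ℂ)⁻¹) * descPochhammer ℂ m

/-- The element `(H + c)(H + c - 1) ⋯ (H + c - m + 1) / m!` of the enveloping algebra. -/
def binH (c : ℤ) (m : ℕ) : UC := aeval (hC + (c : UC)) (binPoly m)

/-- The Kostant form: the subring generated by all `X^(m)` and `Y^(m)`. -/
def UZ : Subalgebra ℤ UC :=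
  Algebra.adjoin ℤ (Set.range (divPow xC) ∪ Set.range (divPow yC))

/-! ### Commutation relations -/

section Relations

attribute [local instance] LieRing.ofAssociativeRing

theorem x_mul_y : xC * yC = yC * xC + hC := by
  have h : ⁅matX, matY⁆ = matH := by
    apply Subtype.ext
    ext i j
    fin_cases i <;> fin_cases j <;>
      simp [matX, matY, matH, LieRing.of_associative_ring_bracket]
  have := (UniversalEnvelopingAlgebra.ι ℂ).map_lie matX matY
  rw [h, LieRing.of_associative_ring_bracket] at this
  unfold xC yC hC
  rw [this]; abel

theorem h_mul_x : hC * xC = xC * (hC + 2) := by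
  have h : ⁅matH, matX⁆ = (2 : ℂ) • matX := by
    apply Subtype.ext
    ext i j
    fin_cases i <;> fin_cases j <;>
      simp [matX, matH, LieRing.of_associative_ring_bracket] <;> norm_num
  have := (UniversalEnvelopingAlgebra.ι ℂ).map_lie matH matX
  rw [h, LieRing.of_associative_ring_bracket, map_smul, two_smul] at this
  unfold xC hC
  rw [mul_add, mul_two, this]; abel

theorem h_mul_y : hC * yC = yC * (hC - 2) := by
  have h : ⁅matH, matY⁆ = (-2 : ℂ) • matY := by
    apply Subtype.ext
    ext i j
    fin_cases i <;> fin_cases j <;>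
      simp [matY, matH, LieRing.of_associative_ring_bracket] <;> norm_num
  have := (UniversalEnvelopingAlgebra.ι ℂ).map_lie matH matY
  rw [h, LieRing.of_associative_ring_bracket, map_smul, neg_smul, two_smul] at this
  unfold yC hC
  rw [mul_sub, mul_two, sub_eq_add_neg, this]; abel

end Relations

theorem binPoly_zero : binPoly 0 = 1 := by simp [binPoly]

theorem binPoly_succ (m : ℕ) :
    ((m : ℂ) + 1) • binPoly (m + 1) = binPoly m * (X - (m : ℂ[X])) := by
  have h : ((m : ℂ) + 1) ≠ 0 := by exact_mod_cast Nat.succ_ne_zero m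
  rw [binPoly, binPoly, descPochhammer_succ_right, smul_eq_C_mul, ← mul_assoc, ← C_mul,
    mul_assoc]
  congr 2
  rw [Nat.factorial_succ]
  push_cast
  field_simp

/-- Pascal's rule. -/
theorem binPoly_pascal (m : ℕ) :
    (binPoly (m + 1)).comp (X + 1) = binPoly (m + 1) + binPoly m := by
  have h : ((m : ℂ) + 1) ≠ 0 := by exact_mod_cast Nat.succ_ne_zero m
  have h1 : (descPochhammer ℂ (m + 1)).comp (X + 1) =
      (X + 1) * descPochhammer ℂ m := by
    rw [descPochhammer_succ_left]
    simp [mul_comp, comp_assoc]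
  have h2 : binPoly m = C (((m + 1).factorial : ℂ)⁻¹) * ((m + 1 : ℂ[X]) * descPochhammer ℂ m) := by
    rw [binPoly, ← mul_assoc]
    congr 1
    have : ((m : ℂ[X]) + 1) = C ((m : ℂ) + 1) := by simp
    rw [this, ← C_mul, Nat.factorial_succ]
    congr 1
    push_cast
    field_simp
  rw [h2, binPoly, mul_comp, C_comp, h1, descPochhammer_succ_right]
  ring

theorem binPoly_eval_zero (m : ℕ) : (binPoly (m + 1)).eval 0 = 0 := by
  simp [binPoly, descPochhammer_succ_left]

theorem binH_add (c d : ℤ) (m : ℕ) :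
    binH (c + d) m = aeval hC ((binPoly m).comp (X + (c : ℂ[X]) + (d : ℂ[X]))) := by
  simp [binH, aeval_comp, add_assoc]

theorem binH_eq (c : ℤ) (m : ℕ) :
    binH c m = aeval hC ((binPoly m).comp (X + (c : ℂ[X]))) := by
  simp [binH, aeval_comp]

theorem binH_zero (c : ℤ) : binH c 0 = 1 := by simp [binH, binPoly_zero]

theorem binH_succ (c : ℤ) (m : ℕ) :
    ((m : ℂ) + 1) • binH c (m + 1) = binH c m * (hC + (c : UC) - (m : UC)) := by
  have := congrArg (aeval (hC + (c : UC))) (binPoly_succ m)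
  simpa [binH] using this

theorem binH_pascal (c : ℤ) (m : ℕ) :
    binH (c + 1) (m + 1) = binH c (m + 1) + binH c m := by
  have := congrArg (aeval (hC + (c : UC))) (binPoly_pascal m)
  simpa [binH, aeval_comp, add_assoc] using this

theorem h_comm_binH (c : ℤ) (m : ℕ) : Commute hC (binH c m) := by
  rw [binH_eq]
  simpa using ((commute_X ((binPoly m).comp (X + (c : ℂ[X])))).map (aeval hC))

theorem aeval_h_mul_x (f : ℂ[X]) : aeval hC f * xC = xC * aeval hC (f.comp (X + 2)) := by
  induction f using Polynomial.induction_on' with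
  | add p q hp hq => simp only [map_add, add_mul, add_comp, hp, hq, mul_add]
  | monomial n a =>
    have h : ∀ n : ℕ, hC ^ n * xC = xC * (hC + 2) ^ n := by
      intro n
      induction n with
      | zero => simp
      | succ n ih => rw [pow_succ, mul_assoc, h_mul_x, ← mul_assoc, ih, mul_assoc, ← pow_succ]
    have h2 : aeval hC (2 : ℂ[X]) = 2 := map_ofNat _ 2
    simp [← C_mul_X_pow_eq_monomial, h, h2, ← Algebra.smul_def]

theorem binH_mul_x (c : ℤ) (m : ℕ) : binH c m * xC = xC * binH (c + 2) m := by
  rw [binH_eq, aeval_h_mul_x, binH_eq, comp_assoc]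
  congr 3
  simp
  ring

theorem x_mul_binH (c : ℤ) (m : ℕ) : xC * binH c m = binH (c - 2) m * xC := by
  rw [binH_mul_x]; simp

theorem divPow_zero (t : UC) : divPow t 0 = 1 := by simp [divPow]

theorem mul_divPow (t : UC) (m : ℕ) : t * divPow t m = ((m : ℂ) + 1) • divPow t (m + 1) := by
  have h : ((m : ℂ) + 1) ≠ 0 := by exact_mod_cast Nat.succ_ne_zero m
  rw [divPow, divPow, mul_smul_comm, ← pow_succ', smul_smul, Nat.factorial_succ]
  congr 1
  push_cast
  field_simp

theorem divPow_mul (t : UC) (m : ℕ) : divPow t m * t = ((m : ℂ) + 1) • divPow t (m + 1) := by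
  rw [← mul_divPow, divPow, smul_mul_assoc, mul_smul_comm, ← pow_succ, ← pow_succ']

theorem divPow_mul_divPow (t : UC) (m n : ℕ) :
    divPow t m * divPow t n = (m + n).choose m • divPow t (m + n) := by
  have h := Nat.add_choose_mul_factorial_mul_factorial m n
  rw [← Nat.choose_symm_add] at h
  have h1 : (m.factorial : ℂ) ≠ 0 := by exact_mod_cast m.factorial_ne_zero
  have h2 : (n.factorial : ℂ) ≠ 0 := by exact_mod_cast n.factorial_ne_zero
  have h3 : ((m + n).factorial : ℂ) ≠ 0 := by exact_mod_cast (m + n).factorial_ne_zero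
  rw [divPow, divPow, divPow, smul_mul_smul_comm, ← pow_add, ← Nat.cast_smul_eq_nsmul ℂ, smul_smul]
  congr 1
  rw [← h] at h3 ⊢
  push_cast at h3 ⊢
  have h4 := left_ne_zero_of_mul (left_ne_zero_of_mul h3)
  field_simp

theorem divPow_x_mul_binH (a : ℕ) (c : ℤ) (m : ℕ) :
    divPow xC a * binH c m = binH (c - 2 * a) m * divPow xC a := by
  have h : ∀ (a : ℕ) (c : ℤ), xC ^ a * binH c m = binH (c - 2 * a) m * xC ^ a := by
    intro a
    induction a with
    | zero => simp
    | succ a ih =>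
      intro c
      rw [pow_succ, mul_assoc, x_mul_binH, ← mul_assoc, ih, mul_assoc]
      congr 2
      push_cast; ring
  rw [divPow, smul_mul_assoc, mul_smul_comm, h]

theorem x_mul_divPow_y (b : ℕ) :
    xC * divPow yC (b + 1) = divPow yC (b + 1) * xC + divPow yC b * (hC - (b : UC)) := by
  induction b with
  | zero => simp [divPow, x_mul_y]
  | succ b ih =>
    have hb : ((b : ℂ) + 1 + 1) ≠ 0 := by exact_mod_cast Nat.succ_ne_zero (b + 1)
    have e1 := divPow_mul yC (b + 1)
    have e0 := divPow_mul yC b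
    push_cast at e1
    have e2 : ((b : ℂ) + 1 + 1) • (xC * divPow yC (b + 1 + 1)) =
        ((b : ℂ) + 1 + 1) • (divPow yC (b + 1 + 1) * xC
          + divPow yC (b + 1) * (hC - ((b + 1 : ℕ) : UC))) := by
      rw [← mul_smul_comm, ← e1, ← mul_assoc, ih, add_mul, mul_assoc _ xC yC, x_mul_y, mul_add,
        ← mul_assoc, e1, mul_assoc, sub_mul, h_mul_y, (Nat.cast_commute b yC).eq, ← mul_sub,
        ← mul_assoc, e0, smul_add, smul_mul_assoc, add_assoc, smul_mul_assoc, ← mul_smul_comm,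
        ← mul_smul_comm, ← mul_add]
      congr 2
      have : ∀ z : UC, ((b : ℂ) + 1 + 1) • z = ((b : ℂ) + 1) • z + z := by
        intro z; rw [add_smul _ (1 : ℂ), one_smul]
      have h2 : ∀ z : UC, ((b : ℂ) + 1) • z = (b : UC) * z + z := by
        intro z; rw [add_smul _ (1 : ℂ), one_smul, Algebra.smul_def, map_natCast]
      rw [this, h2, h2]
      simp only [← mul_assoc, (Nat.cast_commute b (divPow yC (b + 1))).eq]
      push_cast
      noncomm_ring
    exact (smul_right_injective UC hb) e2

/-- Divided powers with integer exponents, equal to zero for negative exponents. -/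
def divPowZ (t : UC) (n : ℤ) : UC := if 0 ≤ n then divPow t n.toNat else 0

theorem divPowZ_natCast (t : UC) (n : ℕ) : divPowZ t n = divPow t n := by simp [divPowZ]

theorem divPowZ_of_neg (t : UC) (n : ℤ) (h : n < 0) : divPowZ t n = 0 := by
  simp [divPowZ, h]

theorem mul_divPowZ (t : UC) (n : ℤ) : t * divPowZ t n = ((n : ℂ) + 1) • divPowZ t (n + 1) := by
  rcases lt_trichotomy n (-1) with h | h | h
  · rw [divPowZ_of_neg t n (by omega), divPowZ_of_neg t (n + 1) (by omega)]; simp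
  · subst h; simp [divPowZ]
  · obtain ⟨m, rfl⟩ := Int.eq_ofNat_of_zero_le (show 0 ≤ n by omega)
    have : ((m : ℤ) + 1) = ((m + 1 : ℕ) : ℤ) := by push_cast; rfl
    rw [this, divPowZ_natCast, divPowZ_natCast, mul_divPow]
    simp

theorem x_mul_divPowZ_y (b : ℤ) :
    xC * divPowZ yC b = divPowZ yC b * xC + divPowZ yC (b - 1) * (hC - (b : UC) + 1) := by
  rcases lt_trichotomy b 0 with h | h | h
  · simp [divPowZ_of_neg yC b h, divPowZ_of_neg yC (b - 1) (by omega)]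
  · subst h; simp [divPowZ, divPow_zero]
  · obtain ⟨m, rfl⟩ : ∃ m : ℕ, b = ((m + 1 : ℕ) : ℤ) := ⟨(b - 1).toNat, by omega⟩
    have : (((m + 1 : ℕ) : ℤ) - 1) = (m : ℤ) := by push_cast; ring
    rw [this, divPowZ_natCast, divPowZ_natCast, x_mul_divPow_y]
    congr 2
    push_cast
    abel

/-- Kostant's commutation formula for `X^(a) Y^(b)`. -/
theorem divPow_x_mul_divPowZ_y (a : ℕ) (b : ℤ) :
    divPow xC a * divPowZ yC b = ∑ k ∈ Finset.range (a + 1),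
      divPowZ yC (b - k) * binH (2 * k - a - b) k * divPowZ xC (a - k) := by
  induction a with
  | zero => simp [divPow_zero, binH_zero, divPowZ]
  | succ a ih =>
    have ha : ((a : ℂ) + 1) ≠ 0 := by exact_mod_cast Nat.succ_ne_zero a
    apply smul_right_injective UC ha
    simp only
    rw [← smul_mul_assoc, ← mul_divPow, mul_assoc, ih, Finset.mul_sum, Finset.smul_sum]
    set P : ℕ → UC := fun k => ((a : ℂ) - k + 1) •
      (divPowZ yC (b - k) * binH (2 * k - a - b - 2) k * divPowZ xC (a - k + 1)) with hP
    set Q : ℕ → UC := fun k => divPowZ yC (b - k - 1) * (hC - (b : UC) + k + 1)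
      * binH (2 * k - a - b) k * divPowZ xC (a - k) with hQ
    have e1 : ∀ k : ℕ, xC * (divPowZ yC (b - k) * binH (2 * k - a - b) k * divPowZ xC (a - k))
        = P k + Q k := by
      intro k
      rw [← mul_assoc, ← mul_assoc, x_mul_divPowZ_y, add_mul, add_mul, mul_assoc _ xC,
        x_mul_binH, ← mul_assoc, mul_assoc _ xC, mul_divPowZ, mul_smul_comm]
      congr 1
      · simp only [hP]; push_cast; rfl
      · simp only [hQ]
        congr 3
        push_cast
        abel
    simp_rw [e1]
    rw [Finset.sum_add_distrib, Finset.sum_range_succ' _ (a + 1)]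
    have e2 : ∑ k ∈ Finset.range (a + 1), P k = ∑ k ∈ Finset.range (a + 1), P (k + 1) + P 0 := by
      rw [← Finset.sum_range_succ' P (a + 1), Finset.sum_range_succ P (a + 1)]
      simp [hP]
    rw [e2, add_right_comm, ← Finset.sum_add_distrib]
    congr 1
    · refine Finset.sum_congr rfl fun k _ => ?_
      simp only [hP, hQ]
      have i1 : (b - ((k + 1 : ℕ) : ℤ)) = b - k - 1 := by push_cast; ring
      have i2 : ((a : ℤ) - ((k + 1 : ℕ) : ℤ) + 1) = a - k := by push_cast; ring
      have i3 : (2 * ((k + 1 : ℕ) : ℤ) - a - b - 2) = 2 * k - a - b := by push_cast; ring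
      have i4 : (((a + 1 : ℕ) : ℤ) - ((k + 1 : ℕ) : ℤ)) = a - k := by push_cast; ring
      have i5 : (2 * ((k + 1 : ℕ) : ℤ) - ((a + 1 : ℕ) : ℤ) - b) = 2 * k - a - b + 1 := by
        push_cast; ring
      have g : ∀ (s : ℂ) (u v w : UC), s • (u * v * w) = u * (s • v) * w := by
        intro s u v w
        rw [mul_smul_comm, smul_mul_assoc]
      rw [i1, i2, i3, i4, i5, g, g, ← add_mul, mul_assoc _ (hC - (b : UC) + k + 1), ← mul_add]
      congr 2
      rw [binH_pascal]
      set c : ℤ := 2 * k - a - b with hc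
      have hs := binH_succ c k
      have hcomm := (h_comm_binH c k).eq
      have : (hC + (c : UC) - (k : UC)) = hC - (b : UC) + k - a := by
        rw [hc]; push_cast; noncomm_ring
      rw [this, mul_sub, mul_add, mul_sub, ← hcomm, (Int.cast_commute b _).symm.eq,
        (Nat.cast_commute k _).symm.eq, (Nat.cast_commute a _).symm.eq] at hs
      have e3 : ∀ z : UC, ((a : ℂ) - ((k + 1 : ℕ) : ℂ) + 1) • z = (a : UC) * z - (k : UC) * z := by
        intro z
        rw [show ((a : ℂ) - ((k + 1 : ℕ) : ℂ) + 1) = a - k by push_cast; ring, sub_smul,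
          Algebra.smul_def, Algebra.smul_def, map_natCast, map_natCast]
      have e4 : ∀ (n : ℕ) (z : UC), ((n : ℂ) + 1) • z = (n : UC) * z + z := by
        intro n z
        rw [add_smul, one_smul, Algebra.smul_def, map_natCast]
      rw [e4] at hs
      rw [e3, e4, add_mul, add_mul, sub_mul, one_mul, mul_add]
      have hs' : (k : UC) * binH c (k + 1) =
        hC * binH c k - (b : UC) * binH c k + k * binH c k - a * binH c k - binH c (k + 1) := by
        rw [← hs]; abel
      rw [hs']
      abel
    · simp [hP, binH_zero]

/-- The additive group of integer combinations of binomial polynomials. -/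
def binSpan : Submodule ℤ ℂ[X] := Submodule.span ℤ (Set.range binPoly)

theorem binPoly_mem (m : ℕ) : binPoly m ∈ binSpan := Submodule.subset_span ⟨m, rfl⟩

theorem intCast_mem_binSpan (n : ℤ) : (n : ℂ[X]) ∈ binSpan := by
  have := binSpan.smul_mem n (binPoly_mem 0)
  simpa [binPoly_zero] using this

theorem comp_add_one_mem {f : ℂ[X]} (hf : f ∈ binSpan) : f.comp (X + 1) ∈ binSpan := by
  induction hf using Submodule.span_induction with
  | mem f hf =>
    obtain ⟨m, rfl⟩ := hf
    cases m with
    | zero => simpa [binPoly_zero] using binPoly_mem 0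
    | succ m => rw [binPoly_pascal]; exact add_mem (binPoly_mem _) (binPoly_mem _)
  | zero => simp
  | add f g _ _ hf hg => rw [add_comp]; exact add_mem hf hg
  | smul n f _ hf => rw [zsmul_eq_mul, mul_comp, intCast_comp, ← zsmul_eq_mul]
                     exact binSpan.smul_mem n hf

theorem comp_sub_one_mem {f : ℂ[X]} (hf : f ∈ binSpan) : f.comp (X - 1) ∈ binSpan := by
  induction hf using Submodule.span_induction with
  | mem f hf =>
    obtain ⟨m, rfl⟩ := hf
    induction m with
    | zero => simpa [binPoly_zero] using binPoly_mem 0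
    | succ m ih =>
      have h := congrArg (fun f => f.comp (X - 1)) (binPoly_pascal m)
      simp only [comp_assoc, add_comp, X_comp, one_comp, sub_add_cancel, comp_X] at h
      have h2 : (binPoly (m + 1)).comp (X - 1) = binPoly (m + 1) - (binPoly m).comp (X - 1) := by
        exact eq_sub_of_add_eq h.symm
      rw [h2]
      exact sub_mem (binPoly_mem _) ih
  | zero => simp
  | add f g _ _ hf hg => rw [add_comp]; exact add_mem hf hg
  | smul n f _ hf => rw [zsmul_eq_mul, mul_comp, intCast_comp, ← zsmul_eq_mul]
                     exact binSpan.smul_mem n hf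

theorem comp_add_int_mem {f : ℂ[X]} (hf : f ∈ binSpan) (c : ℤ) :
    f.comp (X + (c : ℂ[X])) ∈ binSpan := by
  induction c with
  | zero => simpa using hf
  | succ i ih =>
    have := comp_add_one_mem ih
    simp only [comp_assoc, add_comp, X_comp, intCast_comp] at this
    rw [show X + (((i : ℤ) + 1 : ℤ) : ℂ[X]) = X + 1 + ((i : ℤ) : ℂ[X]) by push_cast; ring]
    exact this
  | pred i ih =>
    have := comp_sub_one_mem ih
    simp only [comp_assoc, add_comp, X_comp, intCast_comp] at this
    rw [show X + ((-(i : ℤ) - 1 : ℤ) : ℂ[X]) = X - 1 + ((-(i : ℤ) : ℤ) : ℂ[X]) by push_cast; ring]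
    exact this

/-- A polynomial whose difference and constant value are integral combinations is one itself. -/
theorem mem_binSpan_of_diff {f : ℂ[X]} (h0 : ∃ n : ℤ, f.eval 0 = n)
    (hd : f.comp (X + 1) - f ∈ binSpan) : f ∈ binSpan := by
  have key : ∀ g ∈ binSpan, ∃ F ∈ binSpan, F.comp (X + 1) - F = g := by
    intro g hg
    induction hg using Submodule.span_induction with
    | mem g hg =>
      obtain ⟨m, rfl⟩ := hg
      exact ⟨binPoly (m + 1), binPoly_mem _, by rw [binPoly_pascal]; ring⟩
    | zero => exact ⟨0, zero_mem _, by simp⟩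
    | add f g _ _ hf hg =>
      obtain ⟨F, hF, rfl⟩ := hf
      obtain ⟨G, hG, rfl⟩ := hg
      exact ⟨F + G, add_mem hF hG, by rw [add_comp]; ring⟩
    | smul n f _ hf =>
      obtain ⟨F, hF, rfl⟩ := hf
      refine ⟨n • F, binSpan.smul_mem n hF, ?_⟩
      rw [zsmul_eq_mul, zsmul_eq_mul, mul_comp, intCast_comp]; ring
  have int0 : ∀ g ∈ binSpan, ∃ n : ℤ, g.eval 0 = n := by
    intro g hg
    induction hg using Submodule.span_induction with
    | mem g hg =>
      obtain ⟨m, rfl⟩ := hg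
      cases m with
      | zero => exact ⟨1, by simp [binPoly_zero]⟩
      | succ m => exact ⟨0, by simp [binPoly_eval_zero]⟩
    | zero => exact ⟨0, by simp⟩
    | add f g _ _ hf hg =>
      obtain ⟨m, hm⟩ := hf
      obtain ⟨n, hn⟩ := hg
      exact ⟨m + n, by simp [hm, hn]⟩
    | smul n f _ hf =>
      obtain ⟨m, hm⟩ := hf
      exact ⟨n * m, by simp [hm]⟩
  obtain ⟨F, hF, hFd⟩ := key _ hd
  obtain ⟨m, hm⟩ := h0
  obtain ⟨n, hn⟩ := int0 F hF
  have hper : ∀ i : ℕ, (f - F).eval (i : ℂ) = ((m - n : ℤ) : ℂ) := by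
    intro i
    induction i with
    | zero => simp [hm, hn]
    | succ i ih =>
      have := congrArg (eval (i : ℂ)) hFd
      simp only [eval_sub, eval_comp, eval_add, eval_X, eval_one] at this
      rw [← ih]
      push_cast
      simp only [eval_sub]
      linear_combination -this
  have hc : f - F = C ((m - n : ℤ) : ℂ) := by
    apply Polynomial.eq_of_infinite_eval_eq
    refine Set.Infinite.mono ?_ (Set.infinite_range_of_injective (Nat.cast_injective (R := ℂ)))
    rintro _ ⟨i, rfl⟩
    simp only [Set.mem_ofPred_eq, hper, eval_C]
  have : f = F + ((m - n : ℤ) : ℂ[X]) := by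
    rw [← sub_eq_iff_eq_add', hc]; simp
  rw [this]
  exact add_mem hF (intCast_mem_binSpan _)

theorem binPoly_mul_mem (s : ℕ) : ∀ m n, m + n ≤ s → binPoly m * binPoly n ∈ binSpan := by
  induction s with
  | zero =>
    intro m n h
    obtain ⟨rfl, rfl⟩ : m = 0 ∧ n = 0 := by omega
    simpa [binPoly_zero] using binPoly_mem 0
  | succ s ih =>
    intro m n h
    cases m with
    | zero => simpa [binPoly_zero] using binPoly_mem n
    | succ m =>
      cases n with
      | zero => simpa [binPoly_zero] using binPoly_mem (m + 1)
      | succ n =>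
        apply mem_binSpan_of_diff
        · exact ⟨0, by simp [binPoly_eval_zero]⟩
        · rw [mul_comp, binPoly_pascal, binPoly_pascal]
          have : (binPoly (m + 1) + binPoly m) * (binPoly (n + 1) + binPoly n)
              - binPoly (m + 1) * binPoly (n + 1) = binPoly (m + 1) * binPoly n
                + binPoly m * binPoly (n + 1) + binPoly m * binPoly n := by ring
          rw [this]
          exact add_mem (add_mem (ih _ _ (by omega)) (ih _ _ (by omega))) (ih _ _ (by omega))

theorem mul_mem_binSpan {f g : ℂ[X]} (hf : f ∈ binSpan) (hg : g ∈ binSpan) : f * g ∈ binSpan := by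
  induction hf using Submodule.span_induction with
  | mem f hf =>
    obtain ⟨m, rfl⟩ := hf
    induction hg using Submodule.span_induction with
    | mem g hg => obtain ⟨n, rfl⟩ := hg; exact binPoly_mul_mem _ m n le_rfl
    | zero => simp
    | add f g _ _ hf hg => rw [mul_add]; exact add_mem hf hg
    | smul n f _ hf => rw [mul_smul_comm]; exact binSpan.smul_mem n hf
  | zero => simp
  | add f g _ _ hf hg => rw [add_mul]; exact add_mem hf hg
  | smul n f _ hf => rw [smul_mul_assoc]; exact binSpan.smul_mem n hf

/-- The element `Y^(m) (H choose n) X^(m')` of the enveloping algebra, for `t = (m, n, m')`. -/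
def pbwC (t : ℕ × ℕ × ℕ) : UC := divPow yC t.1 * binH 0 t.2.1 * divPow xC t.2.2

/-- The integral span of all `Y^(m) (H choose n) X^(m')`. -/
def pbwSpan : Submodule ℤ UC := Submodule.span ℤ (Set.range pbwC)

theorem sandwich_mem (m m' : ℕ) {f : ℂ[X]} (hf : f ∈ binSpan) :
    divPow yC m * aeval hC f * divPow xC m' ∈ pbwSpan := by
  induction hf using Submodule.span_induction with
  | mem f hf =>
    obtain ⟨n, rfl⟩ := hf
    exact Submodule.subset_span ⟨(m, n, m'), by simp [pbwC, binH]⟩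
  | zero => simp
  | add f g _ _ hf hg => rw [map_add, mul_add, add_mul]; exact add_mem hf hg
  | smul n f _ hf => rw [map_zsmul, mul_smul_comm, smul_mul_assoc]; exact pbwSpan.smul_mem n hf

theorem y_mul_mem (a : ℕ) {u : UC} (hu : u ∈ pbwSpan) : divPow yC a * u ∈ pbwSpan := by
  induction hu using Submodule.span_induction with
  | mem u hu =>
    obtain ⟨⟨m, n, m'⟩, rfl⟩ := hu
    simp only [pbwC]
    rw [← mul_assoc, ← mul_assoc, divPow_mul_divPow, smul_mul_assoc, smul_mul_assoc]
    exact pbwSpan.smul_of_tower_mem _ (Submodule.subset_span ⟨(a + m, n, m'), rfl⟩)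
  | zero => simp
  | add f g _ _ hf hg => rw [mul_add]; exact add_mem hf hg
  | smul n f _ hf => rw [mul_smul_comm]; exact pbwSpan.smul_mem n hf

theorem x_mul_mem (a : ℕ) {u : UC} (hu : u ∈ pbwSpan) : divPow xC a * u ∈ pbwSpan := by
  induction hu using Submodule.span_induction with
  | mem u hu =>
    obtain ⟨⟨m, n, m'⟩, rfl⟩ := hu
    simp only [pbwC]
    rw [← mul_assoc, ← mul_assoc, ← divPowZ_natCast yC, divPow_x_mul_divPowZ_y, Finset.sum_mul,
      Finset.sum_mul]
    refine sum_mem fun k hk => ?_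
    have hk' : k ≤ a := by simpa [Nat.lt_succ_iff] using hk
    have i1 : (a : ℤ) - k = ((a - k : ℕ) : ℤ) := by omega
    rw [i1, divPowZ_natCast]
    rcases lt_or_ge m k with h | h
    · rw [divPowZ_of_neg yC _ (by omega)]; simp
    · have i2 : (m : ℤ) - k = ((m - k : ℕ) : ℤ) := by omega
      rw [i2, divPowZ_natCast, mul_assoc _ (divPow xC (a - k)), divPow_x_mul_binH, mul_assoc,
        mul_assoc _ (divPow xC (a - k)), divPow_mul_divPow, mul_smul_comm, mul_smul_comm,
        ← mul_assoc, mul_assoc _ (binH _ _) (binH _ _), binH_eq, binH_eq, ← map_mul]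
      exact pbwSpan.smul_of_tower_mem _ (sandwich_mem _ _ (mul_mem_binSpan
        (comp_add_int_mem (binPoly_mem _) _) (comp_add_int_mem (binPoly_mem _) _)))
  | zero => simp
  | add f g _ _ hf hg => rw [mul_add]; exact add_mem hf hg
  | smul n f _ hf => rw [mul_smul_comm]; exact pbwSpan.smul_mem n hf

theorem mem_pbwSpan_of_mem_UZ {u : UC} (hu : u ∈ UZ) : u ∈ pbwSpan := by
  have : ∀ v ∈ pbwSpan, u * v ∈ pbwSpan := by
    induction hu using Algebra.adjoin_induction with
    | mem u hu =>
      rcases hu with ⟨a, rfl⟩ | ⟨a, rfl⟩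
      · exact fun v hv => x_mul_mem a hv
      · exact fun v hv => y_mul_mem a hv
    | algebraMap n =>
      intro v hv
      rw [← Algebra.smul_def]
      exact pbwSpan.smul_mem n hv
    | add f g _ _ hf hg => intro v hv; rw [add_mul]; exact add_mem (hf v hv) (hg v hv)
    | mul f g _ _ hf hg => intro v hv; rw [mul_assoc]; exact hf _ (hg v hv)
  have h1 : (1 : UC) ∈ pbwSpan :=
    Submodule.subset_span ⟨(0, 0, 0), by simp [pbwC, divPow_zero, binH_zero]⟩
  simpa using this 1 h1

theorem divPow_x_mem (m : ℕ) : divPow xC m ∈ UZ := Algebra.subset_adjoin (Or.inl ⟨m, rfl⟩)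

theorem divPow_y_mem (m : ℕ) : divPow yC m ∈ UZ := Algebra.subset_adjoin (Or.inr ⟨m, rfl⟩)

/-- All binomials `(H + c choose m)` lie in the Kostant form. -/
theorem binH_mem (c : ℤ) (m : ℕ) : binH c m ∈ UZ := by
  induction m using Nat.strong_induction_on generalizing c with
  | _ m ih =>
  have hm : binH 0 m ∈ UZ := by
    have h := divPow_x_mul_divPowZ_y m m
    rw [divPowZ_natCast, Finset.sum_range_succ] at h
    simp only [sub_self] at h
    have i : (2 * (m : ℤ) - m - m) = 0 := by ring
    have e : divPowZ yC 0 = 1 ∧ divPowZ xC 0 = 1 := by simp [divPowZ, divPow_zero]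
    rw [i, e.1, e.2, one_mul, mul_one] at h
    rw [eq_sub_iff_add_eq'.mpr h.symm]
    refine sub_mem (mul_mem (divPow_x_mem m) (divPow_y_mem m)) (sum_mem fun k hk => ?_)
    have hk' : k < m := by simpa using hk
    have i1 : (m : ℤ) - k = ((m - k : ℕ) : ℤ) := by omega
    rw [i1, divPowZ_natCast, divPowZ_natCast]
    exact mul_mem (mul_mem (divPow_y_mem _) (ih k hk' _)) (divPow_x_mem _)
  cases m with
  | zero => rw [binH_zero]; exact one_mem _
  | succ m =>
    induction c with
    | zero => exact hm
    | succ i hi => rw [binH_pascal]; exact add_mem hi (ih m (by omega) _)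
    | pred i hi =>
      have := binH_pascal (-(i : ℤ) - 1) m
      rw [sub_add_cancel] at this
      rw [← sub_eq_iff_eq_add] at this
      rw [← this]
      exact sub_mem hi (ih m (by omega) _)

theorem pbwC_mem (t : ℕ × ℕ × ℕ) : pbwC t ∈ UZ :=
  mul_mem (mul_mem (divPow_y_mem _) (binH_mem _ _)) (divPow_x_mem _)

/-! ### Linear independence, by acting on the Verma modules -/

/-- The operator of `X` on the Verma module of highest weight `l`. -/
def vermaX (l : ℂ) : Module.End ℂ (ℕ →₀ ℂ) :=
  Finsupp.lsum ℂ fun i => ((i : ℂ) * (l - i + 1)) • Finsupp.lsingle (i - 1)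

/-- The operator of `Y` on the Verma module of highest weight `l`. -/
def vermaY : Module.End ℂ (ℕ →₀ ℂ) := Finsupp.lsum ℂ fun i => Finsupp.lsingle (i + 1)

/-- The operator of `H` on the Verma module of highest weight `l`. -/
def vermaH (l : ℂ) : Module.End ℂ (ℕ →₀ ℂ) :=
  Finsupp.lsum ℂ fun i => (l - 2 * i) • Finsupp.lsingle i

theorem vermaX_single (l : ℂ) (i : ℕ) (z : ℂ) :
    vermaX l (Finsupp.single i z) = ((i : ℂ) * (l - i + 1)) • Finsupp.single (i - 1) z := by
  simp [vermaX]

theorem vermaY_single (i : ℕ) (z : ℂ) :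
    vermaY (Finsupp.single i z) = Finsupp.single (i + 1) z := by
  simp [vermaY]

theorem vermaH_single (l : ℂ) (i : ℕ) (z : ℂ) :
    vermaH l (Finsupp.single i z) = (l - 2 * i) • Finsupp.single i z := by
  simp [vermaH]

theorem verma_xy (l : ℂ) : vermaX l * vermaY = vermaY * vermaX l + vermaH l := by
  apply Finsupp.lhom_ext
  intro i z
  simp only [Module.End.mul_apply, LinearMap.add_apply, vermaX_single, vermaY_single,
    vermaH_single, map_smul]
  cases i with
  | zero => simp
  | succ i =>
    simp only [Nat.add_sub_cancel, ← add_smul]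
    congr 1
    push_cast
    ring

theorem verma_hx (l : ℂ) : vermaH l * vermaX l = vermaX l * vermaH l + (2 : ℂ) • vermaX l := by
  apply Finsupp.lhom_ext
  intro i z
  simp only [Module.End.mul_apply, LinearMap.add_apply, LinearMap.smul_apply, vermaX_single,
    vermaH_single, map_smul]
  cases i with
  | zero => simp
  | succ i =>
    simp only [Nat.add_sub_cancel, ← add_smul, smul_smul]
    congr 1
    push_cast
    ring

theorem verma_hy (l : ℂ) : vermaH l * vermaY = vermaY * vermaH l - (2 : ℂ) • vermaY := by
  apply Finsupp.lhom_ext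
  intro i z
  simp only [Module.End.mul_apply, LinearMap.sub_apply, LinearMap.smul_apply, vermaY_single,
    vermaH_single, map_smul, ← sub_smul]
  congr 1
  push_cast
  ring

section Verma

attribute [local instance] LieRing.ofAssociativeRing

/-- The Verma module of highest weight `l`, as a representation of the enveloping algebra. -/
theorem exists_verma (l : ℂ) : ∃ ρ : UC →ₐ[ℂ] Module.End ℂ (ℕ →₀ ℂ),
    ρ xC = vermaX l ∧ ρ yC = vermaY ∧ ρ hC = vermaH l := by
  let f : Sl2 →ₗ⁅ℂ⁆ Module.End ℂ (ℕ →₀ ℂ) :=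
    { toFun := fun A => A.1 0 1 • vermaX l + A.1 1 0 • vermaY + A.1 0 0 • vermaH l
      map_add' := by
        intro A B
        change (A.1 0 1 + B.1 0 1) • vermaX l + (A.1 1 0 + B.1 1 0) • vermaY
          + (A.1 0 0 + B.1 0 0) • vermaH l = _
        module
      map_smul' := by
        intro c A
        change (c * A.1 0 1) • vermaX l + (c * A.1 1 0) • vermaY + (c * A.1 0 0) • vermaH l = _
        simp only [RingHom.id_apply]
        module
      map_lie' := by
        intro A B
        have hA : A.1 1 1 = - A.1 0 0 := by
          have h : Matrix.trace A.1 = 0 := A.2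
          rw [Matrix.trace_fin_two] at h
          linear_combination h
        have hB : B.1 1 1 = - B.1 0 0 := by
          have h : Matrix.trace B.1 = 0 := B.2
          rw [Matrix.trace_fin_two] at h
          linear_combination h
        simp only [LieSubalgebra.coe_bracket, LieRing.of_associative_ring_bracket,
          Matrix.sub_apply, Matrix.mul_apply, Fin.sum_univ_two, hA, hB]
        simp only [add_mul, mul_add, smul_mul_smul_comm, verma_xy, verma_hx, verma_hy]
        module }
  refine ⟨UniversalEnvelopingAlgebra.lift ℂ f, ?_, ?_, ?_⟩
  · rw [xC, UniversalEnvelopingAlgebra.lift_ι_apply]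
    simp [f, matX]
  · rw [yC, UniversalEnvelopingAlgebra.lift_ι_apply]
    simp [f, matY]
  · rw [hC, UniversalEnvelopingAlgebra.lift_ι_apply]
    simp [f, matH]

end Verma

theorem vermaX_pow_of_lt (l : ℂ) : ∀ (n i : ℕ) (z : ℂ), i < n →
    (vermaX l ^ n) (Finsupp.single i z) = 0 := by
  intro n
  induction n with
  | zero => intro i z h; omega
  | succ n ih =>
    intro i z h
    rw [pow_succ, Module.End.mul_apply, vermaX_single, map_smul]
    cases i with
    | zero => simp
    | succ i => rw [Nat.add_sub_cancel, ih i z (by omega), smul_zero]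

theorem vermaX_pow_self (l : ℂ) (n : ℕ) : (vermaX l ^ n) (Finsupp.single n 1) =
    (∏ i ∈ Finset.range n, ((i + 1 : ℂ) * (l - i))) • Finsupp.single 0 1 := by
  induction n with
  | zero => simp
  | succ n ih =>
    rw [pow_succ, Module.End.mul_apply, vermaX_single, map_smul, Nat.add_sub_cancel, ih, smul_smul,
      Finset.prod_range_succ, mul_comm]
    congr 2
    push_cast
    ring

theorem vermaY_pow (n i : ℕ) (z : ℂ) :
    (vermaY ^ n) (Finsupp.single i z) = Finsupp.single (i + n) z := by
  induction n generalizing i with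
  | zero => simp
  | succ n ih =>
    rw [pow_succ, Module.End.mul_apply, vermaY_single, ih]
    congr 1; omega

theorem verma_aeval (l : ℂ) (f : ℂ[X]) :
    (aeval (vermaH l) f) (Finsupp.single 0 1) = f.eval l • Finsupp.single 0 1 := by
  have h : ∀ n : ℕ, (vermaH l ^ n) (Finsupp.single 0 1) = l ^ n • Finsupp.single 0 1 := by
    intro n
    induction n with
    | zero => simp
    | succ n ih => rw [pow_succ', Module.End.mul_apply, ih, map_smul, vermaH_single, smul_smul,
                    pow_succ]; simp
  induction f using Polynomial.induction_on' with
  | add p q hp hq => simp [map_add, hp, hq, add_smul]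
  | monomial n a => 
    rw [aeval_monomial, Module.End.mul_apply, h, map_smul, eval_monomial, Module.algebraMap_end_apply,
      smul_smul, mul_comm]

theorem binPoly_linearIndependent : LinearIndependent ℂ binPoly := by
  have hdeg : ∀ m, (binPoly m).natDegree = m := by
    intro m
    rw [binPoly, natDegree_C_mul (inv_ne_zero (by exact_mod_cast m.factorial_ne_zero)),
      descPochhammer_natDegree]
  have hne : ∀ m, binPoly m ≠ 0 := fun m => by
    rw [binPoly]
    exact mul_ne_zero (C_ne_zero.mpr (inv_ne_zero (by exact_mod_cast m.factorial_ne_zero)))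
      (monic_descPochhammer ℂ m).ne_zero
  let S : Polynomial.Sequence ℂ :=
    { elems' := binPoly
      degree_eq' := fun m => by rw [degree_eq_natDegree (hne m), hdeg] }
  exact S.linearIndependent

theorem pbwC_linearIndependent : LinearIndependent ℂ pbwC := by
  classical
  rw [linearIndependent_iff]
  intro l hl
  have key : ∀ c a b, l (a, b, c) = 0 := by
    intro c
    induction c using Nat.strong_induction_on with
    | _ c ih =>
    intro a b
    let f : ℕ → ℕ × ℕ × ℕ := fun n => (a, n, c)
    have hf : Function.Injective f := fun m n h => by simpa [f] using h
    let F : ℂ[X] := ∑ t ∈ l.support with t ∈ Set.range f, l t • binPoly t.2.1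
    have hF : F = 0 := by
      apply Polynomial.eq_of_infinite_eval_eq
      refine Set.Infinite.mono ?_ (Set.infinite_range_of_injective
        (f := fun i : ℕ => ((i + c : ℕ) : ℂ)) (fun i j h => by simpa using h))
      rintro _ ⟨i, rfl⟩
      obtain ⟨ρ, hx, hy, hh⟩ := exists_verma ((i + c : ℕ) : ℂ)
      set L : ℂ := ((i + c : ℕ) : ℂ) with hL
      have hterm : ∀ t : ℕ × ℕ × ℕ, l t • ((ρ (pbwC t)) (Finsupp.single c 1)) a =
          (if t ∈ Set.range f then (l t • binPoly t.2.1).eval L else 0) *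
          (((a.factorial : ℂ)⁻¹) * ((c.factorial : ℂ)⁻¹ *
            ∏ i ∈ Finset.range c, ((i + 1 : ℂ) * (L - i)))) := by
        rintro ⟨m, n, m'⟩
        have e : ρ (pbwC (m, n, m')) = ((m.factorial : ℂ)⁻¹ • vermaY ^ m) *
            aeval (vermaH L) (binPoly n) * ((m'.factorial : ℂ)⁻¹ • vermaX L ^ m') := by
          simp only [pbwC, divPow, binH, map_mul, map_smul, map_pow, hx, hy, Int.cast_zero,
            add_zero, ← aeval_algHom_apply, hh]
        rw [e, Module.End.mul_apply, Module.End.mul_apply, LinearMap.smul_apply,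
          LinearMap.smul_apply]
        have hr : (m, n, m') ∈ Set.range f ↔ m = a ∧ m' = c := by
          simp only [f, Set.mem_range, Prod.mk.injEq]
          constructor
          · rintro ⟨_, h1, _, h2⟩; exact ⟨h1.symm, h2.symm⟩
          · rintro ⟨h1, h2⟩; exact ⟨n, h1.symm, rfl, h2.symm⟩
        rcases lt_trichotomy m' c with h | h | h
        · rw [ih m' h m n]; simp
        · subst h
          rw [vermaX_pow_self]
          simp only [map_smul, verma_aeval, vermaY_pow]
          by_cases hm : m = a
          · subst hm
            rw [if_pos (hr.mpr ⟨rfl, rfl⟩)]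
            simp only [Finsupp.smul_apply, zero_add, Finsupp.single_eq_same, smul_eq_mul,
              eval_smul]
            ring
          · rw [if_neg (fun h => hm (hr.mp h).1)]
            simp [hm]
        · rw [vermaX_pow_of_lt L m' c 1 h, if_neg (fun h' => by have := (hr.mp h').2; omega)]
          simp
      have hsum := congrArg (fun u => ((ρ u) (Finsupp.single c 1)) a) hl
      simp only [Finsupp.linearCombination_apply, Finsupp.sum, map_sum, map_smul, map_zero,
        LinearMap.zero_apply, Finsupp.zero_apply, LinearMap.sum_apply, LinearMap.smul_apply,
        Finsupp.finsetSum_apply, Finsupp.smul_apply, hterm] at hsum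
      rw [← Finset.sum_mul, ← Finset.sum_filter] at hsum
      have hne : (((a.factorial : ℂ)⁻¹) * ((c.factorial : ℂ)⁻¹ *
            ∏ i ∈ Finset.range c, ((i + 1 : ℂ) * (L - i)))) ≠ 0 := by
        refine mul_ne_zero (inv_ne_zero (by exact_mod_cast a.factorial_ne_zero)) (mul_ne_zero
          (inv_ne_zero (by exact_mod_cast c.factorial_ne_zero)) (Finset.prod_ne_zero_iff.mpr ?_))
        intro j hj
        have hj' : j < c := by simpa using hj
        refine mul_ne_zero (by exact_mod_cast Nat.succ_ne_zero j) (sub_ne_zero.mpr ?_)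
        rw [hL]
        intro h
        have : i + c = j := by exact_mod_cast h
        omega
      have := (mul_eq_zero.mp hsum).resolve_right hne
      simp only [Set.mem_ofPred_eq, F, eval_finsetSum, eval_zero]
      exact this
    have h2 := Finset.sum_preimage' f l.support hf.injOn (fun t => l t • binPoly t.2.1)
    have h3 : Finsupp.linearCombination ℂ binPoly (l.comapDomain f hf.injOn) = 0 := by
      rw [Finsupp.linearCombination_apply, Finsupp.sum]
      exact h2.trans hF
    have h4 := linearIndependent_iff.mp binPoly_linearIndependent _ h3
    exact DFunLike.congr_fun h4 b
  ext ⟨a, b, c⟩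
  exact key c a b

/-- Kostant's theorem: the elements `Y^(m) (H choose n) X^(m')` form a basis of the integral form. -/
def basisZ : Module.Basis (ℕ × ℕ × ℕ) ℤ UZ :=
  Module.Basis.mk (v := fun t => (⟨pbwC t, pbwC_mem t⟩ : UZ))
    (by
      apply LinearIndependent.of_comp UZ.val.toLinearMap
      exact pbwC_linearIndependent.restrict_scalars (R := ℤ) (fun a b h => by simpa using h))
    (by
      rintro ⟨u, hu⟩ -
      have h := mem_pbwSpan_of_mem_UZ hu
      rw [pbwSpan] at h
      have e : Set.range pbwC = UZ.val.toLinearMap ''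
          Set.range (fun t => (⟨pbwC t, pbwC_mem t⟩ : UZ)) := by
        rw [← Set.range_comp]; rfl
      rw [e, ← Submodule.map_span] at h
      obtain ⟨v, hv, hvu⟩ := h
      have : v = ⟨u, hu⟩ := Subtype.ext hvu
      exact this ▸ hv)

theorem basisZ_apply (t : ℕ × ℕ × ℕ) : basisZ t = ⟨pbwC t, pbwC_mem t⟩ := by simp [basisZ]

/-! ### The hyperalgebra of `SL₂` over `k` -/

variable (k : Type*) [Field k]

/-- The hyperalgebra of `SL₂` over `k`, i.e. the base change to `k` of the Kostant form. -/
def Hyper : Type _ := k ⊗[ℤ] UZ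

instance : Ring (Hyper k) := inferInstanceAs (Ring (k ⊗[ℤ] UZ))

instance : Algebra k (Hyper k) := inferInstanceAs (Algebra k (k ⊗[ℤ] UZ))

/-- The base change map from the Kostant form to the hyperalgebra. -/
def toHyper : UZ →+* Hyper k :=
  (Algebra.TensorProduct.includeRight : UZ →ₐ[ℤ] k ⊗[ℤ] UZ).toRingHom

/-- The element `X^(m)` of the hyperalgebra. -/
def Xd (m : ℕ) : Hyper k := toHyper k ⟨divPow xC m, divPow_x_mem m⟩

/-- The element `Y^(m)` of the hyperalgebra. -/
def Yd (m : ℕ) : Hyper k := toHyper k ⟨divPow yC m, divPow_y_mem m⟩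

/-- The element `(H + c choose m)` of the hyperalgebra. -/
def Hbin (c : ℤ) (m : ℕ) : Hyper k := toHyper k ⟨binH c m, binH_mem c m⟩

/-- The `k`-basis `Y^(m) (H choose n) X^(m')` of the hyperalgebra, indexed by `(m, n, m')`. -/
def basisHyper : Module.Basis (ℕ × ℕ × ℕ) k (Hyper k) := Algebra.TensorProduct.basis k basisZ

theorem basisHyper_apply (m n m' : ℕ) :
    basisHyper k (m, n, m') = Yd k m * Hbin k 0 n * Xd k m' := by
  rw [Yd, Hbin, Xd, ← map_mul, ← map_mul]
  refine (Algebra.TensorProduct.basis_apply (A := k) basisZ (m, n, m')).trans ?_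
  rw [basisZ_apply]
  rfl

/-- The linear map `Fr'`, with `Y^(m) (H choose n) X^(m') ↦ Y^(mp) (H choose np) X^(m'p)`. -/
def frob (p : ℕ) : Hyper k →ₗ[k] Hyper k :=
  (basisHyper k).constr k fun t => Yd k (t.1 * p) * Hbin k 0 (t.2.1 * p) * Xd k (t.2.2 * p)

/-! ### The subalgebras -/

/-- The subalgebra `U_r`, generated by `X^(p^i)` and `Y^(p^i)` with `i < r`. -/
def Usub (p r : ℕ) : Subalgebra k (Hyper k) :=
  Algebra.adjoin k {u | ∃ i < r, u = Xd k (p ^ i) ∨ u = Yd k (p ^ i)}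

/-- The subalgebra `U⁰`, generated by all `(H choose p^i)`. -/
def Uzero (p : ℕ) : Subalgebra k (Hyper k) :=
  Algebra.adjoin k (Set.range fun i : ℕ => Hbin k 0 (p ^ i))

/-- The subalgebra `A`, generated by `U⁰` and all `Y^(p^i) X^(p^i)`. -/
def Aall (p : ℕ) : Subalgebra k (Hyper k) :=
  Algebra.adjoin k ((Uzero k p : Set (Hyper k)) ∪
    Set.range fun i : ℕ => Yd k (p ^ i) * Xd k (p ^ i))

/-- The subalgebra `A_r = A ∩ U_r`. -/
def Asub (p r : ℕ) : Subalgebra k (Hyper k) := Aall k p ⊓ Usub k p r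

/-- The element `μ_a = (H - a - 1 choose p - 1)`. -/
def mu (p : ℕ) (a : ℤ) : Hyper k := Hbin k (-a - 1) (p - 1)

/-! ### The polynomials -/

section Polys

variable (p : ℕ) [Fact p.Prime]

/-- The polynomial `φ_{a,m}(x) = ∏_{i < m} (x - i (i + a + 1))`. -/
def phi (a : ℤ) (m : ℕ) : (ZMod p)[X] :=
  ∏ i ∈ Finset.range m, (X - C ((i : ZMod p) * (i + a + 1)))

/-- The polynomial `ψ(x) = ∏_{i ∈ 𝔽_p} (x - i²)`. -/
def psi : (ZMod p)[X] := ∏ i : ZMod p, (X - C (i ^ 2))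

/-- The polynomials `ψ_j^(ε)(x)`, for `p` odd. -/
def psiE (ε : Fin 2) (j : ℚ) : (ZMod p)[X] :=
  if ε = 1 then psi p /ₘ (X - C ((j : ZMod p) ^ 2))
  else if j = 0 then ∏ i ∈ Finset.univ \ {(0 : ZMod p)}, (X - C (i ^ 2))
  else 2 * X * (X + C ((j : ZMod p) ^ 2)) *
    ∏ i ∈ Finset.univ \ {(0 : ZMod p), (j : ZMod p), -(j : ZMod p)}, (X - C (i ^ 2))

/-- The set `𝒫` of pairs `(a, j)`. -/
def Pairs : Set (ℕ × ℚ) :=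
  if p = 2 then {(0, 1 / 2), (1, 0), (1, 1)}
  else {q | q.1 < p ∧ ∃ s : ℕ, s ≤ (p - 1) / 2 ∧ q.2 = s}

/-- The polynomial `f` with `B^(ε)(a, j) = f(μ_a Y X) μ_a`. For `p` odd it is
`ψ_j^(ε)(x + ((a + 1) / 2)²)`; for `p = 2` it is read off the definition of `B^(ε)(a, j)`. -/
def bPoly (ε : Fin 2) (a : ℕ) (j : ℚ) : (ZMod p)[X] :=
  if p = 2 then
    if a = 0 then (if ε = 0 then 1 else X) else (if j = 0 then X else X + 1)
  else (psiE p ε j).comp (X + C ((((a : ZMod p) + 1) / 2) ^ 2))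

open Classical in
/-- The number `n^(ε)(a, j)`: the largest `n` such that `φ_{a,n}` divides the polynomial of
`B^(ε)(a, j)`, whose degree is less than `p`. (For `p = 2` this gives `n^(0)(0, 1/2) = 0`,
`n^(1)(0, 1/2) = 1`, `n^(ε)(1, 0) = 1` and `n^(ε)(1, 1) = 0`.) -/
def nNum (ε : Fin 2) (a : ℕ) (j : ℚ) : ℕ :=
  Nat.findGreatest (fun n => phi p a n ∣ bPoly p ε a j) (p - 1)

/-- Successive quotients in the expansion of `f` along `φ_{a,0}, φ_{a,1}, …`. -/
def newtonQuot (a : ℕ) (f : (ZMod p)[X]) : ℕ → (ZMod p)[X]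
  | 0 => f
  | m + 1 => newtonQuot a f m /ₘ (X - C ((m : ZMod p) * (m + a + 1)))

/-- The coefficient `c_m^(ε)` of `Y^m X^m` in `B^(ε)(a, j)`, i.e. the coefficient of `φ_{a,m}` in
the expansion of the polynomial of `B^(ε)(a, j)` along `φ_{a,0}, φ_{a,1}, …`;
see `bOne_eq_sum` below. -/
def coef (ε : Fin 2) (a : ℕ) (j : ℚ) (m : ℕ) : ZMod p :=
  (newtonQuot p a (bPoly p ε a j) m).eval ((m : ZMod p) * (m + a + 1))

end Polys

/-! ### The elements `B^(ε)(a, j)` -/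

section Elements

variable (p : ℕ) [Fact p.Prime] [CharP k p]

/-- The value at `u` of a polynomial with coefficients in the prime field `𝔽_p` of `k`. -/
def evalP (f : (ZMod p)[X]) (u : Hyper k) : Hyper k :=
  aeval u (f.map (ZMod.castHom (dvd_refl p) k))

/-- The element `B^(ε)(a, j)` for a single pair `(a, j) ∈ 𝒫`. -/
def bOne (ε : Fin 2) (a : ℕ) (j : ℚ) : Hyper k :=
  if p = 2 then
    if a = 0 then (if ε = 0 then mu k p 0 else mu k p 0 * Yd k 1 * Xd k 1)
    else if j = 0 then mu k p 1 * Yd k 1 * Xd k 1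
    else mu k p 1 * Yd k 1 * Xd k 1 + mu k p 1
  else
    evalP k p (psiE p ε j)
      (mu k p a * Yd k 1 * Xd k 1 + algebraMap k (Hyper k) ((((a : k) + 1) / 2) ^ 2)) * mu k p a

end Elements

/-! ### The expansion of `B^(ε)(a, j)` -/

section Newton

variable (p : ℕ) [Fact p.Prime]

theorem newton_expand (a : ℕ) (f : (ZMod p)[X]) (N : ℕ) :
    f = ∑ m ∈ Finset.range N,
        C ((newtonQuot p a f m).eval ((m : ZMod p) * (m + a + 1))) * phi p a m
      + newtonQuot p a f N * phi p a N := by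
  induction N with
  | zero => simp [newtonQuot, phi]
  | succ N ih =>
    rw [Finset.sum_range_succ, add_assoc]
    have e : phi p a (N + 1) = phi p a N * (X - C ((N : ZMod p) * (N + a + 1))) := by
      rw [phi, Finset.prod_range_succ, ← phi]; simp
    have h := modByMonic_add_div (newtonQuot p a f N)
      (X - C ((N : ZMod p) * ((N : ZMod p) + a + 1)))
    rw [modByMonic_X_sub_C_eq_C_eval] at h
    rw [e, newtonQuot]
    conv_lhs => rw [ih]
    congr 1
    conv_lhs => rw [← h]
    ring

theorem natDegree_newtonQuot (a : ℕ) (f : (ZMod p)[X]) (N : ℕ) :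
    (newtonQuot p a f N).natDegree = f.natDegree - N := by
  induction N with
  | zero => simp [newtonQuot]
  | succ N ih =>
    rw [newtonQuot, natDegree_divByMonic _ (monic_X_sub_C _), ih, natDegree_X_sub_C]
    omega

theorem newton_expand_of_degree (a : ℕ) (f : (ZMod p)[X]) (N : ℕ) (hf : f.natDegree ≤ N) :
    f = ∑ m ∈ Finset.range (N + 1),
        C ((newtonQuot p a f m).eval ((m : ZMod p) * (m + a + 1))) * phi p a m := by
  have h := newton_expand p a f (N + 1)
  have h0 : newtonQuot p a f (N + 1) = 0 := by
    rw [newtonQuot, divByMonic_eq_zero_iff (monic_X_sub_C _), degree_X_sub_C]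
    refine lt_of_le_of_lt degree_le_natDegree ?_
    rw [natDegree_newtonQuot, Nat.sub_eq_zero_of_le hf]
    simp
  rw [h0, zero_mul, add_zero] at h
  exact h

theorem newton_coeff_eq_zero (a : ℕ) (f : (ZMod p)[X]) (n m : ℕ) (hmn : m < n)
    (hf : phi p a n ∣ f) : (newtonQuot p a f m).eval ((m : ZMod p) * (m + a + 1)) = 0 := by
  obtain ⟨g, rfl⟩ := hf
  have key : ∀ m ≤ n, newtonQuot p a (phi p a n * g) m =
      (∏ i ∈ Finset.Ico m n, (X - C ((i : ZMod p) * (i + a + 1)))) * g := by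
    intro m
    induction m with
    | zero => intro _; simp [newtonQuot, phi]
    | succ m ih =>
      intro h
      rw [newtonQuot, ih (by omega), Finset.prod_eq_prod_Ico_succ_bot (by omega : m < n),
        mul_assoc, mul_divByMonic_cancel_left _ (monic_X_sub_C _)]
  rw [key m hmn.le, Finset.prod_eq_prod_Ico_succ_bot hmn]
  simp

theorem natDegree_prod_le_card (s : Finset (ZMod p)) :
    (∏ i ∈ s, (X - C (i ^ 2))).natDegree = s.card := by
  rw [natDegree_prod_of_monic _ _ (fun i _ => monic_X_sub_C _)]
  simp only [natDegree_X_sub_C]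
  simp

theorem natDegree_psiE_le (hp : p ≠ 2) (ε : Fin 2) (j : ℚ) (hj : j ≠ 0 → (j : ZMod p) ≠ 0) :
    (psiE p ε j).natDegree ≤ p - 1 := by
  have hP := Fact.out (p := p.Prime)
  unfold psiE
  split_ifs with h1 h2
  · rw [natDegree_divByMonic _ (monic_X_sub_C _), psi, natDegree_prod_le_card, natDegree_X_sub_C]
    simp [ZMod.card]
  · rw [natDegree_prod_le_card, Finset.card_univ_sdiff]
    simp [ZMod.card]
  · have hj0 := hj h2
    have hne : (j : ZMod p) ≠ -(j : ZMod p) := by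
      intro h
      have h2' : (2 : ZMod p) * j = 0 := by linear_combination h
      rcases mul_eq_zero.mp h2' with h3 | h3
      · have : p ∣ 2 := (ZMod.natCast_eq_zero_iff 2 p).mp (by exact_mod_cast h3)
        exact hp ((Nat.prime_dvd_prime_iff_eq hP Nat.prime_two).mp this)
      · exact hj0 h3
    have hc : ({(0 : ZMod p), (j : ZMod p), -(j : ZMod p)} : Finset (ZMod p)).card = 3 := by
      rw [Finset.card_eq_three]
      exact ⟨_, _, _, hj0.symm, (neg_ne_zero.mpr hj0).symm, hne, rfl⟩
    have h3 : 3 ≤ p := by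
      have := hP.two_le; omega
    have e2 : (2 * X * (X + C ((j : ZMod p) ^ 2)) : (ZMod p)[X]).natDegree ≤ 2 := by
      compute_degree
    refine natDegree_mul_le.trans ?_
    rw [natDegree_prod_le_card, Finset.card_univ_sdiff, hc, ZMod.card]
    omega

theorem natDegree_bPoly_le (ε : Fin 2) (a : ℕ) (j : ℚ) (haj : (a, j) ∈ Pairs p) :
    (bPoly p ε a j).natDegree ≤ p - 1 := by
  have hP := Fact.out (p := p.Prime)
  unfold bPoly
  split_ifs with h1 h2 h3 h4
  · simp
  · simp [h1]
  · simp [h1]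
  · subst h1; compute_degree
  · rw [natDegree_comp, natDegree_X_add_C, mul_one]
    refine natDegree_psiE_le p h1 ε j ?_
    rw [Pairs, if_neg h1] at haj
    obtain ⟨-, s, hs, rfl⟩ := haj
    intro h0 h
    simp only [Rat.cast_natCast, ZMod.natCast_eq_zero_iff] at h
    have h0' : s ≠ 0 := by simpa using h0
    have := Nat.le_of_dvd (by omega) h
    have := hP.two_le
    omega

theorem bPoly_eq_sum (ε : Fin 2) (a : ℕ) (j : ℚ) (haj : (a, j) ∈ Pairs p) :
    bPoly p ε a j = ∑ m ∈ Finset.Icc (nNum p ε a j) (p - 1), C (coef p ε a j m) * phi p a m := by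
  classical
  have h := newton_expand_of_degree p a _ _ (natDegree_bPoly_le p ε a j haj)
  conv_lhs => rw [h]
  symm
  refine Finset.sum_subset_zero_on_sdiff ?_ ?_ (fun _ _ => rfl)
  · intro m hm
    have := (Finset.mem_Icc.mp hm).2
    simpa [Nat.lt_succ_iff] using this
  · intro m hm
    simp only [Finset.mem_sdiff, Finset.mem_range, Finset.mem_Icc, not_and, not_le] at hm
    have hlt : m < nNum p ε a j := by
      by_contra hcon
      have := hm.2 (not_lt.mp hcon)
      omega
    have hdvd : phi p a (nNum p ε a j) ∣ bPoly p ε a j :=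
      Nat.findGreatest_spec (P := fun n => phi p a n ∣ bPoly p ε a j) (Nat.zero_le _)
        (by simp [phi])
    rw [newton_coeff_eq_zero p a _ _ m hlt hdvd]
    simp

end Newton

section Weight

theorem toHyper_relations :
    Xd k 1 * Yd k 1 = Yd k 1 * Xd k 1 + Hbin k 0 1 ∧
    Hbin k 0 1 * Xd k 1 = Xd k 1 * (Hbin k 0 1 + 2) ∧
    Hbin k 0 1 * Yd k 1 = Yd k 1 * (Hbin k 0 1 - 2) := by
  have h1 : binH 0 1 = hC := by
    have := binH_succ 0 0
    simpa [binH_zero] using this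
  have hx : divPow xC 1 = xC := by simp [divPow]
  have hy : divPow yC 1 = yC := by simp [divPow]
  have e2 : (2 : Hyper k) = toHyper k 2 := (map_ofNat _ 2).symm
  have e3 : ((2 : UZ) : UC) = 2 := rfl
  rw [e2]
  simp only [Xd, Yd, Hbin, ← map_mul, ← map_add, ← map_sub]
  refine ⟨congrArg _ (Subtype.ext ?_), congrArg _ (Subtype.ext ?_), congrArg _ (Subtype.ext ?_)⟩
  · simpa [h1, hx, hy] using x_mul_y
  · simpa [h1, hx, hy, e3] using h_mul_x
  · simpa [h1, hx, hy, e3] using h_mul_y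

theorem commute_yx_h : Commute (Yd k 1 * Xd k 1) (Hbin k 0 1) := by
  obtain ⟨-, hx, hy⟩ := toHyper_relations k
  have : Hbin k 0 1 * (Yd k 1 * Xd k 1) = Yd k 1 * Xd k 1 * Hbin k 0 1 := by
    rw [← mul_assoc, hy, mul_assoc, sub_mul, hx]
    noncomm_ring
  exact this.symm

theorem commute_yx_Hbin (c : ℤ) (m : ℕ) : Commute (Yd k 1 * Xd k 1) (Hbin k c m) := by
  have hx : divPow xC 1 = xC := by simp [divPow]
  have hy : divPow yC 1 = yC := by simp [divPow]
  have h : Commute (yC * xC) hC := by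
    have : hC * (yC * xC) = yC * xC * hC := by
      rw [← mul_assoc, h_mul_y, mul_assoc, sub_mul, h_mul_x]
      noncomm_ring
    exact this.symm
  have h2 : Commute (yC * xC) (binH c m) := by
    rw [binH_eq]
    generalize (binPoly m).comp (X + (c : ℂ[X])) = f
    induction f using Polynomial.induction_on' with
    | add p q hp hq => rw [map_add]; exact hp.add_right hq
    | monomial n z =>
      rw [aeval_monomial]
      exact (Algebra.commute_algebraMap_right z (yC * xC)).mul_right (h.pow_right n)
  show _ = _
  simp only [Xd, Yd, Hbin, ← map_mul]
  refine congrArg _ (Subtype.ext ?_)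
  simpa [hx, hy] using h2.eq

theorem yx_pow_succ (m : ℕ) : Yd k 1 ^ (m + 1) * Xd k 1 ^ (m + 1) =
    Yd k 1 ^ m * Xd k 1 ^ m * (Yd k 1 * Xd k 1 - m * (Hbin k 0 1 + m + 1)) := by
  obtain ⟨hxy, hx, -⟩ := toHyper_relations k
  set x := Xd k 1
  set y := Yd k 1
  set h := Hbin k 0 1
  have h2x : (2 : Hyper k) * x = x * 2 := by rw [two_mul, mul_two]
  have hhx : ∀ m : ℕ, h * x ^ m = x ^ m * (h + 2 * m) := by
    intro m
    induction m with
    | zero => simp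
    | succ m ih =>
      rw [pow_succ, ← mul_assoc, ih, mul_assoc, add_mul, hx, mul_assoc, (Nat.cast_commute m x).eq,
        ← mul_assoc 2 x, h2x]
      push_cast
      noncomm_ring
  have key : ∀ m : ℕ, y * x * x ^ m = x ^ m * (y * x - m * (h + m + 1)) := by
    intro m
    induction m with
    | zero => simp
    | succ m ih =>
      have e : y * x = x * y - h := by rw [hxy]; abel
      have e1 : y * x * x = x * (y * x - h - 2) := by
        conv_lhs => rw [e]
        rw [sub_mul, hx]
        noncomm_ring
      have e2 : (m : Hyper k) * (h + m + 1) * x = x * (m * (h + m + 1 + 2)) := by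
        have e3 : (h + m + 1) * x = x * (h + m + 1 + 2) := by
          rw [add_mul, add_mul, hx, (Nat.cast_commute m x).eq]
          noncomm_ring
        rw [mul_assoc, e3, ← mul_assoc, (Nat.cast_commute m x).eq, mul_assoc]
      rw [pow_succ, ← mul_assoc, ih, mul_assoc, sub_mul, e1, e2, mul_assoc]
      push_cast
      noncomm_ring
  rw [pow_succ y, pow_succ' x, mul_assoc, ← mul_assoc y, key, mul_assoc]

theorem Hbin_succ (c : ℤ) (m : ℕ) : ((m : Hyper k) + 1) * Hbin k c (m + 1) =
    Hbin k c m * (Hbin k 0 1 + c - m) := by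
  have h1 : binH 0 1 = hC := by
    have := binH_succ 0 0
    simpa [binH_zero] using this
  have h := binH_succ c m
  rw [Algebra.smul_def] at h
  have e1 : ((m : Hyper k) + 1) = toHyper k (m + 1) := by simp
  have e2 : ((c : Hyper k)) = toHyper k c := by simp
  have e3 : ((m : Hyper k)) = toHyper k m := by simp
  rw [e1, e2, e3]
  simp only [Hbin, ← map_mul, ← map_add, ← map_sub]
  refine congrArg _ (Subtype.ext ?_)
  simpa [h1] using h

variable (p : ℕ)

theorem charP_hyper [CharP k p] : (p : Hyper k) = 0 := by
  have := map_natCast (algebraMap k (Hyper k)) p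
  rw [← this, CharP.cast_eq_zero, map_zero]

variable [Fact p.Prime] [CharP k p]

theorem mu_mul_h (a : ℤ) : mu k p a * Hbin k 0 1 = a * mu k p a := by
  have hP := Fact.out (p := p.Prime)
  have h := Hbin_succ k (-a - 1) (p - 1)
  have e : ((p - 1 : ℕ) : Hyper k) + 1 = 0 := by
    rw [← charP_hyper k p, ← Nat.cast_succ, Nat.succ_eq_add_one, Nat.sub_add_cancel hP.one_le]
  have e' : ((p - 1 : ℕ) : Hyper k) = -1 := eq_neg_of_add_eq_zero_left e
  rw [e, zero_mul, e'] at h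
  have h2 : mu k p a * (Hbin k 0 1 - a) = 0 := by
    rw [mu, h]; push_cast; congr 1; noncomm_ring
  rw [mul_sub, sub_eq_zero] at h2
  rw [h2, (Int.cast_commute a _).eq]

theorem mu_mul_Hbin (a : ℤ) (m : ℕ) (hm : m < p) :
    mu k p a * Hbin k (-a - 1) m = (-1) ^ m * mu k p a := by
  induction m with
  | zero =>
    have : Hbin k (-a - 1) 0 = 1 := by
      rw [Hbin, ← map_one (toHyper k)]
      exact congrArg _ (Subtype.ext (binH_zero _))
    simp [this]
  | succ m ih =>
    have h := congrArg (mu k p a * ·) (Hbin_succ k (-a - 1) m)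
    beta_reduce at h
    rw [← mul_assoc, ← mul_assoc, ih (by omega), ← Nat.cast_succ, ← (Nat.cast_commute _ _).eq,
      mul_assoc, mul_assoc, mul_sub, mul_add, mu_mul_h, ← (Int.cast_commute _ _).eq,
      ← (Nat.cast_commute m _).eq] at h
    have hu : ((m + 1 : ℕ) : k) ≠ 0 := by
      rw [Ne, CharP.cast_eq_zero_iff k p]
      exact fun hd => absurd (Nat.le_of_dvd (by omega) hd) (by omega)
    have e : ∀ z : Hyper k, ((m + 1 : ℕ) : Hyper k) * z = ((m + 1 : ℕ) : k) • z := by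
      intro z; rw [Algebra.smul_def, map_natCast]
    apply smul_right_injective (Hyper k) hu
    beta_reduce
    rw [← e, ← e]
    rw [h, pow_succ]
    have hc := (Nat.cast_commute (m + 1) ((-1 : Hyper k) ^ m * -1)).eq
    rw [← mul_assoc, hc, mul_assoc, mul_assoc]
    congr 1
    push_cast
    noncomm_ring

theorem mu_idem (a : ℤ) : mu k p a * mu k p a = mu k p a := by
  have hP := Fact.out (p := p.Prime)
  conv_lhs => rw [mu]
  have h := mu_mul_Hbin k p a (p - 1) (by have := hP.two_le; omega)
  rw [mu] at h ⊢
  rw [h]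
  rcases hP.eq_two_or_odd' with h2 | h2
  · subst h2
    have : (-1 : Hyper k) = 1 := by
      have := charP_hyper k 2
      rw [neg_eq_iff_add_eq_zero, one_add_one_eq_two]
      exact_mod_cast this
    simp [this]
  · have : Even (p - 1) := by
      obtain ⟨t, ht⟩ := h2
      exact ⟨t, by omega⟩
    rw [this.neg_one_pow, one_mul]

theorem evalP_mu (a : ℤ) (f : (ZMod p)[X]) :
    evalP k p f (mu k p a * Yd k 1 * Xd k 1) * mu k p a =
      mu k p a * evalP k p f (Yd k 1 * Xd k 1) := by
  have hc : Commute (Yd k 1 * Xd k 1) (mu k p a) := commute_yx_Hbin k _ _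
  rw [mul_assoc (mu k p a)]
  have hpow : ∀ n : ℕ, (mu k p a * (Yd k 1 * Xd k 1)) ^ n * mu k p a =
      mu k p a * (Yd k 1 * Xd k 1) ^ n := by
    intro n
    induction n with
    | zero => simp
    | succ n ih =>
      rw [pow_succ, mul_assoc, mul_assoc (mu k p a) _ (mu k p a), hc.eq,
        ← mul_assoc (mu k p a) (mu k p a), mu_idem, ← mul_assoc, ih, mul_assoc, ← pow_succ]
  unfold evalP
  induction f using Polynomial.induction_on' with
  | add f g hf hg => simp only [Polynomial.map_add, map_add, add_mul, mul_add, hf, hg]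
  | monomial n z =>
    simp only [map_monomial, aeval_monomial]
    rw [mul_assoc, hpow, ← mul_assoc, ← mul_assoc, Algebra.commutes]

theorem mu_mul_pow (a m : ℕ) : mu k p a * (Yd k 1 ^ m * Xd k 1 ^ m) =
    mu k p a * evalP k p (phi p a m) (Yd k 1 * Xd k 1) := by
  have hc : Commute (Yd k 1 * Xd k 1) (mu k p a) := commute_yx_Hbin k _ _
  have hh : ∀ m : ℕ, Commute (Yd k 1 ^ m * Xd k 1 ^ m) (mu k p a) := by
    intro m
    induction m with
    | zero => simp
    | succ m ih =>
      rw [yx_pow_succ]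
      refine ih.mul_left (hc.sub_left ((Nat.cast_commute m _).mul_left ?_))
      refine ((Commute.add_left ?_ (Nat.cast_commute m _))).add_left (Commute.one_left _)
      show _ = _
      simp only [mu, Hbin, ← map_mul]
      refine congrArg _ (Subtype.ext ?_)
      have h1 : binH 0 1 = hC := by
        have := binH_succ 0 0
        simpa [binH_zero] using this
      simpa [h1] using (h_comm_binH (-a - 1) (p - 1)).eq
  induction m with
  | zero => simp [phi, evalP]
  | succ m ih =>
    have e : phi p a (m + 1) = phi p a m * (X - C ((m : ZMod p) * (m + a + 1))) := by
      rw [phi, Finset.prod_range_succ, ← phi]; simp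
    have e2 : evalP k p (phi p a (m + 1)) (Yd k 1 * Xd k 1) =
        evalP k p (phi p a m) (Yd k 1 * Xd k 1) *
          (Yd k 1 * Xd k 1 - (m : Hyper k) * (m + a + 1)) := by
      simp [evalP, e]
    have e3 : mu k p a * (Yd k 1 * Xd k 1 - m * (Hbin k 0 1 + m + 1)) =
        mu k p a * (Yd k 1 * Xd k 1 - (m : Hyper k) * (m + a + 1)) := by
      have h0 := mu_mul_h k p a
      have e4 : mu k p a * (Hbin k 0 1 + m + 1) = mu k p a * ((m : Hyper k) + a + 1) := by
        rw [mul_add, mul_add, h0, mul_add, mul_add, Int.cast_natCast, (Nat.cast_commute a _).eq]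
        abel
      rw [mul_sub, mul_sub, ← mul_assoc _ (m : Hyper k), ← mul_assoc _ (m : Hyper k),
        ← (Nat.cast_commute m (mu k p a)).eq, mul_assoc, mul_assoc, e4]
    have hcm : Commute (Yd k 1 * Xd k 1 - (m : Hyper k) * (m + a + 1)) (mu k p a) := by
      refine hc.sub_left ((Nat.cast_commute m _).mul_left ?_)
      exact ((Nat.cast_commute m _).add_left (Nat.cast_commute a _)).add_left (Commute.one_left _)
    rw [yx_pow_succ, ← mul_assoc, ← (hh m).eq, mul_assoc, e3, ← hcm.eq, e2, ← mul_assoc,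
      ← mul_assoc]
    conv_rhs => rw [← ih]
    rw [mul_assoc, hcm.eq, ← mul_assoc, (hh m).eq]

/-- The expansion of `B^(ε)(a, j)` which defines the coefficients `c_m^(ε)`. -/
theorem bOne_eq_sum (ε : Fin 2) (a : ℕ) (j : ℚ) (haj : (a, j) ∈ Pairs p) :
    bOne k p ε a j = mu k p a * ∑ m ∈ Finset.Icc (nNum p ε a j) (p - 1),
      (ZMod.castHom (dvd_refl p) k (coef p ε a j m)) • (Yd k 1 ^ m * Xd k 1 ^ m) := by
  have h1 : bOne k p ε a j = mu k p a * evalP k p (bPoly p ε a j) (Yd k 1 * Xd k 1) := by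
    by_cases hp : p = 2
    · subst hp
      have hcase : (a = 0 ∨ a = 1) := by
        rw [Pairs, if_pos rfl] at haj
        simp only [Set.mem_insert_iff, Set.mem_singleton_iff, Prod.mk.injEq] at haj
        omega
      rcases hcase with rfl | rfl
      · by_cases hε : ε = 0 <;> simp [bOne, bPoly, evalP, hε, mul_assoc]
      · by_cases hj : j = 0 <;> simp [bOne, bPoly, evalP, hj, mul_assoc, mul_add]
    · rw [← evalP_mu, bOne, bPoly, if_neg hp, if_neg hp]
      congr 1
      have h2 : ZMod.castHom (dvd_refl p) k 2 = 2 := map_ofNat _ 2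
      simp [evalP, aeval_comp, Polynomial.map_comp, -ZMod.castHom_apply, h2]
  have h2 : evalP k p (bPoly p ε a j) (Yd k 1 * Xd k 1) =
      ∑ m ∈ Finset.Icc (nNum p ε a j) (p - 1), (ZMod.castHom (dvd_refl p) k (coef p ε a j m)) •
        evalP k p (phi p a m) (Yd k 1 * Xd k 1) := by
    conv_lhs => rw [bPoly_eq_sum p ε a j haj]
    simp [evalP, Polynomial.map_sum, Algebra.smul_def]
  rw [h1, h2, Finset.mul_sum, Finset.mul_sum]
  refine Finset.sum_congr rfl fun m _ => ?_
  rw [mul_smul_comm, mul_smul_comm, mu_mul_pow]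

end Weight

section Elements

variable (p : ℕ) [Fact p.Prime] [CharP k p]

/-- Condition (A): `a` is even and `(p - a + 1) / 2 ≤ j ≤ (p - 1) / 2`. -/
def condA (a : ℕ) (j : ℚ) : Prop :=
  Even a ∧ ((p : ℚ) - a + 1) / 2 ≤ j ∧ j ≤ ((p : ℚ) - 1) / 2

/-- Condition (C): `a` is odd and `0 ≤ j ≤ (a - 1) / 2`. -/
def condC (a : ℕ) (j : ℚ) : Prop := Odd a ∧ 0 ≤ j ∧ j ≤ ((a : ℚ) - 1) / 2

/-- The number `s(a, j)`, for `(a, j)` with (A) or (C). -/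
def sNum (a : ℕ) : ℕ := if p = 2 then 1 else if Even a then (p - a + 1) / 2 else (p - a) / 2

open Classical in
/-- The element `Z^(ε)(z; (a, j))`. The second case covers the pairs `(a, j)` in `𝒫` with `a` even
and `j ≤ (p - a - 1) / 2`, and those with `a` odd and `(a + 1) / 2 ≤ j`. -/
def Zel (ε : Fin 2) (a : ℕ) (j : ℚ) (z : Hyper k) : Hyper k :=
  if condA p a j ∨ condC a j then
    mu k p a * ∑ m ∈ Finset.Icc (nNum p ε a j) (p - 1),
      (ZMod.castHom (dvd_refl p) k (coef p ε a j m)) •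
        (Yd k 1 ^ m * Xd k 1 ^ (m - sNum p a) * frob k p z * Xd k 1 ^ sNum p a)
  else frob k p z * bOne k p ε a j

/-- The element `B^(ε)(a, j)` for an `r`-tuple `(a, j) ∈ 𝒫^r` with `r ≥ 1`. -/
def bElt : (r : ℕ) → (Fin r → Fin 2) → (Fin r → ℕ) → (Fin r → ℚ) → Hyper k
  | 0, _, _, _ => 1
  | 1, ε, a, j => bOne k p (ε 0) (a 0) (j 0)
  | r + 2, ε, a, j =>
      Zel k p (ε 0) (a 0) (j 0) (bElt (r + 1) (Fin.tail ε) (Fin.tail a) (Fin.tail j))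

/-- The element `E(a, j) = B^(0,…,0)(a, j)`. -/
def eElt (r : ℕ) (a : Fin r → ℕ) (j : Fin r → ℚ) : Hyper k := bElt k p r 0 a j

end Elements

/-- The set `𝒳_r(a, j)`. -/
def Xset (p r : ℕ) (a : Fin r → ℕ) (j : Fin r → ℚ) : Set (Fin r → Fin 2) :=
  if p = 2 then {ε | ∀ i, a i = 1 → ε i = 0} else {ε | ∀ i, j i = 0 → ε i = 0}

/-- The number `w`: the Hamming weight of `j` if `p` is odd, and `r` minus the Hamming weight of
`a` if `p = 2`. -/
def wNum (p r : ℕ) (a : Fin r → ℕ) (j : Fin r → ℚ) : ℕ :=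
  if p = 2 then r - hammingNorm a else hammingNorm j

/-- The left `A_r`-submodule `A_r · u` of the hyperalgebra, as a `k`-subspace. -/
def Aspan (p r : ℕ) (u : Hyper k) : Submodule k (Hyper k) :=
  (Asub k p r).toSubmodule.map (LinearMap.mulRight k u)

/-- The `i`-th power of the Jacobson radical of the algebra `e R e`, whose identity is the
idempotent `e`, as a subset of `R`. -/
def radPow {R : Type*} [Ring R] {e : R} (he : IsIdempotentElem e) (i : ℕ) : Set R :=
  Subtype.val '' ((Ring.jacobson he.Corner ^ i : Ideal he.Corner) : Set he.Corner)

end HyperSL2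

end

/-! The weight-zero part `Wsub`, spanned by the products of Cartan elements with Y^(m)X^(m), is
commutative and equals 𝒜 (`Wsub_comm`, `Aall_eq_Wsub`), which settles centrality. A Cartan element
is determined by its values at the integral weights. By Lucas' theorem μ_a is then the indicator
function of a + pℤ, and Fr' is pull-back along h ↦ ⌊h/p⌋ (`evH_mu`, `evH_frob`).

A single pair (a, j) is governed by polynomials. Against μ_a the element Y^m X^m becomes
φ_{a,m}(YX), and X^p = 0, so a polynomial in YX matters only modulo φ_{a,p}. For p odd, φ_{a,p} is a
translate of ψ = x(x^((p-1)/2) - 1)², in which 0 is a simple root and every nonzero j² a double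
root. Hence ψ_j^(0) is the idempotent of the local factor of 𝔽_p[x]/ψ at j². For j ≠ 0 this factor
is a copy of the dual numbers, with radical spanned by ψ_j^(1); for j = 0 it is a field. For p = 2
the same part is played by x² (a = 0) and x(x + 1) (a = 1). `PairFacts` collects what is needed.

Fr' is not multiplicative on weight zero elements, but it becomes so after right multiplication by
X^s g(YX) μ_a in the cases at hand (`FrobCompat.frob_mul`). The exponent s serves this purpose: X^s
moves the weight a to a residue 0 or 1 modulo p, where few obstructing terms remain. It follows that
Z^(0)(z) Z^(ε)(w) = Z^(ε)(zw), that Z^(1)(z) Z^(1)(w) = 0 for a nonsplit pair, that Z^(ε) is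
injective on weight zero elements, and that A_(r+1) Z^(0)(1) lies in Z^(0)(A_r) + Z^(1)(A_r).

By induction on r the elements B^(θ), θ ∈ 𝒳_r, span A_r E, are nonzero, and multiply like squarefree
monomials: B^(θ) B^(θ') is B^(θ+θ') for disjoint supports and 0 otherwise. The weight of θ therefore
gives a multiplicative filtration whose positive part is nilpotent, with A_r E = kE + (positive
part). So A_r E is local, its radical is the positive part, and splitting monomials into factors of
weight one identifies the powers of the radical with the filtration. -/

noncomputable section

namespace HyperSL2

open Polynomial
open scoped TensorProduct

section

/-! ### Binomial coefficients with integral top in characteristic `p` -/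

section IntChoose

variable (k : Type*) [Field k]

/-- The binomial coefficient `(h choose n)` for an integer `h`, as an element of `k`. -/
def intChoose (h : ℤ) (n : ℕ) : k := ((Ring.choose h n : ℤ) : k)

theorem intChoose_natCast (h n : ℕ) : intChoose k h n = h.choose n := by
  rw [intChoose, Ring.choose_natCast, Int.cast_natCast]

@[simp] theorem intChoose_zero_right (h : ℤ) : intChoose k h 0 = 1 := by simp [intChoose]

@[simp] theorem intChoose_one_right (h : ℤ) : intChoose k h 1 = h := by simp [intChoose]

variable (p : ℕ) [CharP k p]

theorem natCast_eq_of_modEq {m n : ℕ} (h : m ≡ n [MOD p]) : (m : k) = n :=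
  (CharP.natCast_eq_natCast k p).mpr h

variable [Fact p.Prime]

theorem choose_pow_cast_eq_zero {N i : ℕ} (h0 : i ≠ 0) (hi : i < p ^ N) :
    ((p ^ N).choose i : k) = 0 :=
  (CharP.cast_eq_zero_iff k p _).mpr
    ((Fact.out : p.Prime).dvd_choose_pow h0 hi.ne)

/-- In the Vandermonde convolution every term except one contains a factor (p^N choose j) with 0 < j
< p^N, which vanishes in k. -/
theorem intChoose_add_pow {N n : ℕ} (hn : n < p ^ N) (h : ℤ) :
    intChoose k (h + (p ^ N : ℕ)) n = intChoose k h n := by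
  rw [intChoose, Ring.add_choose_eq n (Commute.all _ _), Int.cast_sum,
    Finset.sum_eq_single (n, 0)]
  · simp [intChoose]
  · rintro ⟨i, j⟩ hij hne
    rw [Finset.HasAntidiagonal.mem_antidiagonal] at hij
    simp only at hij
    have hj : j ≠ 0 := by
      rintro rfl
      exact hne (by simpa using hij)
    rw [Ring.choose_natCast, Int.cast_mul, Int.cast_natCast,
      choose_pow_cast_eq_zero k p hj (by omega), mul_zero]
  · intro hh
    simp at hh

theorem intChoose_add_pow_mul {N n : ℕ} (hn : n < p ^ N) (h t : ℤ) :
    intChoose k (h + (p ^ N : ℕ) * t) n = intChoose k h n := by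
  induction t with
  | zero => simp
  | succ i ih => 
    rw [← ih, ← intChoose_add_pow k p hn (h + (p ^ N : ℕ) * (i : ℤ))]; congr 1; ring
  | pred i ih => rw [← ih, ← intChoose_add_pow k p hn]; congr 1; ring

/-- Lucas' theorem, with integers on top. -/
theorem intChoose_lucas (h : ℤ) (n : ℕ) : intChoose k h n =
    intChoose k (h % p) (n % p) * intChoose k (h / p) (n / p) := by
  have hP := (Fact.out : p.Prime)
  have hp0 : (p : ℤ) ≠ 0 := by exact_mod_cast hP.ne_zero
  have hn : n < p ^ (n + 1) := (Nat.lt_pow_self hP.one_lt).trans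
    (Nat.pow_lt_pow_right hP.one_lt (Nat.lt_succ_self n))
  -- Both sides are periodic in h with period p^(n+1), so h may be replaced by a natural number, for
  -- which Lucas' theorem is known.
  obtain ⟨m, t, rfl⟩ : ∃ (m : ℕ) (t : ℤ), h = m + (p ^ (n + 1) : ℕ) * t := by
    refine ⟨(h % (p ^ (n + 1) : ℕ)).toNat, h / (p ^ (n + 1) : ℕ), ?_⟩
    rw [Int.toNat_of_nonneg (Int.emod_nonneg _ (by exact_mod_cast (pow_pos hP.pos _).ne')),
      Int.emod_add_mul_ediv]
  have e : (((p ^ (n + 1) : ℕ) : ℤ) * t) = p * ((p ^ n : ℕ) * t) := by push_cast; ring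
  rw [intChoose_add_pow_mul k p hn, e, Int.add_mul_emod_self_left, Int.add_mul_ediv_left _ _ hp0]
  have hn' : n / p < p ^ n := (Nat.div_le_self n p).trans_lt (Nat.lt_pow_self hP.one_lt)
  rw [intChoose_add_pow_mul k p hn']
  have := natCast_eq_of_modEq k p (Choose.choose_modEq_choose_mod_mul_choose_div_nat (n := m)
    (k := n) (p := p))
  rw [← Int.natCast_mod, ← Int.natCast_div, intChoose_natCast, intChoose_natCast,
    intChoose_natCast]
  exact_mod_cast this

theorem intChoose_mul (h : ℤ) (n : ℕ) : intChoose k h (n * p) = intChoose k (h / p) n := by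
  rw [intChoose_lucas k p h, Nat.mul_mod_left, Nat.mul_div_cancel _ (Fact.out : p.Prime).pos]
  simp

theorem nat_choose_lucas (a b m n : ℕ) (ha : a < p) (hb : b < p) :
    ((a + p * m).choose (b + p * n) : k) = a.choose b * m.choose n := by
  have := natCast_eq_of_modEq k p (Choose.choose_modEq_choose_mod_mul_choose_div_nat
    (n := a + p * m) (k := b + p * n) (p := p))
  have hp := (Fact.out : p.Prime).pos
  rw [Nat.add_mul_mod_self_left, Nat.add_mul_mod_self_left, Nat.mod_eq_of_lt ha,
    Nat.mod_eq_of_lt hb, Nat.add_mul_div_left _ _ hp, Nat.add_mul_div_left _ _ hp,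
    Nat.div_eq_of_lt ha, Nat.div_eq_of_lt hb, zero_add, zero_add] at this
  exact_mod_cast this

/-- A carry occurs when two numbers below `p ^ N` have a sum of at least `p ^ N`. -/
theorem choose_cast_eq_zero_of_carry {N m n : ℕ} (hm : m < p ^ N) (hn : n < p ^ N)
    (h : p ^ N ≤ m + n) : ((m + n).choose m : k) = 0 := by
  -- Removing p^N from the top does not change the residue, and the new top m + n - p^N is smaller
  -- than m.
  have h1 := intChoose_add_pow k p hm ((m + n - p ^ N : ℕ) : ℤ)
  rw [← Nat.cast_add, Nat.sub_add_cancel h, intChoose_natCast, intChoose_natCast,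
    Nat.choose_eq_zero_of_lt (by omega : m + n - p ^ N < m)] at h1
  simpa using h1

end IntChoose

/-! ### The Cartan part as functions of the integral weight -/

theorem binPoly_eval_int (h : ℤ) (n : ℕ) : (binPoly n).eval (h : ℂ) = (Ring.choose h n : ℤ) := by
  have h1 : ((Ring.choose h n : ℤ) : ℂ) = Ring.choose (h : ℂ) n := by
    simpa using Ring.map_choose (Int.castRingHom ℂ) h n
  rw [h1, Ring.choose_eq_smul, binPoly, eval_C_mul, smul_eq_mul, ← aeval_eq_smeval,
    ← descPochhammer_map (Int.castRingHom ℂ), eval_map, aeval_def]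
  rfl

theorem aeval_hC_mem {f : ℂ[X]} (hf : f ∈ binSpan) : aeval hC f ∈ UZ := by
  induction hf using Submodule.span_induction with
  | mem f hf =>
    obtain ⟨m, rfl⟩ := hf
    simpa [binH] using binH_mem 0 m
  | zero => simp
  | add f g _ _ hf hg => rw [map_add]; exact add_mem hf hg
  | smul n f _ hf => rw [map_zsmul]; exact zsmul_mem hf n

/-- The value of an integral combination of binomials as an element of the Kostant form. -/
def polyU (f : binSpan) : UZ := ⟨aeval hC f.1, aeval_hC_mem f.2⟩

variable (k : Type*) [Field k]

theorem Hbin_eq_polyU (c : ℤ) (m : ℕ) : Hbin k c m =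
    toHyper k (polyU ⟨_, comp_add_int_mem (binPoly_mem m) c⟩) := by
  rw [Hbin]
  exact congrArg _ (Subtype.ext (binH_eq c m))

theorem toHyper_basis (t : ℕ × ℕ × ℕ) : toHyper k (basisZ t) = basisHyper k t :=
  (Algebra.TensorProduct.basis_apply (A := k) basisZ t).symm

theorem Hbin_zero (c : ℤ) : Hbin k c 0 = 1 := by
  rw [Hbin, ← map_one (toHyper k)]
  exact congrArg _ (Subtype.ext (binH_zero _))

theorem Xd_zero : Xd k 0 = 1 := by
  rw [Xd, ← map_one (toHyper k)]
  exact congrArg _ (Subtype.ext (divPow_zero _))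

theorem Yd_zero : Yd k 0 = 1 := by
  rw [Yd, ← map_one (toHyper k)]
  exact congrArg _ (Subtype.ext (divPow_zero _))

theorem Hbin_eq_basis (n : ℕ) : Hbin k 0 n = basisHyper k (0, n, 0) := by
  rw [basisHyper_apply, Xd_zero, Yd_zero, one_mul, mul_one]

/-- The coefficient functional of the Kostant form evaluating its Cartan component at weight `h`. -/
def evZ (h : ℤ) : UZ →ₗ[ℤ] ℤ :=
  basisZ.constr ℤ fun t => if t.1 = 0 ∧ t.2.2 = 0 then Ring.choose h t.2.1 else 0

/-- The functional of the hyperalgebra evaluating the Cartan component at the weight `h`. -/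
def evH (h : ℤ) : Hyper k →ₗ[k] k :=
  (basisHyper k).constr k fun t => if t.1 = 0 ∧ t.2.2 = 0 then intChoose k h t.2.1 else 0

/-- Evaluations over k are reductions of integral ones, which for integer-valued polynomials in H
are ordinary polynomial evaluations (`evZ_polyU`). -/
theorem evH_toHyper (h : ℤ) (u : UZ) : evH k h (toHyper k u) = (evZ h u : k) := by
  have hu : u ∈ Submodule.span ℤ (Set.range basisZ) := by
    rw [basisZ.span_eq]; exact Submodule.mem_top
  induction hu using Submodule.span_induction with
  | zero => simp
  | add u v _ _ hu hv => simp [hu, hv]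
  | smul n u _ hu => rw [map_zsmul, map_zsmul, map_zsmul, hu]; simp
  | mem u hu =>
    obtain ⟨t, rfl⟩ := hu
    rw [toHyper_basis, evH, evZ, Module.Basis.constr_basis, Module.Basis.constr_basis]
    split_ifs <;> simp [intChoose]

theorem evZ_polyU (h : ℤ) (f : binSpan) : (evZ h (polyU f) : ℂ) = f.1.eval (h : ℂ) := by
  obtain ⟨f, hf⟩ := f
  induction hf using Submodule.span_induction with
  | mem f hf =>
    obtain ⟨m, rfl⟩ := hf
    have : polyU ⟨binPoly m, binPoly_mem m⟩ = basisZ (0, m, 0) := by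
      rw [basisZ_apply]
      exact Subtype.ext (by simp [polyU, pbwC, divPow_zero, binH])
    rw [this, evZ, Module.Basis.constr_basis, binPoly_eval_int]
    simp
  | zero =>
    have : polyU ⟨0, zero_mem _⟩ = 0 := Subtype.ext (by simp [polyU])
    simp [this]
  | add f g hf' hg' hf hg =>
    have : polyU ⟨f + g, add_mem hf' hg'⟩ = polyU ⟨f, hf'⟩ + polyU ⟨g, hg'⟩ :=
      Subtype.ext (by simp [polyU])
    simp only [this, map_add, Int.cast_add, eval_add, hf, hg]
  | smul n f hf' hf =>
    have : polyU ⟨n • f, binSpan.smul_mem n hf'⟩ = n • polyU ⟨f, hf'⟩ :=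
      Subtype.ext (by simp [polyU])
    rw [this, map_zsmul, smul_eq_mul, Int.cast_mul, hf]
    simp [zsmul_eq_mul]

theorem toHyper_polyU_mem (f : binSpan) :
    toHyper k (polyU f) ∈ Submodule.span k (Set.range (Hbin k 0)) := by
  obtain ⟨f, hf⟩ := f
  induction hf using Submodule.span_induction with
  | mem f hf =>
    obtain ⟨m, rfl⟩ := hf
    refine Submodule.subset_span ⟨m, ?_⟩
    rw [Hbin]
    exact congrArg _ (Subtype.ext (by simp [polyU, binH]))
  | zero =>
    have : polyU ⟨0, zero_mem _⟩ = 0 := Subtype.ext (by simp [polyU])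
    simp [this]
  | add f g hf' hg' hf hg =>
    have : polyU ⟨f + g, add_mem hf' hg'⟩ = polyU ⟨f, hf'⟩ + polyU ⟨g, hg'⟩ :=
      Subtype.ext (by simp [polyU])
    rw [this, map_add]; exact add_mem hf hg
  | smul n f hf' hf =>
    have : polyU ⟨n • f, binSpan.smul_mem n hf'⟩ = n • polyU ⟨f, hf'⟩ :=
      Subtype.ext (by simp [polyU])
    rw [this, map_zsmul]; exact zsmul_mem hf n

theorem Hbin_mem_span (c : ℤ) (m : ℕ) : Hbin k c m ∈ Submodule.span k (Set.range (Hbin k 0)) := by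
  rw [Hbin_eq_polyU]; exact toHyper_polyU_mem k _

theorem evH_Hbin (h c : ℤ) (m : ℕ) : evH k h (Hbin k c m) = intChoose k (h + c) m := by
  rw [Hbin_eq_polyU, evH_toHyper, intChoose]
  congr 1
  have := evZ_polyU h ⟨_, comp_add_int_mem (binPoly_mem m) c⟩
  simp only [eval_comp, eval_add, eval_X, eval_intCast] at this
  rw [← Int.cast_add, binPoly_eval_int] at this
  exact_mod_cast this

theorem Hbin_mul_Hbin (c d : ℤ) (m n : ℕ) : ∃ f : binSpan,
    Hbin k c m * Hbin k d n = toHyper k (polyU f) ∧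
      ∀ h, evH k h (toHyper k (polyU f)) = intChoose k (h + c) m * intChoose k (h + d) n := by
  refine ⟨⟨_, mul_mem_binSpan (comp_add_int_mem (binPoly_mem m) c)
    (comp_add_int_mem (binPoly_mem n) d)⟩, ?_, fun h => ?_⟩
  · rw [Hbin_eq_polyU, Hbin_eq_polyU, ← map_mul]
    exact congrArg _ (Subtype.ext (by simp [polyU]))
  · rw [evH_toHyper, intChoose, intChoose, ← Int.cast_mul]
    congr 1
    have := evZ_polyU h ⟨_, mul_mem_binSpan (comp_add_int_mem (binPoly_mem m) c)
      (comp_add_int_mem (binPoly_mem n) d)⟩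
    simp only [eval_comp, eval_add, eval_X, eval_intCast, eval_mul] at this
    rw [← Int.cast_add, ← Int.cast_add, binPoly_eval_int, binPoly_eval_int] at this
    exact_mod_cast this

/-- The Cartan part of the hyperalgebra, spanned by all `(H choose n)`. -/
def Ucar : Subalgebra k (Hyper k) :=
  (Submodule.span k (Set.range (Hbin k 0))).toSubalgebra
    (Submodule.subset_span ⟨0, Hbin_zero k 0⟩) (by
      intro u v hu hv
      induction hu, hv using Submodule.span_induction₂ with
      | mem_mem u v hu hv =>
        obtain ⟨m, rfl⟩ := hu
        obtain ⟨n, rfl⟩ := hv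
        obtain ⟨f, hf, -⟩ := Hbin_mul_Hbin k 0 0 m n
        rw [hf]; exact toHyper_polyU_mem k f
      | zero_left v hv => simp
      | zero_right u hu => simp
      | add_left u v w _ _ _ h1 h2 => rw [add_mul]; exact add_mem h1 h2
      | add_right u v w _ _ _ h1 h2 => rw [mul_add]; exact add_mem h1 h2
      | smul_left c u v _ _ h => rw [smul_mul_assoc]; exact Submodule.smul_mem _ c h
      | smul_right c u v _ _ h => rw [mul_smul_comm]; exact Submodule.smul_mem _ c h)

theorem mem_Ucar {u : Hyper k} : u ∈ Ucar k ↔ u ∈ Submodule.span k (Set.range (Hbin k 0)) :=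
  Iff.rfl

theorem Hbin_mem_Ucar (c : ℤ) (m : ℕ) : Hbin k c m ∈ Ucar k := Hbin_mem_span k c m

/-- By bilinearity this concerns products of two binomials, which lift to products of polynomials
over ℂ, where evaluation is multiplicative. -/
theorem evH_mul (h : ℤ) {u v : Hyper k} (hu : u ∈ Ucar k) (hv : v ∈ Ucar k) :
    evH k h (u * v) = evH k h u * evH k h v := by
  rw [mem_Ucar] at hu hv
  induction hu, hv using Submodule.span_induction₂ with
  | mem_mem u v hu hv =>
    obtain ⟨m, rfl⟩ := hu
    obtain ⟨n, rfl⟩ := hv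
    obtain ⟨f, hf, hf2⟩ := Hbin_mul_Hbin k 0 0 m n
    rw [hf, hf2, evH_Hbin, evH_Hbin]
  | zero_left v hv => simp
  | zero_right u hu => simp
  | add_left u v w _ _ _ h1 h2 => rw [add_mul, map_add, map_add, h1, h2, add_mul]
  | add_right u v w _ _ _ h1 h2 => rw [mul_add, map_add, map_add, h1, h2, mul_add]
  | smul_left c u v _ _ h =>
    rw [smul_mul_assoc, map_smul, map_smul, h, smul_eq_mul, smul_eq_mul, mul_assoc]
  | smul_right c u v _ _ h =>
    rw [mul_smul_comm, map_smul, map_smul, h, smul_eq_mul, smul_eq_mul, mul_left_comm]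

theorem evH_one (h : ℤ) : evH k h 1 = 1 := by
  rw [← Hbin_zero k 0, evH_Hbin, intChoose_zero_right]

/-- The matrix of the values (n choose i) is unitriangular, so the coefficients vanish one after the
other. -/
theorem eq_zero_of_evH {u : Hyper k} (hu : u ∈ Ucar k) (h : ∀ n : ℕ, evH k n u = 0) : u = 0 := by
  obtain ⟨c, rfl⟩ := Finsupp.mem_span_range_iff_exists_finsupp.mp ((mem_Ucar k).mp hu)
  have key : ∀ n, c n = 0 := by
    intro n
    induction n using Nat.strong_induction_on with
    | _ n ih =>
    have := h n
    rw [Finsupp.sum, map_sum, Finset.sum_eq_single n] at this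
    · simpa [evH_Hbin, intChoose_natCast] using this
    · intro i _ hne
      rcases lt_or_gt_of_ne hne with hi | hi
      · simp [ih i hi]
      · simp [evH_Hbin, intChoose_natCast, Nat.choose_eq_zero_of_lt hi]
    · intro hn
      simp [Finsupp.notMem_support_iff.mp hn]
  have : c = 0 := Finsupp.ext key
  simp [this]

/-- The standard tool for identities between Cartan elements: they are checked as identities of
functions ℤ → k. -/
theorem ext_evH {u v : Hyper k} (hu : u ∈ Ucar k) (hv : v ∈ Ucar k)
    (h : ∀ n : ℤ, evH k n u = evH k n v) : u = v :=
  sub_eq_zero.mp (eq_zero_of_evH k (sub_mem hu hv) fun n => by rw [map_sub, h, sub_self])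

theorem Ucar_comm {u v : Hyper k} (hu : u ∈ Ucar k) (hv : v ∈ Ucar k) : Commute u v :=
  ext_evH k (mul_mem hu hv) (mul_mem hv hu) fun n => by
    rw [evH_mul k n hu hv, evH_mul k n hv hu, mul_comm]

end

/-! ### Commutation formulas and the commutative algebra of weight zero -/

section

variable (k : Type*) [Field k]

theorem Xd_mul_Xd (m n : ℕ) : Xd k m * Xd k n = ((m + n).choose m : k) • Xd k (m + n) := by
  rw [Xd, Xd, Xd, ← map_mul, Nat.cast_smul_eq_nsmul, ← map_nsmul]
  exact congrArg _ (Subtype.ext (divPow_mul_divPow xC m n))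

theorem Yd_mul_Yd (m n : ℕ) : Yd k m * Yd k n = ((m + n).choose m : k) • Yd k (m + n) := by
  rw [Yd, Yd, Yd, ← map_mul, Nat.cast_smul_eq_nsmul, ← map_nsmul]
  exact congrArg _ (Subtype.ext (divPow_mul_divPow yC m n))

theorem Xd_mul_Hbin (a : ℕ) (c : ℤ) (m : ℕ) :
    Xd k a * Hbin k c m = Hbin k (c - 2 * a) m * Xd k a := by
  simp only [Xd, Hbin, ← map_mul]
  exact congrArg _ (Subtype.ext (divPow_x_mul_binH a c m))

theorem aeval_h_mul_y (f : ℂ[X]) : aeval hC f * yC = yC * aeval hC (f.comp (X - 2)) := by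
  induction f using Polynomial.induction_on' with
  | add p q hp hq => simp only [map_add, add_mul, add_comp, hp, hq, mul_add]
  | monomial n a =>
    have h : ∀ n : ℕ, hC ^ n * yC = yC * (hC - 2) ^ n := by
      intro n
      induction n with
      | zero => simp
      | succ n ih => rw [pow_succ, mul_assoc, h_mul_y, ← mul_assoc, ih, mul_assoc, ← pow_succ]
    have h2 : aeval hC (2 : ℂ[X]) = 2 := map_ofNat _ 2
    simp [← C_mul_X_pow_eq_monomial, h, h2, ← Algebra.smul_def]

theorem binH_mul_y (c : ℤ) (m : ℕ) : binH c m * yC = yC * binH (c - 2) m := by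
  rw [binH_eq, aeval_h_mul_y, binH_eq, comp_assoc]
  congr 3
  simp
  ring

theorem binH_mul_divPow_y (a : ℕ) (c : ℤ) (m : ℕ) :
    binH c m * divPow yC a = divPow yC a * binH (c - 2 * a) m := by
  have h : ∀ (a : ℕ) (c : ℤ), binH c m * yC ^ a = yC ^ a * binH (c - 2 * a) m := by
    intro a
    induction a with
    | zero => simp
    | succ a ih =>
      intro c
      rw [pow_succ', ← mul_assoc, binH_mul_y, mul_assoc, ih, mul_assoc]
      congr 3
      push_cast; ring
  rw [divPow, smul_mul_assoc, mul_smul_comm, h]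

theorem Hbin_mul_Yd (a : ℕ) (c : ℤ) (m : ℕ) :
    Hbin k c m * Yd k a = Yd k a * Hbin k (c - 2 * a) m := by
  simp only [Yd, Hbin, ← map_mul]
  exact congrArg _ (Subtype.ext (binH_mul_divPow_y a c m))

/-- Kostant's commutation formula in the hyperalgebra. -/
theorem Xd_mul_Yd (a b : ℕ) : Xd k a * Yd k b = ∑ i ∈ Finset.range (min a b + 1),
    Yd k (b - i) * Hbin k (2 * i - a - b) i * Xd k (a - i) := by
  simp only [Xd, Hbin, Yd, ← map_mul, ← map_sum]
  refine congrArg _ (Subtype.ext ?_)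
  have h := divPow_x_mul_divPowZ_y a b
  rw [divPowZ_natCast] at h
  rw [AddSubmonoidClass.coe_finsetSum]
  refine h.trans ?_
  symm
  refine Finset.sum_subset_zero_on_sdiff ?_ ?_ ?_
  · intro i hi
    rw [Finset.mem_range] at hi ⊢
    omega
  · intro i hi
    simp only [Finset.mem_sdiff, Finset.mem_range] at hi
    rw [divPowZ_of_neg yC _ (by omega), zero_mul, zero_mul]
  · intro i hi
    rw [Finset.mem_range] at hi
    rw [show (b : ℤ) - i = ((b - i : ℕ) : ℤ) by omega,
      show (a : ℤ) - i = ((a - i : ℕ) : ℤ) by omega, divPowZ_natCast, divPowZ_natCast]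
    rfl

/-- The translation by `d` of the Cartan part. -/
def shift (d : ℤ) : Hyper k →ₗ[k] Hyper k :=
  (basisHyper k).constr k fun t => Hbin k d t.2.1

theorem shift_Hbin_zero (d : ℤ) (n : ℕ) : shift k d (Hbin k 0 n) = Hbin k d n := by
  rw [Hbin_eq_basis, shift, Module.Basis.constr_basis]

variable {k}

theorem shift_mem {u : Hyper k} (hu : u ∈ Ucar k) (d : ℤ) : shift k d u ∈ Ucar k := by
  rw [mem_Ucar] at hu
  induction hu using Submodule.span_induction with
  | mem u hu =>
    obtain ⟨n, rfl⟩ := hu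
    rw [shift_Hbin_zero]
    exact Hbin_mem_Ucar k d n
  | zero => rw [map_zero]; exact zero_mem _
  | add u v _ _ hu hv => rw [map_add]; exact add_mem hu hv
  | smul c u _ hu => rw [map_smul]; exact Subalgebra.smul_mem _ hu c

theorem evH_shift {u : Hyper k} (hu : u ∈ Ucar k) (h d : ℤ) :
    evH k h (shift k d u) = evH k (h + d) u := by
  rw [mem_Ucar] at hu
  induction hu using Submodule.span_induction with
  | mem u hu =>
    obtain ⟨n, rfl⟩ := hu
    rw [shift_Hbin_zero, evH_Hbin, evH_Hbin, add_zero]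
  | zero => simp
  | add u v _ _ hu hv => rw [map_add, map_add, map_add, hu, hv]
  | smul c u _ hu => rw [map_smul, map_smul, map_smul, hu]

theorem shift_Hbin (d c : ℤ) (n : ℕ) : shift k d (Hbin k c n) = Hbin k (c + d) n :=
  ext_evH k (shift_mem (Hbin_mem_Ucar k c n) d) (Hbin_mem_Ucar k _ n) fun h => by
    rw [evH_shift (Hbin_mem_Ucar k c n), evH_Hbin, evH_Hbin]; congr 1; ring

theorem shift_shift {u : Hyper k} (hu : u ∈ Ucar k) (d e : ℤ) :
    shift k d (shift k e u) = shift k (d + e) u :=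
  ext_evH k (shift_mem (shift_mem hu e) d) (shift_mem hu _) fun h => by
    rw [evH_shift (shift_mem hu e), evH_shift hu, evH_shift hu, add_assoc]

theorem shift_zero {u : Hyper k} (hu : u ∈ Ucar k) : shift k 0 u = u :=
  ext_evH k (shift_mem hu 0) hu fun h => by rw [evH_shift hu, add_zero]

theorem Ucar_mul_Yd {u : Hyper k} (hu : u ∈ Ucar k) (a : ℕ) :
    u * Yd k a = Yd k a * shift k (-(2 * a)) u := by
  rw [mem_Ucar] at hu
  induction hu using Submodule.span_induction with
  | mem u hu =>
    obtain ⟨n, rfl⟩ := hu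
    rw [shift_Hbin_zero, Hbin_mul_Yd, zero_sub]
  | zero => simp
  | add u v _ _ hu hv => rw [map_add, add_mul, mul_add, hu, hv]
  | smul c u _ hu => rw [map_smul, smul_mul_assoc, mul_smul_comm, hu]

theorem Xd_mul_Ucar {u : Hyper k} (hu : u ∈ Ucar k) (a : ℕ) :
    Xd k a * u = shift k (-(2 * a)) u * Xd k a := by
  rw [mem_Ucar] at hu
  induction hu using Submodule.span_induction with
  | mem u hu =>
    obtain ⟨n, rfl⟩ := hu
    rw [shift_Hbin_zero, Xd_mul_Hbin, zero_sub]
  | zero => simp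
  | add u v _ _ hu hv => rw [map_add, add_mul, mul_add, hu, hv]
  | smul c u _ hu => rw [map_smul, smul_mul_assoc, mul_smul_comm, hu]

theorem Ucar_mul_Xd {u : Hyper k} (hu : u ∈ Ucar k) (a : ℕ) :
    u * Xd k a = Xd k a * shift k (2 * a) u := by
  rw [Xd_mul_Ucar (shift_mem hu _), shift_shift hu, neg_add_cancel, shift_zero hu]

theorem Yd_mul_Ucar {u : Hyper k} (hu : u ∈ Ucar k) (a : ℕ) :
    Yd k a * u = shift k (2 * a) u * Yd k a := by
  rw [Ucar_mul_Yd (shift_mem hu _), shift_shift hu, neg_add_cancel, shift_zero hu]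

variable (k) in
/-- The element `Y^(m) X^(m)`. -/
def Cm (m : ℕ) : Hyper k := Yd k m * Xd k m

theorem Yd_mul_mul_Xd {u : Hyper k} (hu : u ∈ Ucar k) (m : ℕ) :
    Yd k m * u * Xd k m = shift k (2 * m) u * Cm k m := by
  rw [Yd_mul_Ucar hu, mul_assoc, Cm]

theorem Ucar_mul_Cm {u : Hyper k} (hu : u ∈ Ucar k) (m : ℕ) :
    u * Cm k m = Yd k m * shift k (-(2 * m)) u * Xd k m := by
  rw [Cm, ← mul_assoc, Ucar_mul_Yd hu]

theorem commute_Ucar_Cm {u : Hyper k} (hu : u ∈ Ucar k) (m : ℕ) : Commute u (Cm k m) := by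
  have h : Cm k m * u = Yd k m * shift k (-(2 * m)) u * Xd k m := by
    rw [Cm, mul_assoc, Xd_mul_Ucar hu, mul_assoc]
  exact (Ucar_mul_Cm hu m).trans h.symm

/-- Kostant's formula is applied to the inner factor X^(m) Y^(n). Moving the Cartan factor to the
front turns its shift into m + n, so the result is symmetric in m and n, whence `commute_Cm_Cm`. -/
theorem Cm_mul_Cm (m n : ℕ) : Cm k m * Cm k n = ∑ i ∈ Finset.range (min m n + 1),
    (((m + n - i).choose m : k) * (m + n - i).choose n) •
      (Hbin k (m + n) i * Cm k (m + n - i)) := by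
  have h : Cm k m * Cm k n = Yd k m * (Xd k m * Yd k n) * Xd k n := by
    simp only [Cm, mul_assoc]
  rw [h, Xd_mul_Yd, Finset.mul_sum, Finset.sum_mul]
  refine Finset.sum_congr rfl fun i hi => ?_
  rw [Finset.mem_range] at hi
  have h1 : Yd k m * (Yd k (n - i) * Hbin k (2 * i - m - n) i * Xd k (m - i)) * Xd k n =
      (Yd k m * Yd k (n - i)) * Hbin k (2 * i - m - n) i * (Xd k (m - i) * Xd k n) := by
    simp only [mul_assoc]
  rw [h1, Yd_mul_Yd, Xd_mul_Xd, show m + (n - i) = m + n - i by omega,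
    show m - i + n = m + n - i by omega, smul_mul_assoc, smul_mul_assoc, mul_smul_comm, smul_smul,
    Yd_mul_mul_Xd (Hbin_mem_Ucar k _ _), shift_Hbin]
  have h2 : (m + n - i).choose (m - i) = (m + n - i).choose n := by
    rw [← Nat.choose_symm (by omega)]
    congr 1; omega
  have h3 : (2 * (i : ℤ) - m - n + 2 * (m + n - i : ℕ)) = m + n := by omega
  rw [h2, h3]

theorem commute_Cm_Cm (m n : ℕ) : Commute (Cm k m) (Cm k n) := by
  have h : Cm k m * Cm k n = Cm k n * Cm k m := by
    rw [Cm_mul_Cm, Cm_mul_Cm, min_comm]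
    refine Finset.sum_congr rfl fun i _ => ?_
    rw [mul_comm ((m + n - i).choose m : k), Nat.add_comm m n, add_comm (m : ℤ)]
  exact h

theorem Cm_zero : Cm k 0 = 1 := by rw [Cm, Xd_zero, Yd_zero, one_mul]

variable (k) in
/-- The generators of the weight zero part. -/
def wtGens : Set (Hyper k) := {w | ∃ u ∈ Ucar k, ∃ m, w = u * Cm k m}

variable (k) in
/-- The part of weight zero of the hyperalgebra. -/
def Wsub : Subalgebra k (Hyper k) :=
  (Submodule.span k (wtGens k)).toSubalgebra
    (Submodule.subset_span ⟨1, one_mem _, 0, by rw [Cm_zero, one_mul]⟩) (by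
      intro u v hu hv
      induction hu, hv using Submodule.span_induction₂ with
      | mem_mem u v hu hv =>
        obtain ⟨u, hu, m, rfl⟩ := hu
        obtain ⟨v, hv, n, rfl⟩ := hv
        rw [mul_assoc, ← mul_assoc _ v, ← (commute_Ucar_Cm hv m).eq, mul_assoc v, Cm_mul_Cm,
          ← mul_assoc, Finset.mul_sum]
        refine sum_mem fun i _ => ?_
        rw [mul_smul_comm, ← mul_assoc]
        exact Submodule.smul_mem _ _ (Submodule.subset_span
          ⟨_, mul_mem (mul_mem hu hv) (Hbin_mem_Ucar k _ _), _, rfl⟩)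
      | zero_left v hv => simp
      | zero_right u hu => simp
      | add_left u v w _ _ _ h1 h2 => rw [add_mul]; exact add_mem h1 h2
      | add_right u v w _ _ _ h1 h2 => rw [mul_add]; exact add_mem h1 h2
      | smul_left c u v _ _ h => rw [smul_mul_assoc]; exact Submodule.smul_mem _ c h
      | smul_right c u v _ _ h => rw [mul_smul_comm]; exact Submodule.smul_mem _ c h)

theorem mem_Wsub {w : Hyper k} : w ∈ Wsub k ↔ w ∈ Submodule.span k (wtGens k) := Iff.rfl

theorem Ucar_mul_Cm_mem {u : Hyper k} (hu : u ∈ Ucar k) (m : ℕ) : u * Cm k m ∈ Wsub k :=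
  Submodule.subset_span ⟨u, hu, m, rfl⟩

theorem Cm_mem (m : ℕ) : Cm k m ∈ Wsub k := by
  simpa using Ucar_mul_Cm_mem (one_mem (Ucar k)) m

theorem Ucar_le_Wsub {u : Hyper k} (hu : u ∈ Ucar k) : u ∈ Wsub k := by
  simpa [Cm_zero] using Ucar_mul_Cm_mem hu 0

/-- Cartan elements commute with each other and with every Y^(m)X^(m), and these commute among
themselves. All later rearrangements of weight zero factors rest on this. -/
theorem Wsub_comm {u v : Hyper k} (hu : u ∈ Wsub k) (hv : v ∈ Wsub k) : Commute u v := by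
  rw [mem_Wsub] at hu hv
  induction hu, hv using Submodule.span_induction₂ with
  | mem_mem u v hu hv =>
    obtain ⟨u, hu, m, rfl⟩ := hu
    obtain ⟨v, hv, n, rfl⟩ := hv
    exact ((Ucar_comm k hu hv).mul_left (commute_Ucar_Cm hv m).symm).mul_right
      ((commute_Ucar_Cm hu n).mul_left (commute_Cm_Cm m n))
  | zero_left v hv => exact Commute.zero_left _
  | zero_right u hu => exact Commute.zero_right _
  | add_left u v w _ _ _ h1 h2 => exact h1.add_left h2
  | add_right u v w _ _ _ h1 h2 => exact h1.add_right h2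
  | smul_left c u v _ _ h => exact h.smul_left c
  | smul_right c u v _ _ h => exact h.smul_right c

/-- Elements of weight zero, sandwiched between `Y^(m)` and `X^(m)`. -/
theorem Yd_mul_Wsub_mul_Xd_mem {w : Hyper k} (hw : w ∈ Wsub k) (m : ℕ) :
    Yd k m * w * Xd k m ∈ Wsub k := by
  rw [mem_Wsub] at hw
  induction hw using Submodule.span_induction with
  | mem w hw =>
    obtain ⟨u, hu, n, rfl⟩ := hw
    have : Yd k m * (u * Cm k n) * Xd k m = (((m + n).choose m : k) * (n + m).choose n) •
        (shift k (2 * m) u * Cm k (m + n)) := by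
      rw [← mul_assoc, Yd_mul_Ucar hu, Cm, mul_assoc, mul_assoc, mul_assoc (Yd k n), Xd_mul_Xd,
        ← mul_assoc (Yd k m), Yd_mul_Yd, mul_smul_comm, smul_mul_assoc, mul_smul_comm,
        mul_smul_comm, smul_smul, mul_comm ((m + n).choose m : k), add_comm n m, Cm]
    rw [this]
    exact Subalgebra.smul_mem _ (Ucar_mul_Cm_mem (shift_mem hu _) _) _
  | zero => simp
  | add u v _ _ hu hv => rw [mul_add, add_mul]; exact add_mem hu hv
  | smul c u _ hu => rw [mul_smul_comm, smul_mul_assoc]; exact Subalgebra.smul_mem _ hu c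

/-- A recursion for Y^(m)X^(m) whose coefficients depend on m only through its image in k; `Cm_add`
exploits this. -/
theorem Cm_succ (m : ℕ) : Cm k m * Cm k 1 =
    (((m + 1 : ℕ) : k) ^ 2) • Cm k (m + 1) + (m : k) • (Hbin k (m + 1) 1 * Cm k m) := by
  rw [Cm_mul_Cm]
  rcases Nat.eq_zero_or_pos m with rfl | hm
  · simp [Hbin_zero]
  · rw [min_eq_right hm, Finset.sum_range_succ, Finset.sum_range_one]
    simp only [Nat.sub_zero, Nat.choose_one_right, Nat.add_sub_cancel, Nat.choose_self,
      Nat.cast_one, one_mul, Hbin_zero]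
    congr 2
    rw [← Nat.choose_symm (by omega)]
    simp [sq]

end

section

variable {k : Type*} [Field k] {p : ℕ}

/-! ### The map `Fr'` on elements of weight zero -/

section Frob

theorem frob_Hbin_zero (n : ℕ) : frob k p (Hbin k 0 n) = Hbin k 0 (n * p) := by
  rw [Hbin_eq_basis, frob, Module.Basis.constr_basis]
  simp [Xd_zero, Yd_zero]

theorem frob_mem {u : Hyper k} (hu : u ∈ Ucar k) : frob k p u ∈ Ucar k := by
  rw [mem_Ucar] at hu
  induction hu using Submodule.span_induction with
  | mem u hu =>
    obtain ⟨n, rfl⟩ := hu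
    rw [frob_Hbin_zero]
    exact Hbin_mem_Ucar k _ _
  | zero => rw [map_zero]; exact zero_mem _
  | add u v _ _ hu hv => rw [map_add]; exact add_mem hu hv
  | smul c u _ hu => rw [map_smul]; exact Subalgebra.smul_mem _ hu c

theorem frob_Yd_mul_mul_Xd {u : Hyper k} (hu : u ∈ Ucar k) (m n : ℕ) :
    frob k p (Yd k m * u * Xd k n) = Yd k (m * p) * frob k p u * Xd k (n * p) := by
  rw [mem_Ucar] at hu
  induction hu using Submodule.span_induction with
  | mem u hu =>
    obtain ⟨l, rfl⟩ := hu
    rw [frob_Hbin_zero, ← basisHyper_apply, frob, Module.Basis.constr_basis]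
  | zero => simp
  | add u v _ _ hu hv => simp only [map_add, add_mul, mul_add, hu, hv]
  | smul c u _ hu => simp only [map_smul, smul_mul_assoc, mul_smul_comm, hu]

theorem frob_one : frob k p 1 = 1 := by
  rw [← Hbin_zero k 0, frob_Hbin_zero, zero_mul, Hbin_zero]

variable [Fact p.Prime] [CharP k p]

/-- By Lucas, (h choose np) = (⌊h/p⌋ choose n) in k. Hence Fr' acts on functions of the weight as
pull-back along h ↦ ⌊h/p⌋; in particular it is multiplicative on the Cartan part. -/
theorem evH_frob {u : Hyper k} (hu : u ∈ Ucar k) (h : ℤ) :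
    evH k h (frob k p u) = evH k (h / p) u := by
  rw [mem_Ucar] at hu
  induction hu using Submodule.span_induction with
  | mem u hu =>
    obtain ⟨n, rfl⟩ := hu
    rw [frob_Hbin_zero, evH_Hbin, evH_Hbin, add_zero, add_zero, intChoose_mul]
  | zero => simp
  | add u v _ _ hu hv => rw [map_add, map_add, map_add, hu, hv]
  | smul c u _ hu => rw [map_smul, map_smul, map_smul, hu]

theorem frob_shift {u : Hyper k} (hu : u ∈ Ucar k) (d : ℤ) :
    frob k p (shift k d u) = shift k (d * p) (frob k p u) :=
  ext_evH k (frob_mem (shift_mem hu d)) (shift_mem (frob_mem hu) _) fun h => by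
    have hp0 : (p : ℤ) ≠ 0 := by exact_mod_cast (Fact.out : p.Prime).ne_zero
    rw [evH_frob (shift_mem hu d), evH_shift hu, evH_shift (frob_mem hu), evH_frob hu,
      Int.add_mul_ediv_right _ _ hp0]

theorem frob_Ucar_mul {u v : Hyper k} (hu : u ∈ Ucar k) (hv : v ∈ Ucar k) :
    frob k p (u * v) = frob k p u * frob k p v :=
  ext_evH k (frob_mem (mul_mem hu hv)) (mul_mem (frob_mem hu) (frob_mem hv)) fun h => by
    rw [evH_frob (mul_mem hu hv), evH_mul k _ hu hv, evH_mul k _ (frob_mem hu) (frob_mem hv),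
      evH_frob hu, evH_frob hv]

theorem frob_Hbin (c : ℤ) (n : ℕ) : frob k p (Hbin k c n) = Hbin k (c * p) (n * p) := by
  rw [← zero_add c, ← shift_Hbin, frob_shift (Hbin_mem_Ucar k _ _), frob_Hbin_zero, shift_Hbin,
    zero_add, zero_add]

/-- The Cartan factor is moved between Y^(m) and X^(m), where Fr' is defined, and back. The two
shifts match because Fr' turns a translation by d into one by dp. -/
theorem frob_Ucar_mul_Cm {u : Hyper k} (hu : u ∈ Ucar k) (m : ℕ) :
    frob k p (u * Cm k m) = frob k p u * Cm k (m * p) := by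
  rw [Ucar_mul_Cm hu, frob_Yd_mul_mul_Xd (shift_mem hu _), frob_shift hu, Ucar_mul_Cm (frob_mem hu)]
  congr 4
  push_cast
  ring

theorem frob_Cm (m : ℕ) : frob k p (Cm k m) = Cm k (m * p) := by
  have := frob_Ucar_mul_Cm (p := p) (one_mem (Ucar k)) m
  rwa [frob_one, one_mul, one_mul] at this

theorem frob_mem_Wsub {w : Hyper k} (hw : w ∈ Wsub k) : frob k p w ∈ Wsub k := by
  rw [mem_Wsub] at hw
  induction hw using Submodule.span_induction with
  | mem w hw =>
    obtain ⟨u, hu, n, rfl⟩ := hw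
    rw [frob_Ucar_mul_Cm hu]
    exact Ucar_mul_Cm_mem (frob_mem hu) _
  | zero => rw [map_zero]; exact zero_mem _
  | add u v _ _ hu hv => rw [map_add]; exact add_mem hu hv
  | smul c u _ hu => rw [map_smul]; exact Subalgebra.smul_mem _ hu c

end Frob

/-! ### The weight projections `μ_a` -/

section Mu

theorem mu_mem (a : ℤ) : mu k p a ∈ Ucar k := Hbin_mem_Ucar k _ _

theorem shift_mu (d a : ℤ) : shift k d (mu k p a) = mu k p (a - d) := by
  rw [mu, shift_Hbin, mu]
  congr 1
  ring

variable [CharP k p]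

theorem natCast_ne_zero_of_lt {n : ℕ} (h0 : n ≠ 0) (h : n < p) : (n : k) ≠ 0 := by
  rw [Ne, CharP.cast_eq_zero_iff k p]
  exact fun hd => absurd (Nat.le_of_dvd (Nat.pos_of_ne_zero h0) hd) (by omega)

variable [Fact p.Prime]

/-- By Lucas the value is (r choose p - 1), where r < p is the residue of h - a - 1; it is nonzero
only for r = p - 1. -/
theorem evH_mu (h a : ℤ) : evH k h (mu k p a) = if h % p = a % p then 1 else 0 := by
  have hP := (Fact.out : p.Prime)
  have hp := hP.pos
  have hp0 : (p : ℤ) ≠ 0 := by exact_mod_cast hP.ne_zero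
  rw [mu, evH_Hbin, intChoose_lucas k p, Nat.mod_eq_of_lt (by omega : p - 1 < p),
    Nat.div_eq_of_lt (by omega : p - 1 < p), intChoose_zero_right, mul_one]
  obtain ⟨r, hr⟩ : ∃ r : ℕ, (h + (-a - 1)) % p = r :=
    ⟨_, (Int.toNat_of_nonneg (Int.emod_nonneg _ hp0)).symm⟩
  have hrp : r < p := by
    have := Int.emod_lt_of_pos (h + (-a - 1)) (by exact_mod_cast hp : (0 : ℤ) < p)
    omega
  rw [hr, intChoose_natCast]
  have key : h % p = a % p ↔ r = p - 1 := by
    have h1 : h % p = a % p ↔ (h + (-a - 1)) % p = ((p - 1 : ℕ) : ℤ) % p := by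
      rw [Int.emod_eq_emod_iff_emod_sub_eq_zero, Int.emod_eq_emod_iff_emod_sub_eq_zero,
        Nat.cast_sub hP.one_le, show h + (-a - 1) - ((p : ℤ) - (1 : ℕ)) = h - a + p * (-1) by
          push_cast; ring, Int.add_mul_emod_self_left]
    rw [h1, hr, ← Int.natCast_mod, Nat.mod_eq_of_lt (by omega : p - 1 < p)]
    exact Nat.cast_inj
  simp only [key]
  split_ifs with h1
  · rw [h1, Nat.choose_self, Nat.cast_one]
  · rw [Nat.choose_eq_zero_of_lt (by omega), Nat.cast_zero]

/-- Multiplication by μ_b restricts a function to b + pℤ, so only the values there matter. -/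
theorem mul_mu_congr {u v : Hyper k} (hu : u ∈ Ucar k) (hv : v ∈ Ucar k) (b : ℤ)
    (h : ∀ n : ℤ, n % p = b % p → evH k n u = evH k n v) : u * mu k p b = v * mu k p b :=
  ext_evH k (mul_mem hu (mu_mem b)) (mul_mem hv (mu_mem b)) fun n => by
    rw [evH_mul k n hu (mu_mem b), evH_mul k n hv (mu_mem b), evH_mu]
    split_ifs with hn
    · rw [h n hn]
    · simp

theorem mu_congr {a b : ℤ} (h : a % p = b % p) : mu k p a = mu k p b :=
  ext_evH k (mu_mem a) (mu_mem b) fun n => by rw [evH_mu, evH_mu, h]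

theorem Hbin_one_congr {c d : ℤ} (h : (c : k) = d) : Hbin k c 1 = Hbin k d 1 :=
  ext_evH k (Hbin_mem_Ucar k _ _) (Hbin_mem_Ucar k _ _) fun n => by
    rw [evH_Hbin, evH_Hbin, intChoose_one_right, intChoose_one_right, Int.cast_add, Int.cast_add, h]

-- Both sides satisfy the recursion `Cm_succ`, whose coefficients see Np + q only modulo p. The
-- factor (q + 1)² by which one divides is invertible because q + 1 < p.
omit [Fact p.Prime] in
theorem Cm_add (N q : ℕ) (hq : q < p) : Cm k (N * p + q) = Cm k (N * p) * Cm k q := by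
  induction q with
  | zero => rw [add_zero, Cm_zero, mul_one]
  | succ q ih =>
    have ih := ih (by omega)
    have h1 := Cm_succ (k := k) (N * p + q)
    have h2 := congrArg (Cm k (N * p) * ·) (Cm_succ (k := k) q)
    beta_reduce at h2
    have hN : ((N * p + q : ℕ) : k) = q := by simp
    have hN1 : ((N * p + q + 1 : ℕ) : k) = (q + 1 : ℕ) := by simp
    have hH : Hbin k ((N * p + q : ℕ) + 1) 1 = Hbin k (q + 1) 1 := Hbin_one_congr (by simp)
    rw [← mul_assoc, ← ih, h1, hN, hN1, hH, mul_add, mul_smul_comm, mul_smul_comm, ← mul_assoc,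
      ← (commute_Ucar_Cm (Hbin_mem_Ucar k _ _) (N * p)).eq, mul_assoc, ← ih] at h2
    have hu : ((q + 1 : ℕ) : k) ^ 2 ≠ 0 := pow_ne_zero 2 (natCast_ne_zero_of_lt (by omega) hq)
    exact smul_right_injective _ hu (add_right_cancel h2)

end Mu

/-! ### Multiplicativity of `Fr'` against suitable right factors -/

section Hom

variable [Fact p.Prime] [CharP k p]

/-- The condition on an element `P` under which `z ↦ Fr'(z) P` is compatible with products. -/
structure FrobCompat (p : ℕ) (b : ℕ) (P : Hyper k) : Prop where
  lt : b < p
  mu_mul : mu k p b * P = P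
  Cm_mul : ∀ i, 1 ≤ i → i ≤ b → Cm k (p - i) * P = 0

/-- In the expansion of the left product the terms with p ∣ i are, by Lucas, exactly the images
under Fr' of the terms on the right. Every other term is killed by P, for one of two reasons
depending on whether i mod p exceeds b. -/
theorem FrobCompat.Cm_mul_Cm_mul {b : ℕ} {P : Hyper k} (hP : FrobCompat p b P) (m n : ℕ) :
    Cm k (m * p) * Cm k (n * p) * P = frob k p (Cm k m * Cm k n) * P := by
  have hp := (Fact.out : p.Prime).pos
  rw [Cm_mul_Cm, Cm_mul_Cm, map_sum, Finset.sum_mul, Finset.sum_mul]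
  symm
  have hinj : Set.InjOn (· * p) (Finset.range (min m n + 1) : Set ℕ) :=
    fun a _ b _ h => Nat.eq_of_mul_eq_mul_right hp h
  have hsub : (Finset.range (min m n + 1)).image (· * p) ⊆ Finset.range (min (m * p) (n * p) + 1) := by
    intro i hi
    obtain ⟨l, hl, rfl⟩ := Finset.mem_image.mp hi
    rw [Finset.mem_range, Nat.lt_succ_iff, le_min_iff] at hl ⊢
    exact ⟨Nat.mul_le_mul_right p hl.1, Nat.mul_le_mul_right p hl.2⟩
  rw [← Finset.sum_subset hsub, Finset.sum_image hinj]
  · refine Finset.sum_congr rfl fun i hi => ?_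
    rw [Finset.mem_range] at hi
    have e : m * p + n * p - i * p = (m + n - i) * p := by rw [Nat.sub_mul, add_mul]
    have hc : ∀ a b : ℕ, ((a * p).choose (b * p) : k) = a.choose b := by
      intro a b
      have := nat_choose_lucas k p 0 0 a b hp hp
      simpa [mul_comm] using this
    rw [map_smul, frob_Ucar_mul_Cm (Hbin_mem_Ucar k _ _), frob_Hbin, e, hc, hc]
    congr 5
    push_cast
    ring
  · intro i hi hni
    rw [Finset.mem_range, Nat.lt_succ_iff, le_min_iff] at hi
    have hi0 : i % p ≠ 0 := by
      intro h0
      obtain ⟨l, rfl⟩ := Nat.dvd_of_mod_eq_zero h0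
      refine hni (Finset.mem_image.mpr ⟨l, ?_, mul_comm _ _⟩)
      rw [Finset.mem_range, Nat.lt_succ_iff, le_min_iff]
      rw [mul_comm p l] at hi
      exact ⟨Nat.le_of_mul_le_mul_right hi.1 hp, Nat.le_of_mul_le_mul_right hi.2 hp⟩
    have hlt := Nat.mod_lt i hp
    have hdm := Nat.mod_add_div i p
    have hle : i / p + 1 ≤ m + n := by
      have h1 : i / p < m := by
        rw [Nat.div_lt_iff_lt_mul hp]
        rcases hi.1.lt_or_eq with h | h
        · exact h
        · rw [h, Nat.mul_mod_left] at hi0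
          exact absurd rfl hi0
      omega
    obtain ⟨N, hN⟩ := Nat.exists_eq_add_of_le hle
    -- Borrowing one p isolates the factor of index p - (i mod p), which `Cm_add` splits off.
    have e : m * p + n * p - i = N * p + (p - i % p) := by
      rw [← add_mul, hN, add_mul, add_mul, mul_comm (i / p)]
      omega
    rw [e, Cm_add N _ (by omega), smul_mul_assoc]
    refine (congrArg _ ?_).trans (smul_zero _)
    -- For i mod p ≤ b the split-off factor annihilates P. Otherwise P = μ_b P restricts the
    -- binomial of index i to weights congruent to b, where Lucas gives the factor (b choose i mod
    -- p) = 0.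
    rcases le_or_gt (i % p) b with hb | hb
    · rw [mul_assoc, mul_assoc, hP.Cm_mul _ (by omega) hb, mul_zero, mul_zero]
    · rw [mul_assoc, ← hP.mu_mul]
      have hc := Wsub_comm (mul_mem (Cm_mem (k := k) (N * p)) (Cm_mem (p - i % p)))
        (Ucar_le_Wsub (mu_mem (k := k) (p := p) b))
      rw [← mul_assoc (_ * _) _ P, hc.eq, ← mul_assoc, ← mul_assoc,
        mul_mu_congr (v := 0) (Hbin_mem_Ucar k _ _) (zero_mem _), zero_mul, zero_mul, zero_mul]
      intro l hl
      rw [evH_Hbin, intChoose_lucas k p, map_zero]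
      have e2 : (l + (((m * p : ℕ) : ℤ) + ((n * p : ℕ) : ℤ))) % p = (b : ℕ) := by
        push_cast
        rw [← add_mul, Int.add_mul_emod_self_right, hl]
        exact Int.emod_eq_of_lt (by positivity) (by exact_mod_cast hP.lt)
      rw [e2, intChoose_natCast, Nat.choose_eq_zero_of_lt hb, Nat.cast_zero, zero_mul]

theorem FrobCompat.frob_mul {b : ℕ} {P : Hyper k} (hP : FrobCompat p b P) {z w : Hyper k}
    (hz : z ∈ Wsub k) (hw : w ∈ Wsub k) :
    frob k p (z * w) * P = frob k p z * frob k p w * P := by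
  -- With a Cartan factor on one side, Fr' is multiplicative unconditionally, so only products of
  -- two elements Y^(m)X^(m) need P.
  have hfrob : ∀ u ∈ Ucar k, ∀ w ∈ Wsub k, frob k p (u * w) = frob k p u * frob k p w := by
    intro u hu w hw
    rw [mem_Wsub] at hw
    induction hw using Submodule.span_induction with
    | mem w hw =>
      obtain ⟨v, hv, n, rfl⟩ := hw
      rw [← mul_assoc, frob_Ucar_mul_Cm (mul_mem hu hv), frob_Ucar_mul hu hv,
        frob_Ucar_mul_Cm hv, mul_assoc]
    | zero => simp
    | add u v _ _ hu hv => rw [mul_add, map_add, map_add, mul_add, hu, hv]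
    | smul c u _ hu => rw [mul_smul_comm, map_smul, map_smul, mul_smul_comm, hu]
  rw [mem_Wsub] at hz hw
  induction hz, hw using Submodule.span_induction₂ with
  | mem_mem z w hz hw =>
    obtain ⟨u, hu, m, rfl⟩ := hz
    obtain ⟨v, hv, n, rfl⟩ := hw
    rw [mul_assoc, ← mul_assoc _ v, ← (commute_Ucar_Cm hv m).eq, mul_assoc v, ← mul_assoc,
      hfrob _ (mul_mem hu hv) _ (mul_mem (Cm_mem m) (Cm_mem n)), mul_assoc,
      ← hP.Cm_mul_Cm_mul, frob_Ucar_mul_Cm hu, frob_Ucar_mul_Cm hv, frob_Ucar_mul hu hv]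
    simp only [mul_assoc]
    rw [(commute_Ucar_Cm (frob_mem (p := p) hv) (m * p)).symm.left_comm]
  | zero_left v hv => simp
  | zero_right u hu => simp
  | add_left u v w _ _ _ h1 h2 => simp only [add_mul, map_add, h1, h2]
  | add_right u v w _ _ _ h1 h2 => simp only [add_mul, mul_add, map_add, h1, h2]
  | smul_left c u v _ _ h => simp only [smul_mul_assoc, map_smul, h]
  | smul_right c u v _ _ h => simp only [smul_mul_assoc, mul_smul_comm, map_smul, h]

end Hom

end

/-! ### The elements `Y^s Fr'(z) X^s g(YX) μ_a` and their products -/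

section

variable {k : Type*} [Field k] {p : ℕ}

theorem Xd_one_pow (m : ℕ) : Xd k 1 ^ m = (m.factorial : k) • Xd k m := by
  induction m with
  | zero => simp [Xd_zero]
  | succ m ih =>
    rw [pow_succ, ih, smul_mul_assoc, Xd_mul_Xd, smul_smul, Nat.choose_succ_self_right,
      Nat.factorial_succ, Nat.cast_mul, mul_comm]

theorem Yd_one_pow (m : ℕ) : Yd k 1 ^ m = (m.factorial : k) • Yd k m := by
  induction m with
  | zero => simp [Yd_zero]
  | succ m ih =>
    rw [pow_succ, ih, smul_mul_assoc, Yd_mul_Yd, smul_smul, Nat.choose_succ_self_right,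
      Nat.factorial_succ, Nat.cast_mul, mul_comm]

theorem Yd_pow_mul_Xd_pow (m : ℕ) :
    Yd k 1 ^ m * Xd k 1 ^ m = ((m.factorial : k) ^ 2) • Cm k m := by
  rw [Xd_one_pow, Yd_one_pow, smul_mul_smul_comm, ← sq, Cm]

theorem pow_sandwich_mem {w : Hyper k} (hw : w ∈ Wsub k) (m : ℕ) :
    Yd k 1 ^ m * w * Xd k 1 ^ m ∈ Wsub k := by
  rw [Xd_one_pow, Yd_one_pow, smul_mul_assoc, smul_mul_smul_comm]
  exact Subalgebra.smul_mem _ (Yd_mul_Wsub_mul_Xd_mem hw m) _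

theorem Xd_mul_Yd_self_mem (m : ℕ) : Xd k m * Yd k m ∈ Wsub k := by
  rw [Xd_mul_Yd]
  refine sum_mem fun i _ => ?_
  rw [Yd_mul_mul_Xd (Hbin_mem_Ucar k _ _)]
  exact Ucar_mul_Cm_mem (shift_mem (Hbin_mem_Ucar k _ _) _) _

theorem Xd_mul_Cm_one (i : ℕ) :
    Xd k i * Cm k 1 = Cm k 1 * Xd k i + (i : k) • (Xd k i * Hbin k (i + 1) 1) := by
  rcases Nat.eq_zero_or_pos i with rfl | hi
  · simp [Xd_zero]
  · have h := Xd_mul_Yd k i 1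
    rw [min_eq_right hi, Finset.sum_range_succ, Finset.sum_range_one] at h
    have hx : Xd k i * Xd k 1 = Xd k 1 * Xd k i := by
      rw [Xd_mul_Xd, Xd_mul_Xd, add_comm 1 i, Nat.choose_one_right, Nat.choose_succ_self_right]
    rw [Cm, ← mul_assoc, h]
    simp only [Nat.sub_zero, Hbin_zero, mul_one, Nat.sub_self, Yd_zero, one_mul, add_mul]
    rw [mul_assoc, hx, ← mul_assoc, mul_assoc (Hbin k _ _), Xd_mul_Xd, Nat.sub_add_cancel hi,
      Nat.choose_symm_of_eq_add (b := 1) (by omega), Nat.choose_one_right, mul_smul_comm,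
      Xd_mul_Hbin]
    congr 4
    push_cast
    ring

theorem frobCompat_zero {b : ℕ} (hb : b < p) : FrobCompat p b (0 : Hyper k) :=
  ⟨hb, by simp, by simp⟩

variable [Fact p.Prime] [CharP k p]

/-- Substitution of `YX` in a polynomial over the prime field. -/
def evC : (ZMod p)[X] →+* Hyper k :=
  (aeval (Cm k 1) : k[X] →ₐ[k] Hyper k).toRingHom.comp (mapRingHom (ZMod.castHom (dvd_refl p) k))

theorem evC_C (c : ZMod p) : (evC (C c) : Hyper k) =
    algebraMap k (Hyper k) (ZMod.castHom (dvd_refl p) k c) := by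
  simp [evC]

theorem evC_C_mul (c : ZMod p) (f : (ZMod p)[X]) : (evC (C c * f) : Hyper k) =
    ZMod.castHom (dvd_refl p) k c • evC f := by
  rw [map_mul, evC_C, Algebra.smul_def]

theorem evC_X : (evC (X : (ZMod p)[X]) : Hyper k) = Cm k 1 := by simp [evC]

theorem evC_mem (f : (ZMod p)[X]) : (evC f : Hyper k) ∈ Wsub k := by
  induction f using Polynomial.induction_on' with
  | add f g hf hg => rw [map_add]; exact add_mem hf hg
  | monomial n c =>
    rw [← C_mul_X_pow_eq_monomial, evC_C_mul, map_pow, evC_X]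
    exact Subalgebra.smul_mem _ (pow_mem (Cm_mem 1) n) _

variable (p) in
/-- The product of the factors of `φ_{a,i}` with index at least `s`. -/
def phiIco (a s i : ℕ) : (ZMod p)[X] :=
  ∏ l ∈ Finset.Ico s i, (X - C ((l : ZMod p) * (l + a + 1)))

theorem phi_eq_phiIco (a i : ℕ) : phi p a i = phiIco p a 0 i := by
  rw [phi, phiIco, Finset.range_eq_Ico]
  simp

theorem phi_mul_phiIco (a : ℕ) {s i : ℕ} (h : s ≤ i) : phi p a s * phiIco p a s i = phi p a i := by
  rw [phi_eq_phiIco, phi_eq_phiIco]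
  exact Finset.prod_Ico_consecutive _ (Nat.zero_le s) h

theorem phi_ne_zero (a s : ℕ) : phi p a s ≠ 0 :=
  (monic_prod_of_monic _ _ fun _ _ => monic_X_sub_C _).ne_zero

theorem commute_mu_evC (a : ℤ) (f : (ZMod p)[X]) : Commute (mu k p a) (evC f) :=
  Wsub_comm (Ucar_le_Wsub (mu_mem a)) (evC_mem f)

/-- Moving YX to the left past X^i adds i(H + i + 1), which against μ_a is the scalar i(i + a + 1).
So each new linear factor contributes one more Y on the left and one more X. -/
theorem evC_phiIco (a : ℕ) {s i : ℕ} (h : s ≤ i) :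
    Xd k 1 ^ s * evC (phiIco p a s i) * mu k p a = Yd k 1 ^ (i - s) * Xd k 1 ^ i * mu k p a := by
  induction i, h using Nat.le_induction with
  | base => simp [phiIco]
  | succ i h ih =>
    have e1 : phiIco p a s (i + 1) = phiIco p a s i * (X - C ((i : ZMod p) * (i + a + 1))) := by
      rw [phiIco, Finset.prod_Ico_succ_top h, ← phiIco]
    have e2 : (evC (X - C ((i : ZMod p) * (i + a + 1))) : Hyper k) =
        Cm k 1 - algebraMap k (Hyper k) (i * (i + a + 1)) := by
      rw [map_sub, evC_X, evC_C]
      simp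
    have e3 : Hbin k (i + 1) 1 * mu k p a = ((i : k) + a + 1) • mu k p a := by
      have h1 : ((i : k) + a + 1) • mu k p a =
          algebraMap k (Hyper k) ((i : k) + a + 1) * mu k p a := Algebra.smul_def _ _
      rw [h1]
      refine mul_mu_congr (Hbin_mem_Ucar k _ _) (Subalgebra.algebraMap_mem _ _) _ fun n hn => ?_
      rw [Algebra.algebraMap_eq_smul_one, map_smul, evH_one, evH_Hbin, intChoose_one_right]
      have : (n : k) = a := by
        have := (CharP.intCast_eq_intCast k p).mpr hn
        simpa using this
      push_cast
      rw [this, smul_eq_mul]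
      ring
    have e4 : Xd k i * (Cm k 1 - algebraMap k (Hyper k) (i * (i + a + 1))) * mu k p a =
        Cm k 1 * Xd k i * mu k p a := by
      rw [mul_sub, sub_mul, Xd_mul_Cm_one, add_mul, smul_mul_assoc, mul_assoc (Xd k i), e3,
        mul_assoc (Xd k i), ← Algebra.smul_def, mul_smul_comm, smul_smul, mul_smul_comm,
        add_sub_cancel_right]
    have e5 : Xd k 1 ^ i * (Cm k 1 - algebraMap k (Hyper k) (i * (i + a + 1))) * mu k p a =
        Cm k 1 * Xd k 1 ^ i * mu k p a := by
      rw [Xd_one_pow, smul_mul_assoc, smul_mul_assoc, e4, mul_smul_comm, smul_mul_assoc]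
    rw [e1, map_mul, mul_assoc, mul_assoc, ← (commute_mu_evC _ (X - C _)).eq,
      ← mul_assoc, ← mul_assoc, ih, mul_assoc, (commute_mu_evC _ _).eq, mul_assoc,
      ← mul_assoc (Xd k 1 ^ i), e2, e5, Cm, Nat.succ_sub h, pow_succ, pow_succ']
    simp only [mul_assoc]

theorem Xd_one_pow_p : Xd k 1 ^ p = 0 := by
  rw [Xd_one_pow, (CharP.cast_eq_zero_iff k p _).mpr
    (Nat.dvd_factorial (Fact.out : p.Prime).pos le_rfl), zero_smul]

/-- The right factor `X^s f(YX) μ_a` of the elements `Z`. -/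
def Pel (k : Type*) [Field k] (p : ℕ) [Fact p.Prime] [CharP k p] (s a : ℕ) (g : (ZMod p)[X]) :
    Hyper k :=
  Xd k 1 ^ s * evC g * mu k p a

/-- The element `Y^s Fr'(z) X^s f(YX) μ_a`. -/
def Zmap (s a : ℕ) (g : (ZMod p)[X]) (z : Hyper k) : Hyper k :=
  Yd k 1 ^ s * frob k p z * Pel k p s a g

theorem Pel_add (s a : ℕ) (f g : (ZMod p)[X]) :
    Pel k p s a (f + g) = Pel k p s a f + Pel k p s a g := by
  simp only [Pel, map_add, mul_add, add_mul]

theorem Pel_C_mul (s a : ℕ) (c : ZMod p) (f : (ZMod p)[X]) :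
    Pel k p s a (C c * f) = ZMod.castHom (dvd_refl p) k c • Pel k p s a f := by
  simp only [Pel, evC_C_mul, mul_smul_comm, smul_mul_assoc]

/-- By `evC_phiIco` with i = p the element contains X^p = 0. Hence g matters only modulo the product
of the factors with index s, …, p - 1, that is, φ_{a,s} g matters only modulo φ_{a,p}. -/
theorem Pel_eq_zero {s a : ℕ} (hs : s ≤ p) {g : (ZMod p)[X]} (h : phiIco p a s p ∣ g) :
    Pel k p s a g = 0 := by
  obtain ⟨f, rfl⟩ := h
  rw [Pel, map_mul, ← mul_assoc, mul_assoc, ← (commute_mu_evC _ _).eq, ← mul_assoc,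
    evC_phiIco a hs, Xd_one_pow_p, mul_zero, zero_mul, zero_mul]

theorem Pel_congr {s a : ℕ} (hs : s ≤ p) {f g : (ZMod p)[X]} (h : phiIco p a s p ∣ f - g) :
    Pel k p s a f = Pel k p s a g := by
  have h1 := Pel_eq_zero (k := k) hs h
  rw [sub_eq_add_neg, Pel_add] at h1
  have h2 : Pel k p s a (-g) = -Pel k p s a g := by simp [Pel]
  rw [h2] at h1
  exact eq_of_sub_eq_zero (by rw [sub_eq_add_neg, h1])

theorem Zmap_eq (s a : ℕ) (g : (ZMod p)[X]) (z : Hyper k) :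
    Zmap s a g z = (Yd k 1 ^ s * frob k p z * Xd k 1 ^ s) * (evC g * mu k p a) := by
  simp only [Zmap, Pel, mul_assoc]

theorem Zmap_mem {z : Hyper k} (hz : z ∈ Wsub k) (s a : ℕ) (g : (ZMod p)[X]) :
    Zmap s a g z ∈ Wsub k := by
  rw [Zmap_eq]
  exact mul_mem (pow_sandwich_mem (frob_mem_Wsub hz) s)
    (mul_mem (evC_mem g) (Ucar_le_Wsub (mu_mem _)))

/-- All blocks have weight zero and commute, so the two copies of Fr' can be brought together. The
leftover Y^s X^s becomes φ_{a,s}(YX) against μ_a, and the compatibility of the right factor merges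
Fr'(z) Fr'(w) into Fr'(zw). -/
theorem Zmap_mul {s a b : ℕ} {f g : (ZMod p)[X]} {z w : Hyper k} (hz : z ∈ Wsub k)
    (hw : w ∈ Wsub k) (hP : FrobCompat p b (Pel k p s a (phi p a s * f * g))) :
    Zmap s a f z * Zmap s a g w = Zmap s a (phi p a s * f * g) (z * w) := by
  have hxy : Xd k 1 ^ s * Yd k 1 ^ s ∈ Wsub k := by
    rw [Xd_one_pow, Yd_one_pow, smul_mul_smul_comm]
    exact Subalgebra.smul_mem _ (Xd_mul_Yd_self_mem s) _
  have h0 := evC_phiIco (k := k) (p := p) a (Nat.zero_le s)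
  rw [← phi_eq_phiIco, pow_zero, one_mul, Nat.sub_zero] at h0
  have hB : ∀ f : (ZMod p)[X], evC f * mu k p a ∈ Wsub k :=
    fun f => mul_mem (evC_mem f) (Ucar_le_Wsub (mu_mem _))
  have e1 : Yd k 1 ^ s * Xd k 1 ^ s * (evC f * mu k p a * (evC g * mu k p a)) =
      evC (phi p a s * f * g) * mu k p a := by
    have h1 : evC f * mu k p a * (evC g * mu k p a) = mu k p a * (evC f * evC g) := by
      rw [(commute_mu_evC _ _).symm.eq, mul_assoc, ← mul_assoc (evC f), ← map_mul,
        (commute_mu_evC _ _).symm.eq, ← mul_assoc, mu_idem, map_mul]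
    rw [h1, ← mul_assoc, ← h0, mul_assoc, ← map_mul, (commute_mu_evC _ _).eq, ← mul_assoc,
      ← map_mul, ← mul_assoc]
  set A := frob k p z with hA
  set B := frob k p w with hB'
  have hBW : B ∈ Wsub k := frob_mem_Wsub hw
  calc Zmap s a f z * Zmap s a g w
      = (Yd k 1 ^ s * A * Xd k 1 ^ s) * ((evC f * mu k p a) * (Yd k 1 ^ s * B * Xd k 1 ^ s)) *
          (evC g * mu k p a) := by rw [Zmap_eq, Zmap_eq]; simp only [mul_assoc, hA, hB']
    _ = (Yd k 1 ^ s * A) * (Xd k 1 ^ s * Yd k 1 ^ s * B) *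
          (Xd k 1 ^ s * (evC f * mu k p a * (evC g * mu k p a))) := by
        rw [(Wsub_comm (hB f) (pow_sandwich_mem hBW s)).eq]; simp only [mul_assoc]
    _ = (Yd k 1 ^ s * (A * B)) * (Xd k 1 ^ s *
          (Yd k 1 ^ s * Xd k 1 ^ s * (evC f * mu k p a * (evC g * mu k p a)))) := by
        rw [(Wsub_comm hxy hBW).eq]; simp only [mul_assoc]
    _ = _ := by
        rw [e1, ← mul_assoc (Xd k 1 ^ s), ← Pel, mul_assoc, ← hP.frob_mul hz hw, ← mul_assoc, Zmap]

/-- Against μ_a, Y^(p-i)X^(p-i) is φ_{a,p-i}(YX) divided by the invertible scalar (p - i)!². For i ≤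
a the polynomial φ_{a,p-a} divides φ_{a,p-i}, so the product with g is 0 modulo φ_{a,p}. -/
theorem frobCompat_of_dvd {a : ℕ} (ha : a < p) {g : (ZMod p)[X]}
    (h : phi p a p ∣ phi p a (p - a) * g) : FrobCompat p a (Pel k p 0 a g) where
  lt := ha
  mu_mul := by
    rw [Pel, pow_zero, one_mul, ← mul_assoc, (commute_mu_evC _ _).eq, mul_assoc, mu_idem]
  Cm_mul := by
    intro i hi hia
    have h0 := evC_phiIco (k := k) (p := p) a (Nat.zero_le (p - i))
    rw [← phi_eq_phiIco, pow_zero, one_mul, Nat.sub_zero, Yd_pow_mul_Xd_pow, smul_mul_assoc] at h0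
    have hu : ((p - i).factorial : k) ^ 2 ≠ 0 := by
      refine pow_ne_zero 2 ?_
      rw [Ne, CharP.cast_eq_zero_iff k p, (Fact.out : p.Prime).dvd_factorial]
      omega
    have hg : phiIco p a 0 p ∣ phi p a (p - i) * g := by
      rw [← phi_eq_phiIco]
      refine h.trans (mul_dvd_mul_right ?_ g)
      exact ⟨_, (phi_mul_phiIco a (by omega)).symm⟩
    have h1 := Pel_eq_zero (k := k) (Nat.zero_le p) hg
    rw [Pel, pow_zero, one_mul, map_mul, mul_assoc, ← (commute_mu_evC _ _).eq, ← mul_assoc, h0,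
      smul_mul_assoc, mul_assoc, (commute_mu_evC _ _).eq] at h1
    rw [Pel, pow_zero, one_mul]
    exact (smul_eq_zero.mp h1).resolve_left hu

/-- X^s carries the weight a to a + 2s, whose residue b is at most 1. Thus at most Y^(p-1)X^(p-1)
has to annihilate the element, which it does since X^(p-1) X = p X^(p) = 0. -/
theorem frobCompat_of_le_one {s a : ℕ} (hs : 1 ≤ s) (hb : (a + 2 * s) % p ≤ 1)
    (g : (ZMod p)[X]) : FrobCompat p ((a + 2 * s) % p) (Pel k p s a g) where
  lt := Nat.mod_lt _ (Fact.out : p.Prime).pos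
  mu_mul := by
    have h1 : mu k p ((a + 2 * s) % p : ℕ) * Xd k 1 ^ s = Xd k 1 ^ s * mu k p a := by
      rw [Xd_one_pow, mul_smul_comm, smul_mul_assoc, Ucar_mul_Xd (mu_mem _), shift_mu,
        mu_congr (b := a)]
      push_cast
      rw [Int.emod_sub_emod]
      congr 1
      ring
    rw [Pel, ← mul_assoc, ← mul_assoc, h1, mul_assoc _ (mu k p a), (commute_mu_evC _ _).eq,
      ← mul_assoc, mul_assoc, mu_idem]
  Cm_mul := by
    intro i hi hib
    obtain rfl : i = 1 := by omega
    have hp := (Fact.out : p.Prime).pos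
    obtain ⟨t, rfl⟩ : ∃ t, s = t + 1 := ⟨s - 1, by omega⟩
    have h1 : Xd k (p - 1) * Xd k 1 ^ (t + 1) = 0 := by
      rw [pow_succ', ← mul_assoc, Xd_mul_Xd, Nat.sub_add_cancel hp,
        ← Nat.choose_symm (Nat.sub_le p 1), Nat.sub_sub_self hp, Nat.choose_one_right,
        CharP.cast_eq_zero, zero_smul, zero_mul]
    rw [Cm, Pel, mul_assoc, ← mul_assoc (Xd k (p - 1)), ← mul_assoc (Xd k (p - 1)), h1, zero_mul,
      zero_mul, mul_zero]

end

section

variable {k : Type*} [Field k] {p : ℕ}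

theorem commute_mu {w : Hyper k} (hw : w ∈ Wsub k) (a : ℤ) : Commute (mu k p a) w :=
  Wsub_comm (Ucar_le_Wsub (mu_mem a)) hw

/-! ### Coefficients of elements of weight zero -/

section Injective

variable (k) in
/-- The value at `h` of the coefficient of `Y^(M) X^(M)`, written with the Cartan part in front. -/
def wtEv (M : ℕ) (h : ℤ) : Hyper k →ₗ[k] k :=
  (basisHyper k).constr k fun t =>
    if t.1 = M ∧ t.2.2 = M then intChoose k (h + 2 * M) t.2.1 else 0

theorem wtEv_Yd_mul_mul_Xd (M : ℕ) (h : ℤ) {u : Hyper k} (hu : u ∈ Ucar k) (m n : ℕ) :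
    wtEv k M h (Yd k m * u * Xd k n) = if m = M ∧ n = M then evH k (h + 2 * M) u else 0 := by
  rw [mem_Ucar] at hu
  induction hu using Submodule.span_induction with
  | mem u hu =>
    obtain ⟨l, rfl⟩ := hu
    rw [← basisHyper_apply, wtEv, Module.Basis.constr_basis, evH_Hbin, add_zero]
  | zero => simp
  | add u v _ _ hu hv =>
    simp only [map_add, add_mul, mul_add, hu, hv]
    split_ifs <;> simp
  | smul c u _ hu =>
    simp only [map_smul, smul_mul_assoc, mul_smul_comm, hu]
    split_ifs <;> simp

/-- The offset 2M in `wtEv` compensates for the shift which u undergoes when it is moved between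
Y^(M) and X^(M). -/
theorem wtEv_Ucar_mul_Cm (M : ℕ) (h : ℤ) {u : Hyper k} (hu : u ∈ Ucar k) (m : ℕ) :
    wtEv k M h (u * Cm k m) = if m = M then evH k h u else 0 := by
  rw [Ucar_mul_Cm hu, wtEv_Yd_mul_mul_Xd M h (shift_mem hu _), evH_shift hu]
  simp only [and_self]
  split_ifs with hm
  · rw [hm, add_neg_cancel_right]
  · rfl

theorem exists_finsupp_of_mem_Wsub {z : Hyper k} (hz : z ∈ Wsub k) :
    ∃ u : ℕ →₀ Hyper k, (∀ m, u m ∈ Ucar k) ∧ z = u.sum fun m x => x * Cm k m := by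
  rw [mem_Wsub] at hz
  induction hz using Submodule.span_induction with
  | mem z hz =>
    obtain ⟨u, hu, m, rfl⟩ := hz
    refine ⟨Finsupp.single m u, fun n => ?_, by simp⟩
    rw [Finsupp.single_apply]
    split_ifs
    · exact hu
    · exact zero_mem _
  | zero => exact ⟨0, fun _ => zero_mem _, by simp⟩
  | add z w _ _ hz hw =>
    obtain ⟨u, hu, rfl⟩ := hz
    obtain ⟨v, hv, rfl⟩ := hw
    refine ⟨u + v, fun m => add_mem (hu m) (hv m), ?_⟩
    rw [Finsupp.sum_add_index'] <;> simp [add_mul]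
  | smul c z _ hz =>
    obtain ⟨u, hu, rfl⟩ := hz
    refine ⟨c • u, fun m => Subalgebra.smul_mem _ (hu m) c, ?_⟩
    rw [Finsupp.sum_smul_index' (fun _ => by simp), Finsupp.smul_sum]
    simp

theorem eq_zero_of_wtEv {z : Hyper k} (hz : z ∈ Wsub k) (h : ∀ M h, wtEv k M h z = 0) : z = 0 := by
  obtain ⟨u, hu, rfl⟩ := exists_finsupp_of_mem_Wsub hz
  have key : ∀ M, u M = 0 := by
    intro M
    refine eq_zero_of_evH k (hu M) fun n => ?_
    have := h M n
    rw [Finsupp.sum, map_sum, Finset.sum_eq_single M] at this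
    · rwa [wtEv_Ucar_mul_Cm _ _ (hu M), if_pos rfl] at this
    · intro i _ hi
      rw [wtEv_Ucar_mul_Cm _ _ (hu i), if_neg hi]
    · intro hM
      rw [Finsupp.notMem_support_iff.mp hM, zero_mul, map_zero]
  have : u = 0 := Finsupp.ext key
  simp [this]

end Injective

variable [Fact p.Prime] [CharP k p]

/-! ### The elements `Z^(ε)(z; (a, j))` in uniform shape -/

section Zel

variable (p) in
/-- The cofactor of `φ_{a,s}` in the polynomial of `B^(ε)(a, j)`. -/
def gPoly (s : ℕ) (ε : Fin 2) (a : ℕ) (j : ℚ) : (ZMod p)[X] :=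
  ∑ m ∈ Finset.Icc (nNum p ε a j) (p - 1), C (coef p ε a j m) * phiIco p a s m

theorem phi_mul_gPoly {s : ℕ} {ε : Fin 2} {a : ℕ} {j : ℚ} (haj : (a, j) ∈ Pairs p)
    (hs : s ≤ nNum p ε a j) : phi p a s * gPoly p s ε a j = bPoly p ε a j := by
  rw [bPoly_eq_sum p ε a j haj, gPoly, Finset.mul_sum]
  refine Finset.sum_congr rfl fun m hm => ?_
  rw [← phi_mul_phiIco a (hs.trans (Finset.mem_Icc.mp hm).1)]
  ring

/-- Inside the outer Y^s and X^s, the weight zero factor Y^(m-s)X^(m-s) commutes past Fr'(z); then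
`evC_phiIco` turns Y^(m-s)X^m μ_a into X^s times a polynomial in YX times μ_a. -/
theorem mu_mul_pow_frob {s m a : ℕ} (hsm : s ≤ m) {z : Hyper k} (hz : z ∈ Wsub k) :
    mu k p a * (Yd k 1 ^ m * Xd k 1 ^ (m - s) * frob k p z * Xd k 1 ^ s) =
      Zmap s a (phiIco p a s m) z := by
  have h1 : Yd k 1 ^ (m - s) * Xd k 1 ^ (m - s) ∈ Wsub k := by
    rw [Yd_pow_mul_Xd_pow]; exact Subalgebra.smul_mem _ (Cm_mem _) _
  have hF : frob k p z ∈ Wsub k := frob_mem_Wsub hz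
  have e : Yd k 1 ^ m * Xd k 1 ^ (m - s) * frob k p z * Xd k 1 ^ s =
      Yd k 1 ^ s * (Yd k 1 ^ (m - s) * Xd k 1 ^ (m - s) * frob k p z) * Xd k 1 ^ s := by
    conv_lhs => rw [← Nat.add_sub_cancel' hsm, pow_add, Nat.add_sub_cancel_left]
    simp only [mul_assoc]
  rw [e, (commute_mu (pow_sandwich_mem (mul_mem h1 hF) s) _).eq, (Wsub_comm h1 hF).eq, Zmap, Pel,
    evC_phiIco a hsm]
  conv_rhs => rw [← Nat.add_sub_cancel' hsm, add_comm s, pow_add, Nat.add_sub_cancel]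
  simp only [mul_assoc]

theorem Zmap_gPoly {s : ℕ} {ε : Fin 2} {a : ℕ} {j : ℚ} (hs : s ≤ nNum p ε a j) {z : Hyper k}
    (hz : z ∈ Wsub k) : Zmap s a (gPoly p s ε a j) z =
      mu k p a * ∑ m ∈ Finset.Icc (nNum p ε a j) (p - 1),
        (ZMod.castHom (dvd_refl p) k (coef p ε a j m)) •
          (Yd k 1 ^ m * Xd k 1 ^ (m - s) * frob k p z * Xd k 1 ^ s) := by
  rw [Finset.mul_sum, Zmap, Pel, gPoly, map_sum, Finset.mul_sum, Finset.sum_mul, Finset.mul_sum]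
  refine Finset.sum_congr rfl fun m hm => ?_
  rw [mul_smul_comm, mu_mul_pow_frob (hs.trans (Finset.mem_Icc.mp hm).1) hz, evC_C_mul,
    mul_smul_comm, smul_mul_assoc, mul_smul_comm, Zmap, Pel]

variable (p) in
open Classical in
/-- The exponent `s` in the definition of `Z^(ε)(z; (a, j))`, zero in the second case. -/
def sEff (a : ℕ) (j : ℚ) : ℕ := if condA p a j ∨ condC a j then sNum p a else 0

/-- Both cases in the definition of Z^(ε) take the same form: the second is the first with s = 0, as
Fr'(z) commutes with each Y^m X^m. -/
theorem Zel_eq_Zmap {ε : Fin 2} {a : ℕ} {j : ℚ} (haj : (a, j) ∈ Pairs p)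
    (hs : sEff p a j ≤ nNum p ε a j) {z : Hyper k} (hz : z ∈ Wsub k) :
    Zel k p ε a j z = Zmap (sEff p a j) a (gPoly p (sEff p a j) ε a j) z := by
  rw [Zmap_gPoly hs hz, Zel]
  by_cases h : condA p a j ∨ condC a j
  · simp only [sEff, if_pos h]
  · simp only [sEff, if_neg h, Nat.sub_zero, pow_zero, mul_one]
    have hF : frob k p z ∈ Wsub k := frob_mem_Wsub hz
    rw [bOne_eq_sum k p ε a j haj, ← mul_assoc, ← (commute_mu hF _).eq, mul_assoc, Finset.mul_sum]
    congr 1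
    refine Finset.sum_congr rfl fun m _ => ?_
    rw [mul_smul_comm, (Wsub_comm hF _).eq]
    rw [Yd_pow_mul_Xd_pow]; exact Subalgebra.smul_mem _ (Cm_mem _) _

theorem bOne_eq_Zel {ε : Fin 2} {a : ℕ} {j : ℚ} (haj : (a, j) ∈ Pairs p)
    (hs : sEff p a j ≤ nNum p ε a j) : bOne k p ε a j = Zel k p ε a j 1 := by
  rw [Zel, frob_one, one_mul]
  split_ifs with h
  · rw [bOne_eq_sum k p ε a j haj]
    congr 1
    refine Finset.sum_congr rfl fun m hm => ?_
    rw [sEff, if_pos h] at hs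
    rw [mul_one, mul_assoc, ← pow_add, Nat.sub_add_cancel (hs.trans (Finset.mem_Icc.mp hm).1)]
  · rfl

end Zel

/-! ### The action of generators of `𝒜` on `Z(1)` -/

section Action

theorem Zmap_add (s a : ℕ) (g : (ZMod p)[X]) (z w : Hyper k) :
    Zmap s a g (z + w) = Zmap s a g z + Zmap s a g w := by
  simp only [Zmap, map_add, mul_add, add_mul]

theorem Zmap_smul (s a : ℕ) (g : (ZMod p)[X]) (c : k) (z : Hyper k) :
    Zmap s a g (c • z) = c • Zmap s a g z := by
  simp only [Zmap, map_smul, mul_smul_comm, smul_mul_assoc]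

theorem Cm_one_mul_Zmap (s a : ℕ) (g : (ZMod p)[X]) {z : Hyper k} (hz : z ∈ Wsub k) :
    Cm k 1 * Zmap s a g z = Zmap s a (X * g) z := by
  rw [Zmap_eq, Zmap_eq, ← mul_assoc, (Wsub_comm (Cm_mem 1) (pow_sandwich_mem
    (frob_mem_Wsub hz) s)).eq, mul_assoc, ← mul_assoc (Cm k 1), map_mul, evC_X]

/-- On weights h = a + pt Lucas splits (h + c choose n) into a constant and a binomial in ⌊(a +
c)/p⌋ + t. Inside Y^s … X^s the map Fr' sees the weight h + 2s, that is ⌊(a + 2s)/p⌋ + t, hence the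
difference of the two quotients. -/
theorem Hbin_mul_Zmap (s a : ℕ) (g : (ZMod p)[X]) (c : ℤ) (n : ℕ) :
    Hbin k c n * Zmap s a g 1 = intChoose k ((a + c) % p) (n % p) •
      Zmap s a g (Hbin k ((a + c) / p - (a + 2 * s) / p) (n / p)) := by
  have hp0 : (p : ℤ) ≠ 0 := by exact_mod_cast (Fact.out : p.Prime).ne_zero
  set e : ℤ := (a + c) / p - (a + 2 * s) / p with he
  have key : Hbin k c n * mu k p a = (intChoose k ((a + c) % p) (n % p) •
      Hbin k (e * p + 2 * s) (n / p * p)) * mu k p a := by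
    refine mul_mu_congr (Hbin_mem_Ucar k _ _) (Subalgebra.smul_mem _ (Hbin_mem_Ucar k _ _) _) _
      fun h hh => ?_
    rw [map_smul, evH_Hbin, evH_Hbin, intChoose_mul, intChoose_lucas k p (h + c), smul_eq_mul]
    obtain ⟨t, rfl⟩ : ∃ t : ℤ, h = a + p * t :=
      ⟨(h - a) / p, by rw [Int.mul_ediv_cancel' (Int.dvd_of_emod_eq_zero
        (Int.emod_eq_emod_iff_emod_sub_eq_zero.mp hh))]; ring⟩
    have h1 : (a : ℤ) + p * t + c = a + c + p * t := by ring
    have h2 : (a : ℤ) + p * t + (e * p + 2 * s) = a + 2 * s + p * (t + e) := by ring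
    rw [h1, h2, Int.add_mul_emod_self_left, Int.add_mul_ediv_left _ _ hp0,
      Int.add_mul_ediv_left _ _ hp0, he]
    congr 2
    ring
  have hW : ∀ w ∈ Wsub k, Yd k 1 ^ s * w * Xd k 1 ^ s * (evC g * mu k p a) =
      mu k p a * (Yd k 1 ^ s * w * Xd k 1 ^ s * evC g) := by
    intro w hw
    rw [← mul_assoc, (commute_mu (mul_mem (pow_sandwich_mem hw s) (evC_mem g)) _).eq]
  rw [Zmap_eq, Zmap_eq, frob_one, frob_Hbin, hW _ (one_mem _),
    hW _ (Ucar_le_Wsub (Hbin_mem_Ucar k _ _)), ← mul_assoc, key, mul_one, smul_mul_assoc,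
    smul_mul_assoc]
  congr 1
  have h3 : Yd k 1 ^ s * Hbin k (e * p) (n / p * p) = Hbin k (e * p + 2 * s) (n / p * p) *
      Yd k 1 ^ s := by
    rw [Yd_one_pow, smul_mul_assoc, mul_smul_comm, Yd_mul_Ucar (Hbin_mem_Ucar k _ _), shift_Hbin]
  rw [h3, (commute_mu (Ucar_le_Wsub (Hbin_mem_Ucar k _ _)) _).symm.eq]
  simp only [mul_assoc]

/-- In the commutator of X^(np) and Y^(s) each correction term with 0 < i ≤ s carries, after
multiplication by X^(s), a coefficient congruent to (s - i choose s) = 0. So Y^(np)X^(np) slips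
inside Y^s … X^s. -/
theorem Cm_mul_Zmap {s : ℕ} (hs : s < p) (a : ℕ) (g : (ZMod p)[X]) (n : ℕ) :
    Cm k (n * p) * Zmap s a g 1 = Zmap s a g (Cm k n) := by
  have h1 : Cm k (n * p) * Yd k s * Xd k s = Yd k s * Cm k (n * p) * Xd k s := by
    rw [Cm, mul_assoc (Yd k (n * p)), Xd_mul_Yd, mul_assoc, Finset.sum_mul, Finset.mul_sum,
      Finset.sum_eq_single 0]
    · have hy : Yd k (n * p) * Yd k s = Yd k s * Yd k (n * p) := by
        rw [Yd_mul_Yd, Yd_mul_Yd, add_comm s, Nat.choose_symm_add]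
      simp only [Nat.sub_zero, Hbin_zero, mul_one, ← mul_assoc, hy]
    · intro i hi hi0
      rw [Finset.mem_range, Nat.lt_succ_iff, le_min_iff] at hi
      have hc : n * p = p * n := mul_comm n p
      rw [mul_assoc (_ * _), Xd_mul_Xd, show n * p - i + s = (s - i) + p * n by omega]
      have h2 := nat_choose_lucas k p (s - i) s n 0 (by omega) hs
      rw [Nat.choose_eq_zero_of_lt (by omega : s - i < s), Nat.cast_zero, zero_mul, mul_zero,
        add_zero] at h2
      rw [← Nat.choose_symm (by omega), show s - i + p * n - (n * p - i) = s by omega, h2,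
        zero_smul, mul_zero, mul_zero]
    · intro h
      simp at h
  rw [Zmap, Zmap, frob_one, mul_one, frob_Cm, Pel, Xd_one_pow, Yd_one_pow]
  simp only [smul_mul_assoc, mul_smul_comm, smul_smul]
  congr 1
  simp only [← mul_assoc, h1]

end Action

/-! ### Injectivity of `Z` on elements of weight zero -/

section ZmapInjective

/-- The divided power index m goes to mp + i, so different summands of Z land on different residues
modulo p. The constant consists of factorials below p and of (i choose s)², hence is nonzero. -/
theorem Zmap_phiIco {s i : ℕ} (hsi : s ≤ i) (hi : i < p) (a : ℕ) : ∃ c : k, c ≠ 0 ∧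
    ∀ u ∈ Ucar k, ∀ m, Zmap s a (phiIco p a s i) (u * Cm k m) =
      c • (shift k (2 * s) (frob k p u) * mu k p a * Cm k (m * p + i)) := by
  have hfac : ∀ n < p, (n.factorial : k) ≠ 0 := by
    intro n hn
    rw [Ne, CharP.cast_eq_zero_iff k p, (Fact.out : p.Prime).dvd_factorial]
    omega
  have hch : (i.choose s : k) ≠ 0 := by
    intro h0
    have h1 := congrArg (Nat.cast (R := k)) (Nat.choose_mul_factorial_mul_factorial hsi)
    push_cast at h1
    rw [h0, zero_mul, zero_mul] at h1
    exact hfac i hi h1.symm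
  refine ⟨((i - s).factorial : k) ^ 2 * (s.factorial : k) ^ 2 * (i.choose s : k) ^ 2, ?_, ?_⟩
  · exact mul_ne_zero (mul_ne_zero (pow_ne_zero 2 (hfac _ (by omega)))
      (pow_ne_zero 2 (hfac _ (by omega)))) (pow_ne_zero 2 hch)
  intro u hu m
  have hF : frob k p u ∈ Ucar k := frob_mem hu
  rw [← mu_mul_pow_frob hsi (Ucar_mul_Cm_mem hu m), frob_Ucar_mul_Cm hu]
  have e : Yd k 1 ^ i * Xd k 1 ^ (i - s) * (frob k p u * Cm k (m * p)) * Xd k 1 ^ s =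
      Yd k 1 ^ s * ((Yd k 1 ^ (i - s) * Xd k 1 ^ (i - s)) * (frob k p u * Cm k (m * p))) *
        Xd k 1 ^ s := by
    conv_lhs => rw [← Nat.add_sub_cancel' hsi, pow_add, Nat.add_sub_cancel_left]
    simp only [mul_assoc]
  have hl := nat_choose_lucas k p i s m 0 hi (by omega)
  rw [mul_zero, add_zero, Nat.choose_zero_right, Nat.cast_one, mul_one] at hl
  have hl2 : ((i + p * m).choose (m * p + (i - s)) : k) = i.choose s := by
    rw [← hl, Nat.choose_symm_of_eq_add]
    have : m * p = p * m := mul_comm m p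
    omega
  have e2 : Yd k s * (frob k p u * Cm k (m * p + (i - s))) * Xd k s =
      ((i.choose s : k) ^ 2) • (shift k (2 * s) (frob k p u) * Cm k (m * p + i)) := by
    have hi' : s + (m * p + (i - s)) = i + p * m := by
      have : m * p = p * m := mul_comm m p
      omega
    rw [← mul_assoc, Yd_mul_Ucar hF, Cm, mul_assoc, mul_assoc, mul_assoc (Yd k (_ + _)), Xd_mul_Xd,
      ← mul_assoc (Yd k s), Yd_mul_Yd, Nat.add_comm (m * p + (i - s)) s, hi',
      hl, hl2, smul_mul_smul_comm, mul_smul_comm,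
      ← sq, Cm, mul_comm m p, add_comm i]
  rw [e, Yd_pow_mul_Xd_pow, smul_mul_assoc, (commute_Ucar_Cm hF _).symm.left_comm,
    ((commute_Cm_Cm (k := k) (i - s) (m * p))).eq, ← Cm_add m (i - s) (by omega), mul_smul_comm,
    Xd_one_pow, Yd_one_pow]
  simp only [smul_mul_assoc, mul_smul_comm, smul_smul, e2]
  rw [(Ucar_comm k (mu_mem (p := p) a) (shift_mem hF _)).left_comm, ← mul_assoc (shift k _ _)]
  congr 1
  ring

theorem Zmap_sum (s a : ℕ) (S : Finset ℕ) (c : ℕ → ZMod p) (f : ℕ → (ZMod p)[X]) (z : Hyper k) :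
    Zmap s a (∑ m ∈ S, C (c m) * f m) z =
      ∑ m ∈ S, ZMod.castHom (dvd_refl p) k (c m) • Zmap s a (f m) z := by
  simp only [Zmap, Pel, map_sum, Finset.mul_sum, Finset.sum_mul, evC_C_mul, mul_smul_comm,
    smul_mul_assoc]

/-- One nonzero coefficient c_i suffices: the coefficient of Y^(Mp+i)X^(Mp+i) at the weights a + pt
recovers, up to a nonzero scalar, every value of the coefficient of Y^(M)X^(M) in z. -/
theorem eq_zero_of_Zmap_eq_zero {s a n : ℕ} (hsn : s ≤ n) {c : ℕ → ZMod p} {i : ℕ}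
    (hi : i ∈ Finset.Icc n (p - 1)) (hc : c i ≠ 0) {z : Hyper k} (hz : z ∈ Wsub k)
    (h : Zmap s a (∑ m ∈ Finset.Icc n (p - 1), C (c m) * phiIco p a s m) z = 0) : z = 0 := by
  have hp := (Fact.out : p.Prime).pos
  have hp0 : (p : ℤ) ≠ 0 := by exact_mod_cast hp.ne'
  have hlt : ∀ l ∈ Finset.Icc n (p - 1), s ≤ l ∧ l < p := by
    intro l hl
    rw [Finset.mem_Icc] at hl
    omega
  choose! d hd0 hd using fun l (hl : s ≤ l ∧ l < p) => Zmap_phiIco (k := k) hl.1 hl.2 a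
  have key : ∀ (M : ℕ) (t : ℤ), wtEv k (M * p + i) (a + p * t)
      (Zmap s a (∑ m ∈ Finset.Icc n (p - 1), C (c m) * phiIco p a s m) z) =
        ZMod.castHom (dvd_refl p) k (c i) * d i * wtEv k M ((a + 2 * s) / p + t) z := by
    intro M t
    clear h
    rw [mem_Wsub] at hz
    induction hz using Submodule.span_induction with
    | mem z hz =>
      obtain ⟨u, hu, m, rfl⟩ := hz
      have hF : frob k p u ∈ Ucar k := frob_mem hu
      rw [Zmap_sum, map_sum, Finset.sum_eq_single i]
      · rw [hd i (hlt i hi) u hu m, map_smul, map_smul,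
          wtEv_Ucar_mul_Cm _ _ (mul_mem (shift_mem hF _) (mu_mem _)), wtEv_Ucar_mul_Cm _ _ hu,
          smul_eq_mul, smul_eq_mul, mul_assoc]
        congr 2
        by_cases hm : m = M
        · rw [if_pos hm, if_pos (by rw [hm]), evH_mul k _ (shift_mem hF _) (mu_mem _),
            evH_shift hF, evH_mu, if_pos (by rw [Int.add_mul_emod_self_left]), mul_one,
            evH_frob hu]
          congr 1
          rw [add_right_comm, Int.add_mul_ediv_left _ _ hp0]
        · rw [if_neg hm, if_neg]
          intro he
          exact hm (Nat.eq_of_mul_eq_mul_right hp (Nat.add_right_cancel he))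
      · intro l hl hli
        rw [hd l (hlt l hl) u hu m, map_smul, map_smul,
          wtEv_Ucar_mul_Cm _ _ (mul_mem (shift_mem hF _) (mu_mem _)), if_neg, smul_zero, smul_zero]
        intro he
        have h1 := congrArg (· % p) he
        simp only [Nat.mul_add_mod', Nat.mod_eq_of_lt (hlt l hl).2,
          Nat.mod_eq_of_lt (hlt i hi).2] at h1
        exact hli h1
      · exact fun hni => absurd hi hni
    | zero => simp [Zmap]
    | add z w _ _ hz hw => rw [Zmap_add, map_add, map_add, hz, hw, mul_add]
    | smul e z _ hz =>
      rw [Zmap_smul, map_smul, map_smul, hz, smul_eq_mul, smul_eq_mul, mul_left_comm]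
  refine eq_zero_of_wtEv hz fun M t => ?_
  have h1 := key M (t - (a + 2 * s) / p)
  rw [h, map_zero, add_sub_cancel, eq_comm] at h1
  have h2 : ZMod.castHom (dvd_refl p) k (c i) ≠ 0 := by
    rwa [Ne, map_eq_zero]
  exact (mul_eq_zero.mp h1).resolve_left (mul_ne_zero h2 (hd0 i (hlt i hi)))

end ZmapInjective

end

/-! ### Periodic Cartan elements and the algebras `𝒜`, `U_r`, `A_r` -/

section

variable {k : Type*} [Field k] {p : ℕ}

section Interpolation

theorem exists_interpolation (N : ℕ) (f : ℕ → k) :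
    ∃ v ∈ Submodule.span k (Hbin k 0 '' Set.Iio N), ∀ h < N, evH k h v = f h := by
  induction N with
  | zero => exact ⟨0, zero_mem _, by simp⟩
  | succ N ih =>
    obtain ⟨v, hv, hvf⟩ := ih
    refine ⟨v + (f N - evH k N v) • Hbin k 0 N, add_mem ?_ ?_, fun h hh => ?_⟩
    · exact Submodule.span_mono (Set.image_mono (Set.Iio_subset_Iio (Nat.le_succ N))) hv
    · exact Submodule.smul_mem _ _ (Submodule.subset_span ⟨N, Nat.lt_succ_self N, rfl⟩)
    · rw [map_add, map_smul, evH_Hbin, add_zero, intChoose_natCast]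
      rcases Nat.lt_succ_iff_lt_or_eq.mp hh with h1 | rfl
      · rw [hvf h h1, Nat.choose_eq_zero_of_lt h1]; simp
      · simp

end Interpolation

variable [Fact p.Prime] [CharP k p]

variable (k p) in
/-- The elements of the Cartan part whose values only depend on the weight modulo `p ^ r`. -/
def Uper (r : ℕ) : Subalgebra k (Hyper k) where
  carrier := {u | u ∈ Ucar k ∧ ∀ h : ℤ, evH k (h + (p ^ r : ℕ)) u = evH k h u}
  mul_mem' := fun ⟨hu, hu'⟩ ⟨hv, hv'⟩ => ⟨mul_mem hu hv, fun h => by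
    rw [evH_mul k _ hu hv, evH_mul k _ hu hv, hu', hv']⟩
  add_mem' := fun ⟨hu, hu'⟩ ⟨hv, hv'⟩ => ⟨add_mem hu hv, fun h => by
    rw [map_add, map_add, hu', hv']⟩
  algebraMap_mem' := fun c => ⟨Subalgebra.algebraMap_mem _ c, fun h => by
    rw [Algebra.algebraMap_eq_smul_one, map_smul, map_smul, evH_one, evH_one]⟩

omit [Fact p.Prime] [CharP k p] in
theorem shift_mem_Uper {r : ℕ} {u : Hyper k} (hu : u ∈ Uper k p r) (d : ℤ) :
    shift k d u ∈ Uper k p r :=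
  ⟨shift_mem hu.1 d, fun h => by
    rw [evH_shift hu.1, evH_shift hu.1, add_right_comm, hu.2]⟩

theorem Hbin_mem_Uper {r n : ℕ} (hn : n < p ^ r) (c : ℤ) : Hbin k c n ∈ Uper k p r :=
  ⟨Hbin_mem_Ucar k c n, fun h => by
    rw [evH_Hbin, evH_Hbin, add_right_comm, intChoose_add_pow k p hn]⟩

/-- The values at 0, …, p^r - 1 can be interpolated by binomials of index below p^r, which are
themselves periodic; periodicity then forces equality at all weights. -/
theorem Uper_le_span {r : ℕ} {u : Hyper k} (hu : u ∈ Uper k p r) :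
    u ∈ Submodule.span k (Hbin k 0 '' Set.Iio (p ^ r)) := by
  obtain ⟨v, hv, hvu⟩ := exists_interpolation (p ^ r) (fun h : ℕ => evH k h u)
  have hper : ∀ w ∈ Uper k p r, ∀ (n t : ℕ), evH k (n + (p ^ r : ℕ) * t : ℤ) w = evH k n w := by
    intro w hw n t
    induction t with
    | zero => simp
    | succ t ih => rw [← ih, ← hw.2 (n + (p ^ r : ℕ) * (t : ℤ))]; congr 2; push_cast; ring
  have hvU : v ∈ Uper k p r := by
    have : Submodule.span k (Hbin k 0 '' Set.Iio (p ^ r)) ≤ (Uper k p r).toSubmodule := by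
      rw [Submodule.span_le]
      rintro _ ⟨n, hn, rfl⟩
      exact Hbin_mem_Uper hn 0
    exact this hv
  have : u = v := by
    refine sub_eq_zero.mp (eq_zero_of_evH k (sub_mem hu.1 hvU.1) fun n => ?_)
    have h1 := hper u hu (n % p ^ r) (n / p ^ r)
    have h2 := hper v hvU (n % p ^ r) (n / p ^ r)
    have e : ((n % p ^ r : ℕ) : ℤ) + (p ^ r : ℕ) * (n / p ^ r : ℕ) = n := by
      exact_mod_cast Nat.mod_add_div n (p ^ r)
    rw [e] at h1 h2
    rw [map_sub, h1, h2, hvu _ (Nat.mod_lt _ (pow_pos (Fact.out : p.Prime).pos _)), sub_self]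
  rwa [this]

section Aall

/-- Modulo p this binomial is the leading p-adic digit of m. It permits induction on m by splitting
off the leading power of p. -/
theorem choose_pow_log_ne_zero {m : ℕ} (hm : m ≠ 0) :
    (m.choose (p ^ Nat.log p m) : k) ≠ 0 := by
  have hP := (Fact.out : p.Prime)
  have key : ∀ (v : ℕ) (h : ℤ), intChoose k h (p ^ v) = ((h / (p ^ v : ℕ) : ℤ) : k) := by
    intro v
    induction v with
    | zero => intro h; simp
    | succ v ih =>
      intro h
      rw [pow_succ, intChoose_mul, ih, mul_comm (p ^ v) p, Nat.cast_mul,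
        Int.ediv_ediv_of_nonneg (by positivity)]
  rw [← intChoose_natCast, key, ← Int.natCast_div, Int.cast_natCast]
  refine natCast_ne_zero_of_lt (p := p) ?_ ?_
  · exact (Nat.div_pos (Nat.pow_log_le_self p hm) (pow_pos hP.pos _)).ne'
  · rw [Nat.div_lt_iff_lt_mul (pow_pos hP.pos _), ← pow_succ']
    exact Nat.lt_pow_succ_log_self hP.one_lt m

theorem frob_mem_Uzero {u : Hyper k} (hu : u ∈ Uzero k p) : u ∈ Ucar k ∧ frob k p u ∈ Uzero k p := by
  induction hu using Algebra.adjoin_induction with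
  | mem u hu =>
    obtain ⟨i, rfl⟩ := hu
    refine ⟨Hbin_mem_Ucar k _ _, ?_⟩
    dsimp only
    rw [frob_Hbin_zero, ← pow_succ]
    exact Algebra.subset_adjoin ⟨i + 1, rfl⟩
  | algebraMap c =>
    refine ⟨Subalgebra.algebraMap_mem _ c, ?_⟩
    rw [Algebra.algebraMap_eq_smul_one, map_smul, frob_one]
    exact Subalgebra.smul_mem _ (one_mem _) c
  | add u v _ _ hu hv => exact ⟨add_mem hu.1 hv.1, by rw [map_add]; exact add_mem hu.2 hv.2⟩
  | mul u v _ _ hu hv =>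
    exact ⟨mul_mem hu.1 hv.1, by rw [frob_Ucar_mul hu.1 hv.1]; exact mul_mem hu.2 hv.2⟩

theorem Hbin_zero_mem_Uzero (n : ℕ) : Hbin k 0 n ∈ Uzero k p := by
  have hP := (Fact.out : p.Prime)
  induction n using Nat.strong_induction_on with
  | _ n ih =>
  rcases lt_or_ge n p with hn | hn
  · rcases Nat.eq_zero_or_pos n with rfl | h0
    · rw [Hbin_zero]; exact one_mem _
    obtain ⟨m, rfl⟩ : ∃ m, n = m + 1 := ⟨n - 1, by omega⟩
    have h1 := Hbin_succ k 0 m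
    have h2 : ((m : Hyper k) + 1) * Hbin k 0 (m + 1) = ((m + 1 : ℕ) : k) • Hbin k 0 (m + 1) := by
      rw [Algebra.smul_def, map_natCast, Nat.cast_succ]
    rw [h2, Int.cast_zero, add_zero] at h1
    have hu : ((m + 1 : ℕ) : k) ≠ 0 := natCast_ne_zero_of_lt (by omega) hn
    rw [← inv_smul_smul₀ hu (Hbin k 0 (m + 1)), h1]
    refine Subalgebra.smul_mem _ (mul_mem (ih m (by omega)) (sub_mem ?_ ?_)) _
    · exact Algebra.subset_adjoin ⟨0, by simp⟩
    · rw [← map_natCast (algebraMap k (Hyper k))]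
      exact Subalgebra.algebraMap_mem _ _
  -- Lucas' theorem as an identity of Cartan elements. As Fr' sends the generator of index p^i to
  -- that of index p^(i+1), it preserves the algebra they generate.
  · have e : Hbin k 0 n = Hbin k 0 (n % p) * frob k p (Hbin k 0 (n / p)) := by
      refine ext_evH k (Hbin_mem_Ucar k _ _) (mul_mem (Hbin_mem_Ucar k _ _)
        (frob_mem (Hbin_mem_Ucar k _ _))) fun h => ?_
      rw [evH_mul k _ (Hbin_mem_Ucar k _ _) (frob_mem (Hbin_mem_Ucar k _ _)),
        evH_frob (Hbin_mem_Ucar k _ _)]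
      simp only [evH_Hbin, add_zero]
      have h1 := intChoose_lucas k p h (n % p)
      rw [Nat.mod_mod, Nat.div_eq_of_lt (Nat.mod_lt n hP.pos), intChoose_zero_right, mul_one] at h1
      rw [h1, ← intChoose_lucas k p]
    rw [e]
    exact mul_mem (ih _ ((Nat.mod_lt n hP.pos).trans_le hn))
      (frob_mem_Uzero (ih _ (Nat.div_lt_self (hP.pos.trans_le hn) hP.one_lt))).2

theorem Ucar_eq_Uzero : Ucar k = Uzero k p := by
  apply le_antisymm
  · intro u hu
    rw [mem_Ucar] at hu
    have : Submodule.span k (Set.range (Hbin k 0)) ≤ (Uzero k p).toSubmodule := by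
      rw [Submodule.span_le]
      rintro _ ⟨n, rfl⟩
      exact Hbin_zero_mem_Uzero n
    exact this hu
  · exact fun u hu => (frob_mem_Uzero hu).1

/-- With q the leading power of p in m, the product of the elements with indices m - q and q is (m
choose q)² Y^(m)X^(m) plus terms of lower index, and the coefficient is invertible. -/
theorem Cm_mem_Aall (m : ℕ) : Cm k m ∈ Aall k p := by
  induction m using Nat.strong_induction_on with
  | _ m ih =>
  rcases Nat.eq_zero_or_pos m with rfl | hm
  · rw [Cm_zero]; exact one_mem _
  set q := p ^ Nat.log p m with hq
  have hqm : q ≤ m := Nat.pow_log_le_self p hm.ne'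
  have hq0 : 0 < q := pow_pos (Fact.out : p.Prime).pos _
  have h := Cm_mul_Cm (k := k) (m - q) q
  rw [Finset.sum_range_succ', Nat.sub_add_cancel hqm, Nat.sub_zero, Nat.choose_symm hqm,
    Hbin_zero, one_mul] at h
  have hq1 : Cm k q ∈ Aall k p := Algebra.subset_adjoin (Or.inr ⟨_, rfl⟩)
  have hu : ((m.choose q : k) * m.choose q) ≠ 0 :=
    mul_ne_zero (choose_pow_log_ne_zero hm.ne') (choose_pow_log_ne_zero hm.ne')
  rw [← inv_smul_smul₀ hu (Cm k m), eq_sub_of_add_eq' h.symm]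
  refine Subalgebra.smul_mem _ (sub_mem (mul_mem (ih _ (by omega)) hq1) (sum_mem fun i _ => ?_)) _
  refine Subalgebra.smul_mem _ (mul_mem ?_ (ih _ (by omega))) _
  refine Algebra.subset_adjoin (Or.inl ?_)
  rw [SetLike.mem_coe, ← Ucar_eq_Uzero]
  exact Hbin_mem_Ucar k _ _

theorem Aall_eq_Wsub : Aall k p = Wsub k := by
  apply le_antisymm
  · rw [Aall, Algebra.adjoin_le_iff]
    rintro u (hu | ⟨i, rfl⟩)
    · rw [← Ucar_eq_Uzero] at hu
      exact Ucar_le_Wsub hu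
    · exact Cm_mem _
  · intro w hw
    rw [mem_Wsub] at hw
    have : Submodule.span k (wtGens k) ≤ (Aall k p).toSubmodule := by
      rw [Submodule.span_le]
      rintro _ ⟨u, hu, m, rfl⟩
      show _ ∈ Aall k p
      refine mul_mem (Algebra.subset_adjoin (Or.inl ?_)) (Cm_mem_Aall m)
      rw [SetLike.mem_coe, ← Ucar_eq_Uzero]
      exact hu
    exact this hw

end Aall

section Usub

theorem Xd_mem_Usub {r m : ℕ} (hm : m < p ^ r) : Xd k m ∈ Usub k p r := by
  induction m using Nat.strong_induction_on with
  | _ m ih =>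
  rcases Nat.eq_zero_or_pos m with rfl | h0
  · rw [Xd_zero]; exact one_mem _
  have hqm : p ^ Nat.log p m ≤ m := Nat.pow_log_le_self p h0.ne'
  have hq0 : 0 < p ^ Nat.log p m := pow_pos (Fact.out : p.Prime).pos _
  have h := Xd_mul_Xd k (p ^ Nat.log p m) (m - p ^ Nat.log p m)
  rw [Nat.add_sub_cancel' hqm] at h
  rw [← inv_smul_smul₀ (choose_pow_log_ne_zero (k := k) (p := p) h0.ne') (Xd k m), ← h]
  have hq : Xd k (p ^ Nat.log p m) ∈ Usub k p r := Algebra.subset_adjoin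
    ⟨_, (Nat.pow_lt_pow_iff_right (Fact.out : p.Prime).one_lt).mp (hqm.trans_lt hm), Or.inl rfl⟩
  exact Subalgebra.smul_mem _ (mul_mem hq (ih _ (by omega) (by omega))) _

theorem Yd_mem_Usub {r m : ℕ} (hm : m < p ^ r) : Yd k m ∈ Usub k p r := by
  induction m using Nat.strong_induction_on with
  | _ m ih =>
  rcases Nat.eq_zero_or_pos m with rfl | h0
  · rw [Yd_zero]; exact one_mem _
  have hqm : p ^ Nat.log p m ≤ m := Nat.pow_log_le_self p h0.ne'
  have hq0 : 0 < p ^ Nat.log p m := pow_pos (Fact.out : p.Prime).pos _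
  have h := Yd_mul_Yd k (p ^ Nat.log p m) (m - p ^ Nat.log p m)
  rw [Nat.add_sub_cancel' hqm] at h
  rw [← inv_smul_smul₀ (choose_pow_log_ne_zero (k := k) (p := p) h0.ne') (Yd k m), ← h]
  have hq : Yd k (p ^ Nat.log p m) ∈ Usub k p r := Algebra.subset_adjoin
    ⟨_, (Nat.pow_lt_pow_iff_right (Fact.out : p.Prime).one_lt).mp (hqm.trans_lt hm), Or.inr rfl⟩
  exact Subalgebra.smul_mem _ (mul_mem hq (ih _ (by omega) (by omega))) _

/-- For c = 0 the binomial is the last term of Kostant's formula for X^(n)Y^(n), the other terms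
being covered by induction. Vandermonde's identity then reduces general c to this. -/
theorem Hbin_mem_Usub {r n : ℕ} (hn : n < p ^ r) (c : ℤ) : Hbin k c n ∈ Usub k p r := by
  induction n using Nat.strong_induction_on generalizing c with
  | _ n ih =>
  have h0 : Hbin k 0 n ∈ Usub k p r := by
    have h := Xd_mul_Yd k n n
    rw [min_self, Finset.sum_range_succ, Nat.sub_self, Xd_zero, Yd_zero, one_mul, mul_one,
      show 2 * (n : ℤ) - n - n = 0 by ring] at h
    rw [eq_sub_of_add_eq' h.symm]
    refine sub_mem (mul_mem (Xd_mem_Usub hn) (Yd_mem_Usub hn)) (sum_mem fun i hi => ?_)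
    rw [Finset.mem_range] at hi
    exact mul_mem (mul_mem (Yd_mem_Usub (by omega)) (ih i hi (by omega) _)) (Xd_mem_Usub (by omega))
  have e : Hbin k c n = ∑ ij ∈ Finset.HasAntidiagonal.antidiagonal n,
      intChoose k c ij.2 • Hbin k 0 ij.1 := by
    refine ext_evH k (Hbin_mem_Ucar k _ _) (sum_mem fun ij _ => Subalgebra.smul_mem _
      (Hbin_mem_Ucar k _ _) _) fun h => ?_
    rw [map_sum, evH_Hbin, intChoose, Ring.add_choose_eq n (Commute.all _ _), Int.cast_sum]
    refine Finset.sum_congr rfl fun ij _ => ?_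
    rw [map_smul, evH_Hbin, add_zero, Int.cast_mul, smul_eq_mul, mul_comm]
    rfl
  rw [e]
  refine sum_mem fun ij hij => Subalgebra.smul_mem _ ?_ _
  rw [Finset.HasAntidiagonal.mem_antidiagonal] at hij
  rcases Nat.eq_zero_or_pos ij.2 with h2 | h2
  · rw [show ij.1 = n by omega]; exact h0
  · exact ih _ (by omega) (by omega) 0

variable (k p) in
/-- The span of all `Y^(m) u X^(m')` with `m, m' < p ^ r` and `u` of period `p ^ r`. -/
def boxSpan (r : ℕ) : Submodule k (Hyper k) :=
  Submodule.span k {v | ∃ m < p ^ r, ∃ n < p ^ r, ∃ u ∈ Uper k p r, v = Yd k m * u * Xd k n}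

/-- A product leaving the box q + m < p^r involves a carry, so its binomial coefficient vanishes in
k. -/
theorem Yd_mul_boxSpan {r q : ℕ} (hq : q < p ^ r) {v : Hyper k} (hv : v ∈ boxSpan k p r) :
    Yd k q * v ∈ boxSpan k p r := by
  induction hv using Submodule.span_induction with
  | mem v hv =>
    obtain ⟨m, hm, n, hn, u, hu, rfl⟩ := hv
    rw [← mul_assoc, ← mul_assoc, Yd_mul_Yd, smul_mul_assoc, smul_mul_assoc]
    rcases lt_or_ge (q + m) (p ^ r) with h | h
    · exact Submodule.smul_mem _ _ (Submodule.subset_span ⟨_, h, n, hn, u, hu, rfl⟩)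
    · rw [choose_cast_eq_zero_of_carry k p hq hm h, zero_smul]; exact zero_mem _
  | zero => simp
  | add u v _ _ hu hv => rw [mul_add]; exact add_mem hu hv
  | smul c u _ hu => rw [mul_smul_comm]; exact Submodule.smul_mem _ c hu

theorem Xd_mul_boxSpan {r q : ℕ} (hq : q < p ^ r) {v : Hyper k} (hv : v ∈ boxSpan k p r) :
    Xd k q * v ∈ boxSpan k p r := by
  induction hv using Submodule.span_induction with
  | mem v hv =>
    obtain ⟨m, hm, n, hn, u, hu, rfl⟩ := hv
    rw [← mul_assoc, ← mul_assoc, Xd_mul_Yd, Finset.sum_mul, Finset.sum_mul]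
    refine sum_mem fun i hi => ?_
    rw [Finset.mem_range, Nat.lt_succ_iff, le_min_iff] at hi
    rw [mul_assoc _ (Xd k (q - i)), Xd_mul_Ucar hu.1, ← mul_assoc, mul_assoc _ (Xd k (q - i)),
      Xd_mul_Xd, mul_smul_comm, mul_assoc (Yd k (m - i))]
    rcases lt_or_ge (q - i + n) (p ^ r) with h | h
    · exact Submodule.smul_mem _ _ (Submodule.subset_span ⟨_, by omega, _, h, _,
        mul_mem (Hbin_mem_Uper (by omega) _) (shift_mem_Uper hu _), rfl⟩)
    · rw [choose_cast_eq_zero_of_carry k p (by omega) hn h, zero_smul]; exact zero_mem _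
  | zero => simp
  | add u v _ _ hu hv => rw [mul_add]; exact add_mem hu hv
  | smul c u _ hu => rw [mul_smul_comm]; exact Submodule.smul_mem _ c hu

theorem Usub_le_boxSpan {r : ℕ} {u : Hyper k} (hu : u ∈ Usub k p r) : u ∈ boxSpan k p r := by
  have hP := (Fact.out : p.Prime)
  have : ∀ v ∈ boxSpan k p r, u * v ∈ boxSpan k p r := by
    induction hu using Algebra.adjoin_induction with
    | mem u hu =>
      obtain ⟨i, hi, rfl | rfl⟩ := hu
      · exact fun v hv => Xd_mul_boxSpan (Nat.pow_lt_pow_right hP.one_lt hi) hv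
      · exact fun v hv => Yd_mul_boxSpan (Nat.pow_lt_pow_right hP.one_lt hi) hv
    | algebraMap c =>
      intro v hv
      rw [← Algebra.smul_def]
      exact Submodule.smul_mem _ c hv
    | add f g _ _ hf hg => intro v hv; rw [add_mul]; exact add_mem (hf v hv) (hg v hv)
    | mul f g _ _ hf hg => intro v hv; rw [mul_assoc]; exact hf _ (hg v hv)
  have h1 : (1 : Hyper k) ∈ boxSpan k p r :=
    Submodule.subset_span ⟨0, pow_pos hP.pos r, 0, pow_pos hP.pos r, 1, one_mem _, by
      rw [Yd_zero, Xd_zero, one_mul, one_mul]⟩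
  simpa using this 1 h1

end Usub

/-! ### Spanning `A_r`, and `Z` as a map from `A_r` to `A_(r+1)` -/

section Asub

variable (k) in
/-- The projection to the part of weight zero. -/
def wtProj : Hyper k →ₗ[k] Hyper k :=
  (basisHyper k).constr k fun t => if t.1 = t.2.2 then basisHyper k t else 0

theorem wtProj_Yd_mul_mul_Xd {u : Hyper k} (hu : u ∈ Ucar k) (m n : ℕ) :
    wtProj k (Yd k m * u * Xd k n) = if m = n then Yd k m * u * Xd k n else 0 := by
  rw [mem_Ucar] at hu
  induction hu using Submodule.span_induction with
  | mem u hu =>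
    obtain ⟨l, rfl⟩ := hu
    rw [← basisHyper_apply, wtProj, Module.Basis.constr_basis]
  | zero => simp
  | add u v _ _ hu hv =>
    simp only [map_add, add_mul, mul_add, hu, hv]
    split_ifs <;> simp
  | smul c u _ hu =>
    simp only [map_smul, smul_mul_assoc, mul_smul_comm, hu]
    split_ifs <;> simp

theorem wtProj_of_mem {w : Hyper k} (hw : w ∈ Wsub k) : wtProj k w = w := by
  rw [mem_Wsub] at hw
  induction hw using Submodule.span_induction with
  | mem w hw =>
    obtain ⟨u, hu, m, rfl⟩ := hw
    rw [Ucar_mul_Cm hu, wtProj_Yd_mul_mul_Xd (shift_mem hu _), if_pos rfl]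
  | zero => simp
  | add u v _ _ hu hv => rw [map_add, hu, hv]
  | smul c u _ hu => rw [map_smul, hu]

/-- The algebra `A_r` is spanned by the products of periodic Cartan elements and `Y^(m) X^(m)`. -/
theorem mem_span_of_mem_Asub {r : ℕ} {w : Hyper k} (hw : w ∈ Asub k p r) :
    w ∈ Submodule.span k {v | ∃ n < p ^ r, ∃ c : ℤ, ∃ m < p ^ r, v = Hbin k c n * Cm k m} := by
  have h1 : w ∈ Wsub k := by rw [← Aall_eq_Wsub (p := p)]; exact hw.1
  rw [← wtProj_of_mem h1]
  -- The projection to weight zero fixes w and keeps only the spanning elements of U_r with equal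
  -- exponents of Y and X.
  have h2 := Usub_le_boxSpan hw.2
  clear hw h1
  induction h2 using Submodule.span_induction with
  | mem v hv =>
    obtain ⟨m, hm, n, hn, u, hu, rfl⟩ := hv
    rw [wtProj_Yd_mul_mul_Xd hu.1]
    split_ifs with hmn
    · subst hmn
      have hu' := Uper_le_span hu
      clear hu
      induction hu' using Submodule.span_induction with
      | mem u hu' =>
        obtain ⟨l, hl, rfl⟩ := hu'
        rw [Yd_mul_mul_Xd (Hbin_mem_Ucar k _ _), shift_Hbin]
        exact Submodule.subset_span ⟨l, hl, _, m, hm, rfl⟩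
      | zero => simp
      | add u v _ _ hu hv => rw [mul_add, add_mul]; exact add_mem hu hv
      | smul c u _ hu => rw [mul_smul_comm, smul_mul_assoc]; exact Submodule.smul_mem _ c hu
    · exact zero_mem _
  | zero => simp
  | add u v _ _ hu hv => rw [map_add]; exact add_mem hu hv
  | smul c u _ hu => rw [map_smul]; exact Submodule.smul_mem _ c hu

theorem Asub_le_Wsub {r : ℕ} {w : Hyper k} (hw : w ∈ Asub k p r) : w ∈ Wsub k := by
  rw [← Aall_eq_Wsub (p := p)]; exact hw.1

theorem mem_Asub {r : ℕ} {w : Hyper k} (h1 : w ∈ Wsub k) (h2 : w ∈ Usub k p r) :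
    w ∈ Asub k p r :=
  ⟨by rw [Aall_eq_Wsub]; exact h1, h2⟩

theorem Hbin_mem_Asub {r n : ℕ} (hn : n < p ^ r) (c : ℤ) : Hbin k c n ∈ Asub k p r :=
  mem_Asub (Ucar_le_Wsub (Hbin_mem_Ucar k _ _)) (Hbin_mem_Usub hn c)

theorem Cm_mem_Asub {r m : ℕ} (hm : m < p ^ r) : Cm k m ∈ Asub k p r :=
  mem_Asub (Cm_mem m) (mul_mem (Yd_mem_Usub hm) (Xd_mem_Usub hm))

theorem frob_mem_Usub {r : ℕ} {z : Hyper k} (hz : z ∈ Asub k p r) :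
    frob k p z ∈ Usub k p (r + 1) := by
  have hp := (Fact.out : p.Prime).pos
  have hz' := mem_span_of_mem_Asub hz
  clear hz
  induction hz' using Submodule.span_induction with
  | mem z hz =>
    obtain ⟨n, hn, c, m, hm, rfl⟩ := hz
    rw [frob_Ucar_mul_Cm (Hbin_mem_Ucar k _ _), frob_Hbin]
    have hlt : ∀ {l : ℕ}, l < p ^ r → l * p < p ^ (r + 1) := fun h => by
      rw [pow_succ]; exact Nat.mul_lt_mul_of_pos_right h hp
    exact mul_mem (Hbin_mem_Usub (hlt hn) _)
      (mul_mem (Yd_mem_Usub (hlt hm)) (Xd_mem_Usub (hlt hm)))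
  | zero => rw [map_zero]; exact zero_mem _
  | add u v _ _ hu hv => rw [map_add]; exact add_mem hu hv
  | smul c u _ hu => rw [map_smul]; exact Subalgebra.smul_mem _ hu c

theorem Zmap_mem_Asub {r : ℕ} {z : Hyper k} (hz : z ∈ Asub k p r) (s a : ℕ) (g : (ZMod p)[X]) :
    Zmap s a g z ∈ Asub k p (r + 1) := by
  have hP := (Fact.out : p.Prime)
  have h1 : 1 < p ^ (r + 1) := Nat.one_lt_pow (Nat.succ_ne_zero r) hP.one_lt
  refine mem_Asub (Zmap_mem (Asub_le_Wsub hz) s a g) ?_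
  rw [Zmap_eq]
  have hC : Cm k 1 ∈ Usub k p (r + 1) := mul_mem (Yd_mem_Usub h1) (Xd_mem_Usub h1)
  have hg : evC g ∈ Usub k p (r + 1) := by
    induction g using Polynomial.induction_on' with
    | add f g hf hg => rw [map_add]; exact add_mem hf hg
    | monomial n c =>
      rw [← C_mul_X_pow_eq_monomial, evC_C_mul, map_pow, evC_X]
      exact Subalgebra.smul_mem _ (pow_mem hC n) _
  refine mul_mem (mul_mem (mul_mem (pow_mem (Yd_mem_Usub h1) s) (frob_mem_Usub hz))
    (pow_mem (Xd_mem_Usub h1) s)) (mul_mem hg (Hbin_mem_Usub ?_ _))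
  have : p ≤ p ^ (r + 1) := Nat.le_self_pow (Nat.succ_ne_zero r) p
  have := hP.pos
  omega

end Asub

end

section

/-! ### The polynomial `ψ` and its local factors -/

section SquareProducts

variable {p : ℕ} [Fact p.Prime]

/-- The product of the linear factors vanishing at the squares of the elements of `S`. -/
def sqProd (S : Finset (ZMod p)) : (ZMod p)[X] := ∏ r ∈ S, (X - C (r ^ 2))

theorem sqProd_dvd {S T : Finset (ZMod p)} (h : S ⊆ T) : sqProd S ∣ sqProd T :=
  Finset.prod_dvd_prod_of_subset _ _ _ h

theorem sqProd_ne_zero (S : Finset (ZMod p)) : sqProd S ≠ 0 :=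
  (monic_prod_of_monic _ _ fun _ _ => monic_X_sub_C _).ne_zero

theorem prod_X_sub_C_univ : ∏ r : ZMod p, (X - C r) = (X ^ p - X : (ZMod p)[X]) := by
  have hp := (Fact.out : p.Prime).one_lt
  have hm : (X ^ p - X : (ZMod p)[X]).Monic :=
    monic_X_pow_sub (by rw [degree_X]; exact_mod_cast hp)
  have hr : (X ^ p - X : (ZMod p)[X]).roots = (Finset.univ : Finset (ZMod p)).val := by
    have := FiniteField.roots_X_pow_card_sub_X (ZMod p)
    rwa [ZMod.card] at this
  have h := prod_multiset_X_sub_C_of_monic_of_roots_card_eq hm (by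
    rw [hr, Finset.card_val, Finset.card_univ, ZMod.card,
      FiniteField.X_pow_card_sub_X_natDegree_eq (ZMod p) hp])
  rw [hr] at h
  exact h

/-- After substituting x² for x, the left side becomes ∏(x - r)(x + r) = (x^p - x)². The
substitution is injective on polynomials. -/
theorem psi_eq (hp : p ≠ 2) : psi p = X * (X ^ ((p - 1) / 2) - 1) ^ 2 := by
  have hP := (Fact.out : p.Prime)
  obtain ⟨h, hh⟩ : ∃ h, p = 2 * h + 1 := hP.odd_of_ne_two hp
  apply expand_injective (R := ZMod p) two_pos
  have e1 : ∏ r : ZMod p, (X + C r) = (X ^ p - X : (ZMod p)[X]) := by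
    rw [← prod_X_sub_C_univ, ← Equiv.prod_comp (Equiv.neg (ZMod p))]
    exact Finset.prod_congr rfl fun r _ => by simp [sub_eq_add_neg]
  have e2 : expand (ZMod p) 2 (psi p) = (X ^ p - X) * (X ^ p - X) := by
    conv_rhs => rw [← prod_X_sub_C_univ]
    rw [prod_X_sub_C_univ]
    nth_rw 1 [← prod_X_sub_C_univ]
    rw [← e1, ← Finset.prod_mul_distrib, psi, map_prod]
    refine Finset.prod_congr rfl fun r _ => ?_
    rw [map_sub, expand_X, expand_C, C_pow]
    ring
  rw [e2]
  have e3 : (p - 1) / 2 = h := by omega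
  have e4 : (X : (ZMod p)[X]) ^ p = X * (X ^ h) ^ 2 := by
    rw [← pow_mul, mul_comm h 2, ← pow_succ', ← hh]
  simp only [e3, map_mul, map_pow, map_sub, map_one, expand_X, e4]
  ring

theorem sub_sq_dvd {K : Type*} [Field K] {P : K[X]} {c : K} (h0 : P.eval c = 0)
    (h1 : P.derivative.eval c = 0) : (X - C c) ^ 2 ∣ P := by
  obtain ⟨R, rfl⟩ := dvd_iff_isRoot.mpr h0
  have : R.eval c = 0 := by simpa using h1
  rw [pow_two]
  exact mul_dvd_mul_left _ (dvd_iff_isRoot.mpr this)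

/-- The idempotent identity modulo `(x - j²)²`. -/
theorem sub_sq_dvd_two_mul {c : ZMod p} (hc : c ≠ 0) {h : ℕ}
    (hh : 2 * h + 1 = p) (hch : c ^ h = 1) {Q : (ZMod p)[X]}
    (hQ : (X - C c) ^ 2 * Q = X * (X ^ h - 1) ^ 2) :
    (X - C c) ^ 2 ∣ 2 * (X + C c) * Q - 1 := by
  obtain ⟨G, hG⟩ : X - C c ∣ (X ^ h - 1 : (ZMod p)[X]) := by
    rw [dvd_iff_isRoot]; simp [hch]
  have hQG : Q = X * G ^ 2 := by
    have h0 : (X - C c) ^ 2 ≠ 0 := pow_ne_zero 2 (X_sub_C_ne_zero c)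
    refine mul_left_cancel₀ h0 ?_
    rw [hQ, hG]; ring
  have hh2 : 2 * (h : ZMod p) = -1 := by
    have : ((2 * h + 1 : ℕ) : ZMod p) = 0 := by rw [hh, CharP.cast_eq_zero]
    push_cast at this
    linear_combination this
  have hpos : 0 < h := by
    have := (Fact.out : p.Prime).two_le
    omega
  have hX : (X : (ZMod p)[X]) * X ^ (h - 1) = X ^ h := by
    rw [← pow_succ', Nat.sub_add_cancel hpos]
  -- The operator x·d/dx is applied twice to x^h - 1 = (x - c)G. Evaluation at c with 2h = -1 gives
  -- 2cG(c) = -1 and 8c²G'(c) = 3, which determine 2(x + c)xG² to first order at c.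
  have d0 := congrArg (X * derivative ·) hG
  simp only [derivative_sub, derivative_X_pow, derivative_one, sub_zero, derivative_mul,
    derivative_C, derivative_X, one_mul] at d0
  rw [mul_left_comm, hX] at d0
  have d1 := congrArg (X * derivative ·) d0
  simp only [derivative_add, derivative_sub, derivative_X_pow, sub_zero, derivative_mul,
    derivative_C, derivative_X, one_mul, zero_mul, zero_add, mul_add] at d1
  rw [mul_left_comm X (C _) (C _ * _), mul_left_comm X (C _) (X ^ _), hX] at d1
  have v0 := congrArg (eval c) d0
  have v1 := congrArg (eval c) d1
  simp only [eval_mul, eval_add, eval_sub, eval_X, eval_C, eval_pow, sub_self, zero_mul, mul_zero,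
    add_zero, hch, mul_one] at v0 v1
  have g0 : 2 * (c * G.eval c) = -1 := by rw [← v0, hh2]
  have g1 : 8 * (c ^ 2 * (derivative G).eval c) = 3 := by
    linear_combination (-4) * v1 + 4 * v0 + (2 * h - 3) * hh2
  refine sub_sq_dvd ?_ ?_
  · rw [hQG]
    simp only [eval_sub, eval_mul, eval_add, eval_X, eval_C, eval_pow, eval_ofNat, eval_one]
    linear_combination (2 * (c * G.eval c) - 1) * g0
  · rw [hQG]
    simp only [derivative_sub, derivative_mul, derivative_add, derivative_pow, derivative_X,
      derivative_C, derivative_one, derivative_ofNat, eval_sub, eval_mul, eval_add, eval_X, eval_C,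
      eval_pow, eval_ofNat, eval_one, eval_zero]
    refine mul_left_cancel₀ hc ?_
    simp only [Nat.cast_ofNat, Nat.add_one_sub_one, pow_one]
    linear_combination (c * G.eval c) * g1 + 3 * (c * G.eval c) * g0

/-- The product of the factors of `ψ` not vanishing at `J²`. -/
def coProd (J : ZMod p) : (ZMod p)[X] := sqProd (Finset.univ \ {J, -J})

theorem psi_eq_mul_coProd (J : ZMod p) : psi p = sqProd {J, -J} * coProd J := by
  rw [coProd, sqProd, sqProd, mul_comm, Finset.prod_sdiff (Finset.subset_univ _), psi]

theorem neg_ne_self_of_ne_zero (hp : p ≠ 2) {J : ZMod p} (hJ : J ≠ 0) : J ≠ -J := by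
  intro h
  have h2 : (2 : ZMod p) * J = 0 := by linear_combination h
  rcases mul_eq_zero.mp h2 with h3 | h3
  · have : p ∣ 2 := (ZMod.natCast_eq_zero_iff 2 p).mp (by exact_mod_cast h3)
    exact hp ((Nat.prime_dvd_prime_iff_eq Fact.out Nat.prime_two).mp this)
  · exact hJ h3

theorem sqProd_pair (hp : p ≠ 2) {J : ZMod p} (hJ : J ≠ 0) :
    sqProd {J, -J} = (X - C (J ^ 2)) ^ 2 := by
  rw [sqProd, Finset.prod_pair (neg_ne_self_of_ne_zero hp hJ), neg_sq, pow_two (X - _)]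

theorem sqProd_pair_zero : sqProd {(0 : ZMod p), -0} = X := by simp [sqProd]

theorem psiE_one_of_ne_zero (hp : p ≠ 2) {j : ℚ} (hJ : (j : ZMod p) ≠ 0) :
    psiE p 1 j = (X - C ((j : ZMod p) ^ 2)) * coProd (j : ZMod p) := by
  rw [psiE, if_pos rfl, psi_eq_mul_coProd (j : ZMod p), sqProd_pair hp hJ, pow_two (X - _),
    mul_assoc, mul_divByMonic_cancel_left _ (monic_X_sub_C _)]

theorem psiE_zero_of_ne_zero {j : ℚ} (hj : j ≠ 0) (hJ : (j : ZMod p) ≠ 0) :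
    psiE p 0 j = 2 * (X + C ((j : ZMod p) ^ 2)) * coProd (j : ZMod p) := by
  rw [psiE, if_neg (by decide), if_neg hj, coProd, sqProd]
  have e : (Finset.univ \ {(j : ZMod p), -(j : ZMod p)} : Finset (ZMod p)) =
      insert 0 (Finset.univ \ {(0 : ZMod p), (j : ZMod p), -(j : ZMod p)}) := by
    ext x
    by_cases hx : x = 0 <;> simp [hx, hJ.symm, eq_comm]
  rw [e, Finset.prod_insert (by simp)]
  simp only [ne_eq, OfNat.ofNat_ne_zero, not_false_eq_true, zero_pow, map_zero, sub_zero]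
  ring

theorem psiE_zero_right (ε : Fin 2) : psiE p ε 0 = coProd 0 := by
  have h0 : sqProd (Finset.univ \ {(0 : ZMod p), -0}) = ∏ i ∈ Finset.univ \ {(0 : ZMod p)},
      (X - C (i ^ 2)) := by simp [sqProd]
  rw [psiE, Rat.cast_zero, coProd, h0]
  split_ifs with h1
  · rw [psi_eq_mul_coProd 0, sqProd_pair_zero, coProd, h0]
    have : (X - C ((0 : ZMod p) ^ 2)) = X := by simp
    rw [this, X_mul]
    have := mul_divByMonic_cancel_left (∏ i ∈ Finset.univ \ {(0 : ZMod p)}, (X - C (i ^ 2)))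
      (monic_X_sub_C (0 : ZMod p))
    rwa [map_zero, sub_zero, X_mul] at this
  · rfl
  · contradiction

theorem two_ne_zero_poly (hp : p ≠ 2) : (2 : (ZMod p)[X]) ≠ 0 := by
  have h2 : (2 : ZMod p) ≠ 0 := by
    intro h
    have : p ∣ 2 := (ZMod.natCast_eq_zero_iff 2 p).mp (by exact_mod_cast h)
    exact hp ((Nat.prime_dvd_prime_iff_eq Fact.out Nat.prime_two).mp this)
  rw [← map_ofNat (C : ZMod p →+* (ZMod p)[X])]
  exact C_ne_zero.mpr h2

theorem coProd_dvd_psiE (hp : p ≠ 2) {j : ℚ} (hj : j ≠ 0 → (j : ZMod p) ≠ 0) (ε : Fin 2) :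
    coProd (j : ZMod p) ∣ psiE p ε j := by
  rcases eq_or_ne j 0 with rfl | h
  · rw [psiE_zero_right, Rat.cast_zero]
  · fin_cases ε
    · exact Dvd.intro_left _ (psiE_zero_of_ne_zero h (hj h)).symm
    · exact Dvd.intro_left _ (psiE_one_of_ne_zero hp (hj h)).symm

theorem psiE_ne_zero (hp : p ≠ 2) {j : ℚ} (hj : j ≠ 0 → (j : ZMod p) ≠ 0) (ε : Fin 2) :
    psiE p ε j ≠ 0 := by
  rcases eq_or_ne j 0 with rfl | h
  · rw [psiE_zero_right]
    exact sqProd_ne_zero _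
  · fin_cases ε
    · refine (psiE_zero_of_ne_zero h (hj h)).trans_ne ?_
      exact mul_ne_zero (mul_ne_zero (two_ne_zero_poly hp) (X_add_C_ne_zero _)) (sqProd_ne_zero _)
    · refine (psiE_one_of_ne_zero hp (hj h)).trans_ne ?_
      exact mul_ne_zero (X_sub_C_ne_zero _) (sqProd_ne_zero _)

/-- ψ is the local factor at j² times `coProd`. The second divides ψ_j^(ε); the first divides
ψ_j^(0) - 1, by `sub_sq_dvd_two_mul` if j ≠ 0 and by the constant term (-1)² = 1 if j = 0. -/
theorem psi_dvd_psiE_mul (hp : p ≠ 2) {j : ℚ} (hj : j ≠ 0 → (j : ZMod p) ≠ 0) (ε : Fin 2) :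
    psi p ∣ psiE p 0 j * psiE p ε j - psiE p ε j := by
  have hP := (Fact.out : p.Prime)
  obtain ⟨h, hh⟩ : ∃ h, p = 2 * h + 1 := hP.odd_of_ne_two hp
  have e : (p - 1) / 2 = h := by omega
  have hpsi := psi_eq hp
  rw [e] at hpsi
  rw [← sub_one_mul, psi_eq_mul_coProd (j : ZMod p)]
  refine mul_dvd_mul ?_ (coProd_dvd_psiE hp hj ε)
  rcases eq_or_ne j 0 with rfl | h0
  · have h1 := psi_eq_mul_coProd (0 : ZMod p)
    rw [hpsi, sqProd_pair_zero] at h1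
    rw [psiE_zero_right, Rat.cast_zero, sqProd_pair_zero, ← mul_left_cancel₀ X_ne_zero h1,
      X_dvd_iff, coeff_zero_eq_eval_zero]
    have : h ≠ 0 := by
      have := hP.two_le
      omega
    simp [this]
  · have hJ := hj h0
    have h1 := psi_eq_mul_coProd (j : ZMod p)
    rw [hpsi, sqProd_pair hp hJ] at h1
    rw [psiE_zero_of_ne_zero h0 hJ, sqProd_pair hp hJ]
    refine sub_sq_dvd_two_mul (pow_ne_zero 2 hJ) hh.symm ?_ h1.symm
    rw [← pow_mul, show 2 * h = p - 1 by omega]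
    exact ZMod.pow_card_sub_one_eq_one hJ

theorem psi_dvd_psiE_one_sq (hp : p ≠ 2) {j : ℚ} (hJ : (j : ZMod p) ≠ 0) :
    psi p ∣ psiE p 1 j * psiE p 1 j := by
  rw [psiE_one_of_ne_zero hp hJ, psi_eq_mul_coProd (j : ZMod p), sqProd_pair hp hJ]
  exact ⟨coProd (j : ZMod p), by ring⟩

/-- On the dual-number factor x acts as j² plus a nilpotent: for j ≠ 0 one has xψ_j^(0) - j²ψ_j^(0)
- 4j²ψ_j^(1) = 2ψ exactly. -/
theorem exists_psi_dvd (hp : p ≠ 2) {j : ℚ} (hj : j ≠ 0 → (j : ZMod p) ≠ 0) :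
    ∃ α β : ZMod p, psi p ∣ X * psiE p 0 j - C α * psiE p 0 j - C β * psiE p 1 j := by
  rw [psi_eq_mul_coProd (j : ZMod p)]
  rcases eq_or_ne j 0 with rfl | h0
  · refine ⟨0, 0, ?_⟩
    rw [psiE_zero_right, Rat.cast_zero, sqProd_pair_zero]
    simp
  · have hJ := hj h0
    refine ⟨(j : ZMod p) ^ 2, 4 * (j : ZMod p) ^ 2, ?_⟩
    rw [psiE_zero_of_ne_zero h0 hJ, psiE_one_of_ne_zero hp hJ, sqProd_pair hp hJ]
    refine ⟨2, ?_⟩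
    simp only [map_mul, map_ofNat]
    ring

/-- The first `m` terms of the sequence `(a + 1) / 2, (a + 1) / 2 + 1, …` modulo `p`. -/
def halfRange (p a m : ℕ) [Fact p.Prime] : Finset (ZMod p) :=
  (Finset.range m).image fun i : ℕ => (i : ZMod p) + ((a : ZMod p) + 1) / 2

theorem mem_halfRange {a m : ℕ} {r : ZMod p} :
    r ∈ halfRange p a m ↔ ∃ i < m, (i : ZMod p) + ((a : ZMod p) + 1) / 2 = r := by
  simp [halfRange]

/-- Completing the square: i(i + a + 1) + ((a + 1)/2)² = (i + (a + 1)/2)². The bound on m keeps the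
terms of `halfRange` distinct. -/
theorem phi_eq_comp (hp : p ≠ 2) (a : ℕ) {m : ℕ} (hm : m ≤ p) :
    phi p a m = (sqProd (halfRange p a m)).comp (X + C ((((a : ZMod p) + 1) / 2) ^ 2)) := by
  have h2 : (2 : ZMod p) ≠ 0 := by
    intro h
    exact two_ne_zero_poly hp (by rw [← map_ofNat (C : ZMod p →+* (ZMod p)[X]), h, map_zero])
  rw [sqProd, halfRange, Finset.prod_image, phi, prod_comp]
  · refine Finset.prod_congr rfl fun i _ => ?_
    rw [sub_comp, X_comp, C_comp, add_sub_assoc, ← C_sub, sub_eq_add_neg X, ← C_neg]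
    congr 2
    push_cast
    field_simp
    ring
  · intro i hi l hl h
    have h := add_right_cancel h
    rw [ZMod.natCast_eq_natCast_iff'] at h
    rw [Finset.coe_range, Set.mem_Iio] at hi hl
    rwa [Nat.mod_eq_of_lt (by omega), Nat.mod_eq_of_lt (by omega)] at h

theorem halfRange_self (a : ℕ) : halfRange p a p = Finset.univ := by
  ext r
  simp only [mem_halfRange, Finset.mem_univ, iff_true]
  exact ⟨(r - ((a : ZMod p) + 1) / 2).val, ZMod.val_lt _, by
    rw [ZMod.natCast_zmod_val, sub_add_cancel]⟩

theorem phi_self_eq_comp (hp : p ≠ 2) (a : ℕ) :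
    phi p a p = (psi p).comp (X + C ((((a : ZMod p) + 1) / 2) ^ 2)) := by
  rw [phi_eq_comp hp a le_rfl, halfRange_self]
  rfl

theorem add_half_eq_iff (hp : p ≠ 2) (a i j : ℕ) :
    (i : ZMod p) + ((a : ZMod p) + 1) / 2 = j ↔ 2 * i + a + 1 ≡ 2 * j [MOD p] := by
  have h2 : (2 : ZMod p) ≠ 0 := by
    intro h
    exact two_ne_zero_poly hp (by rw [← map_ofNat (C : ZMod p →+* (ZMod p)[X]), h, map_zero])
  rw [← ZMod.natCast_eq_natCast_iff]
  push_cast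
  constructor
  · intro h; rw [← h]; field_simp; ring
  · intro h
    refine mul_left_cancel₀ h2 ?_
    rw [← h]; field_simp; ring

theorem add_half_eq_neg_iff (hp : p ≠ 2) (a i j : ℕ) :
    (i : ZMod p) + ((a : ZMod p) + 1) / 2 = -j ↔ p ∣ 2 * i + a + 1 + 2 * j := by
  have h2 : (2 : ZMod p) ≠ 0 := by
    intro h
    exact two_ne_zero_poly hp (by rw [← map_ofNat (C : ZMod p →+* (ZMod p)[X]), h, map_zero])
  rw [← ZMod.natCast_eq_zero_iff]
  push_cast
  have e : 2 * (i : ZMod p) + a + 1 + 2 * j = 2 * (i + ((a : ZMod p) + 1) / 2 + j) := by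
    field_simp
    ring
  rw [e, mul_eq_zero, eq_neg_iff_add_eq_zero, or_iff_right h2]

end SquareProducts

/-- The pairs for which the two elements `B^(0)` and `B^(1)` coincide. -/
def IsSplit (p a : ℕ) (j : ℚ) : Prop := if p = 2 then a = 1 else j = 0

/-- The divisibility relations between the polynomials attached to a pair `(a, j)`. -/
structure PairFacts (p a : ℕ) [Fact p.Prime] (j : ℚ) : Prop where
  sEff_lt : sEff p a j < p
  phi_dvd : ∀ ε, phi p a (sEff p a j) ∣ bPoly p ε a j
  compat : (sEff p a j = 0 ∧ a < p ∧ ∀ ε, phi p a p ∣ phi p a (p - a) * bPoly p ε a j) ∨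
    (1 ≤ sEff p a j ∧ (a + 2 * sEff p a j) % p ≤ 1)
  zero_mul : ∀ ε, phi p a p ∣ bPoly p 0 a j * bPoly p ε a j - bPoly p ε a j
  one_mul_one : ¬ IsSplit p a j → phi p a p ∣ bPoly p 1 a j * bPoly p 1 a j
  X_mul : ∃ α β : ZMod p, phi p a p ∣
    X * bPoly p 0 a j - C α * bPoly p 0 a j - C β * bPoly p 1 a j
  one_eq_zero : IsSplit p a j → bPoly p 1 a j = bPoly p 0 a j
  ne_zero : ∀ ε, bPoly p ε a j ≠ 0

/-- Here φ_{0,2} = x² and φ_{1,2} = x(x + 1): the weight 0 yields dual numbers, the weight 1 two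
copies of the field with idempotents x and x + 1. -/
theorem pairFacts_two {a : ℕ} {j : ℚ} (haj : (a, j) ∈ Pairs 2) : PairFacts 2 a j := by
  have h0 : phi 2 (0 : ℕ) 2 = X * X := by
    simp [phi, Finset.prod_range_succ, CharTwo.add_self_eq_zero]
  have h1 : phi 2 (1 : ℕ) 2 = X * (X + 1) := by
    simp [phi, Finset.prod_range_succ, CharTwo.add_self_eq_zero,
      CharTwo.sub_eq_add]
  have h11 : phi 2 (1 : ℕ) 1 = X := by simp [phi]
  have hz : ∀ a : ℕ, phi 2 a 0 = 1 := by simp [phi]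
  rw [Pairs, if_pos rfl] at haj
  simp only [Set.mem_insert_iff, Set.mem_singleton_iff, Prod.mk.injEq] at haj
  rcases haj with ⟨rfl, rfl⟩ | ⟨rfl, rfl⟩ | ⟨rfl, rfl⟩
  · have hs : sEff 2 0 (1 / 2) = 0 := by
      rw [sEff, if_neg]
      rintro (⟨-, h, -⟩ | ⟨h, -, -⟩)
      · norm_num at h
      · simp at h
    have hb : ∀ ε, bPoly 2 ε 0 (1 / 2) = if ε = 0 then 1 else X := fun ε => by
      rw [bPoly, if_pos rfl, if_pos rfl]
    refine ⟨by rw [hs]; norm_num, fun ε => by rw [hs, hz]; exact one_dvd _,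
      Or.inl ⟨hs, by norm_num, fun ε => dvd_mul_right _ _⟩, fun ε => ?_,
      fun _ => ?_, ⟨0, 1, ?_⟩, fun h => ?_, fun ε => ?_⟩
    · rw [hb, if_pos rfl, one_mul, sub_self]
      exact dvd_zero _
    · rw [hb, if_neg one_ne_zero, h0]
    · rw [hb, hb, if_pos rfl, if_neg one_ne_zero, map_zero, map_one, zero_mul, one_mul, mul_one,
        sub_zero, sub_self]
      exact dvd_zero _
    · simp [IsSplit] at h
    · rw [hb]; split_ifs <;> simp
  · have hs : sEff 2 1 0 = 1 := by
      rw [sEff, if_pos, sNum, if_pos rfl]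
      refine Or.inr ⟨by decide, le_rfl, by norm_num⟩
    have hb : ∀ ε, bPoly 2 ε 1 0 = X := fun ε => by
      rw [bPoly, if_pos rfl, if_neg one_ne_zero, if_pos rfl]
    refine ⟨by rw [hs]; norm_num, fun ε => by rw [hs, hb, h11],
      Or.inr ⟨by rw [hs], by rw [hs]⟩, fun ε => ?_, fun h => ?_, ⟨1, 0, ?_⟩,
      fun h => by rw [hb, hb], fun ε => by rw [hb]; exact X_ne_zero⟩
    · rw [hb, hb, h1, ← mul_sub_one, CharTwo.sub_eq_add]
    · simp [IsSplit] at h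
    · rw [hb, hb, h1, map_zero, zero_mul, sub_zero, map_one, one_mul, ← mul_sub_one,
        CharTwo.sub_eq_add]
  · have hs : sEff 2 1 1 = 0 := by
      rw [sEff, if_neg]
      rintro (⟨h, -, -⟩ | ⟨-, -, h⟩)
      · simp at h
      · norm_num at h
    have hb : ∀ ε, bPoly 2 ε 1 1 = X + 1 := fun ε => by
      rw [bPoly, if_pos rfl, if_neg one_ne_zero, if_neg one_ne_zero]
    refine ⟨by rw [hs]; norm_num, fun ε => by rw [hs, hz]; exact one_dvd _,
      Or.inl ⟨hs, by norm_num, fun ε => by rw [hb, h1, h11]⟩, fun ε => ?_, fun h => ?_, ⟨0, 0, ?_⟩,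
      fun h => by rw [hb, hb], fun ε => by rw [hb]; exact X_add_C_ne_zero 1⟩
    · rw [hb, hb, h1, ← mul_sub_one, add_sub_cancel_right, mul_comm]
    · simp [IsSplit] at h
    · rw [hb, hb, h1, map_zero, zero_mul, sub_zero, sub_zero]

/-- After translation by ((a + 1)/2)² the algebraic relations are those for ψ. What depends on a is
where ±j occur in the sequence (a + 1)/2, (a + 1)/2 + 1, …: under (A) or (C) not among the first s
terms, otherwise both among the first p - a. -/
theorem pairFacts_of_odd {p : ℕ} [Fact p.Prime] (hp : p ≠ 2) {a : ℕ} {j : ℚ}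
    (haj : (a, j) ∈ Pairs p) : PairFacts p a j := by
  have hP := (Fact.out : p.Prime)
  have hodd : p % 2 = 1 := Nat.odd_iff.mp (hP.odd_of_ne_two hp)
  have hp2 := hP.two_le
  rw [Pairs, if_neg hp] at haj
  obtain ⟨ha, t, ht, rfl⟩ : a < p ∧ ∃ t : ℕ, t ≤ (p - 1) / 2 ∧ j = t := haj
  have hj : (t : ℚ) ≠ 0 → (((t : ℚ) : ℚ) : ZMod p) ≠ 0 := by
    intro h0 h
    rw [Rat.cast_natCast, ZMod.natCast_eq_zero_iff] at h
    have h0' : t ≠ 0 := by simpa using h0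
    have := Nat.le_of_dvd (by omega) h
    omega
  have hb : ∀ ε, bPoly p ε a t =
      (psiE p ε t).comp (X + C ((((a : ZMod p) + 1) / 2) ^ 2)) := fun ε => by
    rw [bPoly, if_neg hp]
  have hcomp : ∀ {f g : (ZMod p)[X]}, f ∣ g →
      f.comp (X + C ((((a : ZMod p) + 1) / 2) ^ 2)) ∣
        g.comp (X + C ((((a : ZMod p) + 1) / 2) ^ 2)) := by
    rintro f _ ⟨g, rfl⟩
    rw [mul_comp]
    exact dvd_mul_right _ _
  have hcA : condA p a t ↔ a % 2 = 0 ∧ p + 1 ≤ 2 * t + a := by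
    rw [condA, Nat.even_iff]
    refine and_congr_right fun h => ⟨fun h1 => ?_, fun h1 => ⟨?_, ?_⟩⟩
    · have := h1.1
      rw [div_le_iff₀ two_pos] at this
      have : ((p + 1 : ℕ) : ℚ) ≤ (2 * t + a : ℕ) := by push_cast; linarith
      exact_mod_cast this
    · have : ((p + 1 : ℕ) : ℚ) ≤ (2 * t + a : ℕ) := by exact_mod_cast h1
      push_cast at this
      linarith
    · have : ((2 * t + 1 : ℕ) : ℚ) ≤ (p : ℕ) := by exact_mod_cast (by omega : 2 * t + 1 ≤ p)
      push_cast at this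
      linarith
  have hcC : condC a t ↔ a % 2 = 1 ∧ 2 * t + 1 ≤ a := by
    rw [condC, Nat.odd_iff]
    refine and_congr_right fun h => ⟨fun h1 => ?_, fun h1 => ⟨by positivity, ?_⟩⟩
    · have := h1.2
      have : ((2 * t + 1 : ℕ) : ℚ) ≤ a := by push_cast; linarith
      exact_mod_cast this
    · have : ((2 * t + 1 : ℕ) : ℚ) ≤ a := by exact_mod_cast h1
      push_cast at this
      linarith
  have hzero : ∀ ε, phi p a p ∣ bPoly p 0 a t * bPoly p ε a t - bPoly p ε a t := fun ε => by
    rw [hb, hb, phi_self_eq_comp hp, ← mul_comp, ← sub_comp]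
    exact hcomp (psi_dvd_psiE_mul hp hj ε)
  have hone : ¬ IsSplit p a t → phi p a p ∣ bPoly p 1 a t * bPoly p 1 a t := fun h => by
    rw [IsSplit, if_neg hp] at h
    rw [hb, phi_self_eq_comp hp, ← mul_comp]
    exact hcomp (psi_dvd_psiE_one_sq hp (hj h))
  have hX : ∃ α β : ZMod p, phi p a p ∣
      X * bPoly p 0 a t - C α * bPoly p 0 a t - C β * bPoly p 1 a t := by
    obtain ⟨α, β, h⟩ := exists_psi_dvd (p := p) hp hj
    refine ⟨α - (((a : ZMod p) + 1) / 2) ^ 2, β, ?_⟩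
    rw [hb, hb, phi_self_eq_comp hp]
    convert hcomp h using 1
    simp only [sub_comp, mul_comp, X_comp, C_comp, C_sub]
    ring
  have heq : IsSplit p a t → bPoly p 1 a t = bPoly p 0 a t := fun h => by
    rw [IsSplit, if_neg hp] at h
    rw [hb, hb, h, psiE_zero_right, psiE_zero_right]
  have hne : ∀ ε, bPoly p ε a t ≠ 0 := fun ε => by
    rw [hb]
    intro h
    rw [comp_eq_zero_iff] at h
    rcases h with h | ⟨-, h⟩
    · exact psiE_ne_zero hp hj ε h
    · exact absurd (congrArg natDegree h) (by rw [natDegree_X_add_C, natDegree_C]; exact one_ne_zero)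
  by_cases hT : condA p a t ∨ condC a t
  · have hs : sEff p a t = if Even a then (p - a + 1) / 2 else (p - a) / 2 := by
      rw [sEff, if_pos hT, sNum, if_neg hp]
    rw [hcA, hcC] at hT
    -- The choice of s makes a + 2s equal to p + 1 or p, so that X^s moves the weight a to the
    -- residue 1 or 0.
    have hs' : (a % 2 = 0 ∧ p + 1 ≤ 2 * t + a ∧ a + 2 * sEff p a t = p + 1) ∨
        (a % 2 = 1 ∧ 2 * t + 1 ≤ a ∧ a + 2 * sEff p a t = p) := by
      rcases hT with ⟨h1, h2⟩ | ⟨h1, h2⟩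
      · rw [if_pos (Nat.even_iff.mpr h1)] at hs
        omega
      · rw [if_neg (by rw [Nat.even_iff]; omega)] at hs
        omega
    refine ⟨by omega, fun ε => ?_, Or.inr ⟨by omega, ?_⟩, hzero, hone, hX, heq, hne⟩
    · rw [phi_eq_comp hp a (by omega), hb]
      refine hcomp ((sqProd_dvd ?_).trans (coProd_dvd_psiE hp hj ε))
      -- For i < s one has 2i + a + 1 ≤ p, so parity and size exclude both 2i + a + 1 ≡ 2j and 2i +
      -- a + 1 ≡ -2j modulo p.
      intro r hr
      obtain ⟨i, hi, rfl⟩ := mem_halfRange.mp hr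
      simp only [Finset.mem_sdiff, Finset.mem_univ, true_and, Finset.mem_insert,
        Finset.mem_singleton, not_or, Rat.cast_natCast]
      rw [add_half_eq_iff hp, add_half_eq_neg_iff hp]
      constructor
      · intro h
        rcases Nat.lt_or_ge (2 * i + a + 1) p with h3 | h3
        · rw [Nat.ModEq, Nat.mod_eq_of_lt h3, Nat.mod_eq_of_lt (by omega)] at h
          omega
        · have : 2 * i + a + 1 = p := by omega
          rw [this, Nat.ModEq, Nat.mod_self, Nat.mod_eq_of_lt (by omega)] at h
          omega
      · rintro ⟨c, hc⟩
        have : c < 2 := by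
          by_contra hcon
          have := Nat.mul_le_mul_left p (not_lt.mp hcon)
          omega
        interval_cases c <;> omega
    · rcases hs' with ⟨-, -, h⟩ | ⟨-, -, h⟩
      · rw [h, Nat.add_mod_left]
        exact Nat.mod_le 1 p
      · rw [h, Nat.mod_self]
        exact zero_le_one
  · have hs : sEff p a t = 0 := by rw [sEff, if_neg hT]
    rw [hcA, hcC] at hT
    refine ⟨by omega, fun ε => ?_, Or.inl ⟨hs, ha, fun ε => ?_⟩, hzero, hone, hX, heq, hne⟩
    · rw [hs]; simp [phi]
    · rw [hb, phi_self_eq_comp hp, phi_eq_comp hp a (Nat.sub_le p a), ← mul_comp,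
        psi_eq_mul_coProd ((t : ℚ) : ZMod p)]
      refine hcomp (mul_dvd_mul (sqProd_dvd ?_) (coProd_dvd_psiE hp hj ε))
      -- The positions i of j and l of -j satisfy i + l + a + 1 ≡ 0 modulo p; since the
      -- representatives can be chosen with equality to p, both lie below p - a.
      obtain ⟨i, l, hil, h1, h2⟩ : ∃ i l : ℕ, i + l + a + 1 = p ∧
          2 * i + a + 1 ≡ 2 * t [MOD p] ∧ p ∣ 2 * l + a + 1 + 2 * t := by
        rcases Nat.mod_two_eq_zero_or_one a with h | h
        · refine ⟨(p + 2 * t - a - 1) / 2, (p - 2 * t - a - 1) / 2, by omega, ?_, ?_⟩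
          · rw [show 2 * ((p + 2 * t - a - 1) / 2) + a + 1 = p + 2 * t by omega]
            exact Nat.add_mod_left _ _
          · rw [show 2 * ((p - 2 * t - a - 1) / 2) + a + 1 + 2 * t = p by omega]
        · refine ⟨(2 * t - a - 1) / 2, p - 1 - a - (2 * t - a - 1) / 2, by omega, ?_, ?_⟩
          · rw [show 2 * ((2 * t - a - 1) / 2) + a + 1 = 2 * t by omega]
          · rw [show 2 * (p - 1 - a - (2 * t - a - 1) / 2) + a + 1 + 2 * t = 2 * p by omega]
            exact dvd_mul_left _ _
      intro r hr
      rw [Finset.mem_insert, Finset.mem_singleton, Rat.cast_natCast] at hr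
      rcases hr with rfl | rfl
      · exact mem_halfRange.mpr ⟨i, by omega, (add_half_eq_iff hp a i t).mpr h1⟩
      · exact mem_halfRange.mpr ⟨l, by omega, (add_half_eq_neg_iff hp a l t).mpr h2⟩

theorem pairFacts {p : ℕ} [Fact p.Prime] {a : ℕ} {j : ℚ} (haj : (a, j) ∈ Pairs p) :
    PairFacts p a j := by
  by_cases hp : p = 2
  · subst hp
    exact pairFacts_two haj
  · exact pairFacts_of_odd hp haj

end

section

/-! ### Multiplication rules for one pair and the reduction from `A_(r+1)` to `A_r` -/

section Single

variable {k : Type*} [Field k] {p : ℕ} [Fact p.Prime] [CharP k p] {a : ℕ} {j : ℚ}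

variable (k p) in
/-- The map `z ↦ Z^(ε)(z; (a, j))`, written as a linear map. -/
def Zlin (ε : Fin 2) (a : ℕ) (j : ℚ) : Hyper k →ₗ[k] Hyper k where
  toFun := Zmap (sEff p a j) a (gPoly p (sEff p a j) ε a j)
  map_add' := Zmap_add _ _ _
  map_smul' := Zmap_smul _ _ _

theorem Zlin_apply (ε : Fin 2) (z : Hyper k) :
    Zlin k p ε a j z = Zmap (sEff p a j) a (gPoly p (sEff p a j) ε a j) z := rfl

variable (haj : (a, j) ∈ Pairs p)
include haj

theorem sEff_le_nNum (ε : Fin 2) : sEff p a j ≤ nNum p ε a j := by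
  classical
  have h := pairFacts haj
  have := h.sEff_lt
  exact Nat.le_findGreatest (by omega) (h.phi_dvd ε)

theorem Zel_eq_Zlin (ε : Fin 2) {z : Hyper k} (hz : z ∈ Wsub k) :
    Zel k p ε a j z = Zlin k p ε a j z :=
  Zel_eq_Zmap haj (sEff_le_nNum haj ε) hz

theorem bOne_eq_Zlin (ε : Fin 2) : bOne k p ε a j = Zlin k p ε a j 1 := by
  rw [bOne_eq_Zel haj (sEff_le_nNum haj ε), Zel_eq_Zlin haj ε (one_mem _)]

theorem phiIco_dvd {f : (ZMod p)[X]} (h : phi p a p ∣ phi p a (sEff p a j) * f) :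
    phiIco p a (sEff p a j) p ∣ f := by
  rw [← phi_mul_phiIco a (pairFacts haj).sEff_lt.le] at h
  exact (mul_dvd_mul_iff_left (phi_ne_zero a _)).mp h

/-- The two alternatives of `PairFacts.compat` correspond to the two cases in the definition of Z: s
= 0 with b = a, or s ≥ 1 with b the residue of a + 2s. -/
theorem exists_frobCompat (ε : Fin 2) :
    ∃ b, FrobCompat p b (Pel k p (sEff p a j) a (gPoly p (sEff p a j) ε a j)) := by
  have hg := phi_mul_gPoly haj (sEff_le_nNum haj ε)
  rcases (pairFacts haj).compat with ⟨hs, ha, h⟩ | ⟨hs, h⟩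
  · refine ⟨a, ?_⟩
    rw [hs] at hg ⊢
    refine frobCompat_of_dvd ha ?_
    have : phi p a 0 = 1 := by simp [phi]
    rw [this, one_mul] at hg
    rw [hg]
    exact h ε
  · exact ⟨_, frobCompat_of_le_one hs h _⟩

/-- By `Zmap_mul` the polynomials multiply, and modulo φ_{a,p} the polynomial for ε = 0 acts as
identity on the one for ε. Compatibility is needed only for the product, whose right factor is again
that of Z^(ε). -/
theorem Zlin_zero_mul (ε : Fin 2) {z w : Hyper k} (hz : z ∈ Wsub k) (hw : w ∈ Wsub k) :
    Zlin k p 0 a j z * Zlin k p ε a j w = Zlin k p ε a j (z * w) := by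
  obtain ⟨b, hb⟩ := exists_frobCompat (k := k) haj ε
  have hP : Pel k p (sEff p a j) a (phi p a (sEff p a j) * gPoly p (sEff p a j) 0 a j *
      gPoly p (sEff p a j) ε a j) = Pel k p (sEff p a j) a (gPoly p (sEff p a j) ε a j) := by
    refine Pel_congr (pairFacts haj).sEff_lt.le (phiIco_dvd haj ?_)
    have h := (pairFacts haj).zero_mul ε
    rw [← phi_mul_gPoly haj (sEff_le_nNum haj ε), ← phi_mul_gPoly haj (sEff_le_nNum haj 0)] at h
    convert h using 1
    ring
  rw [← hP] at hb
  rw [Zlin_apply, Zlin_apply, Zlin_apply, Zmap_mul hz hw hb, Zmap, hP, Zmap]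

omit haj in
theorem Zlin_mem_Wsub (ε : Fin 2) {z : Hyper k} (hz : z ∈ Wsub k) : Zlin k p ε a j z ∈ Wsub k :=
  Zmap_mem hz _ _ _

theorem Zlin_mul_zero (ε : Fin 2) {z w : Hyper k} (hz : z ∈ Wsub k) (hw : w ∈ Wsub k) :
    Zlin k p ε a j z * Zlin k p 0 a j w = Zlin k p ε a j (z * w) := by
  rw [(Wsub_comm (Zlin_mem_Wsub ε hz) (Zlin_mem_Wsub 0 hw)).eq, (Wsub_comm hz hw).eq,
    Zlin_zero_mul haj ε hw hz]

theorem Zlin_one_mul_one (hs : ¬ IsSplit p a j) {z w : Hyper k} (hz : z ∈ Wsub k)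
    (hw : w ∈ Wsub k) : Zlin k p 1 a j z * Zlin k p 1 a j w = 0 := by
  have hP : Pel k p (sEff p a j) a (phi p a (sEff p a j) * gPoly p (sEff p a j) 1 a j *
      gPoly p (sEff p a j) 1 a j) = 0 := by
    refine Pel_eq_zero (pairFacts haj).sEff_lt.le (phiIco_dvd haj ?_)
    have h := (pairFacts haj).one_mul_one hs
    rw [← phi_mul_gPoly haj (sEff_le_nNum haj 1)] at h
    convert h using 1
    ring
  have hb : FrobCompat p 0 (Pel k p (sEff p a j) a (phi p a (sEff p a j) *
      gPoly p (sEff p a j) 1 a j * gPoly p (sEff p a j) 1 a j)) := by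
    rw [hP]
    exact frobCompat_zero (Fact.out : p.Prime).pos
  rw [Zlin_apply, Zlin_apply, Zmap_mul hz hw hb, Zmap, hP, mul_zero]

theorem Zlin_one_eq_zero (hs : IsSplit p a j) : Zlin k p 1 a j = Zlin k p 0 a j := by
  have h := (pairFacts haj).one_eq_zero hs
  rw [← phi_mul_gPoly haj (sEff_le_nNum haj 1), ← phi_mul_gPoly haj (sEff_le_nNum haj 0)] at h
  ext z
  rw [Zlin_apply, Zlin_apply, mul_left_cancel₀ (phi_ne_zero a _) h]

theorem exists_Cm_one_mul_Zlin : ∃ α β : k,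
    Cm k 1 * Zlin k p 0 a j 1 = α • Zlin k p 0 a j 1 + β • Zlin k p 1 a j 1 := by
  obtain ⟨α, β, h⟩ := (pairFacts haj).X_mul
  refine ⟨ZMod.castHom (dvd_refl p) k α, ZMod.castHom (dvd_refl p) k β, ?_⟩
  have hP : Pel k p (sEff p a j) a (X * gPoly p (sEff p a j) 0 a j) =
      Pel k p (sEff p a j) a (C α * gPoly p (sEff p a j) 0 a j +
        C β * gPoly p (sEff p a j) 1 a j) := by
    refine Pel_congr (pairFacts haj).sEff_lt.le (phiIco_dvd haj ?_)
    rw [← phi_mul_gPoly haj (sEff_le_nNum haj 1), ← phi_mul_gPoly haj (sEff_le_nNum haj 0)] at h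
    convert h using 1
    ring
  simp only [Zlin_apply]
  rw [Cm_one_mul_Zmap _ _ _ (one_mem _), Zmap, hP, Pel_add, Pel_C_mul, Pel_C_mul, mul_add,
    mul_smul_comm, mul_smul_comm]
  rfl

theorem eq_zero_of_Zlin_eq_zero (ε : Fin 2) {z : Hyper k} (hz : z ∈ Wsub k)
    (h : Zlin k p ε a j z = 0) : z = 0 := by
  obtain ⟨i, hi, hc⟩ : ∃ i ∈ Finset.Icc (nNum p ε a j) (p - 1), coef p ε a j i ≠ 0 := by
    by_contra! hcon
    refine (pairFacts haj).ne_zero ε ?_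
    rw [bPoly_eq_sum p ε a j haj]
    exact Finset.sum_eq_zero fun m hm => by rw [hcon m hm, map_zero, zero_mul]
  exact eq_zero_of_Zmap_eq_zero (sEff_le_nNum haj ε) hi hc hz h

omit haj in
theorem Zlin_mem_Asub {r : ℕ} (ε : Fin 2) {z : Hyper k} (hz : z ∈ Asub k p r) :
    Zlin k p ε a j z ∈ Asub k p (r + 1) :=
  Zmap_mem_Asub hz _ _ _

/-- The weight zero elements which carry the idempotent `Z^(0)(1)` into
`Z^(0)(A_r) + Z^(1)(A_r)`. -/
def carrierSub (r : ℕ) : Subalgebra k (Hyper k) where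
  carrier := {u | u ∈ Wsub k ∧ ∃ z ∈ Asub k p r, ∃ w ∈ Asub k p r,
    u * Zlin k p 0 a j 1 = Zlin k p 0 a j z + Zlin k p 1 a j w}
  mul_mem' := by
    rintro u v ⟨hu, z, hz, w, hw, e⟩ ⟨hv, z', hz', w', hw', e'⟩
    have hE : (Zlin k p 0 a j 1 : Hyper k) ∈ Wsub k :=
      Asub_le_Wsub (Zlin_mem_Asub (r := r) 0 (one_mem _))
    -- As Z^(0)(1) is idempotent, it can be doubled and one copy given to each factor; the
    -- multiplication rules for Z then apply.
    have h1 : u * v * Zlin k p 0 a j 1 =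
        (u * Zlin k p 0 a j 1) * (v * Zlin k p 0 a j 1) := by
      have := Zlin_zero_mul (k := k) haj 0 (one_mem _) (one_mem _)
      rw [mul_one] at this
      rw [mul_assoc u, mul_assoc u, ← mul_assoc (Zlin k p 0 a j 1) v, (Wsub_comm hE hv).eq,
        mul_assoc v, this]
    have hzW := Asub_le_Wsub hz
    have hwW := Asub_le_Wsub hw
    have hzW' := Asub_le_Wsub hz'
    have hwW' := Asub_le_Wsub hw'
    refine ⟨mul_mem hu hv, ?_⟩
    rw [h1, e, e', add_mul, mul_add, mul_add, Zlin_zero_mul haj 0 hzW hzW',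
      Zlin_zero_mul haj 1 hzW hwW', Zlin_mul_zero haj 1 hwW hzW']
    by_cases hs : IsSplit p a j
    · refine ⟨z * z' + (z * w' + (w * z' + w * w')), add_mem (mul_mem hz hz') (add_mem
        (mul_mem hz hw') (add_mem (mul_mem hw hz') (mul_mem hw hw'))), 0, zero_mem _, ?_⟩
      rw [Zlin_one_eq_zero haj hs, Zlin_zero_mul haj 0 hwW hwW']
      simp only [map_add, map_zero]
      abel
    · refine ⟨z * z', mul_mem hz hz', z * w' + w * z', add_mem (mul_mem hz hw') (mul_mem hw hz'),
        ?_⟩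
      rw [Zlin_one_mul_one haj hs hwW hwW']
      simp only [map_add, add_zero]
      abel
  add_mem' := by
    rintro u v ⟨hu, z, hz, w, hw, e⟩ ⟨hv, z', hz', w', hw', e'⟩
    refine ⟨add_mem hu hv, z + z', add_mem hz hz', w + w', add_mem hw hw', ?_⟩
    rw [add_mul, e, e', map_add, map_add]
    abel
  algebraMap_mem' := fun c => by
    refine ⟨Subalgebra.algebraMap_mem _ c, c • 1, Subalgebra.smul_mem _ (one_mem _) c, 0,
      zero_mem _, ?_⟩
    rw [← Algebra.smul_def, map_smul, map_zero, add_zero]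

theorem mem_carrierSub {r : ℕ} {u : Hyper k} : u ∈ carrierSub (k := k) haj r ↔ u ∈ Wsub k ∧
    ∃ z ∈ Asub k p r, ∃ w ∈ Asub k p r,
      u * Zlin k p 0 a j 1 = Zlin k p 0 a j z + Zlin k p 1 a j w := Iff.rfl

theorem Hbin_mem_carrierSub {r n : ℕ} (hn : n < p ^ (r + 1)) (c : ℤ) :
    Hbin k c n ∈ carrierSub (k := k) haj r := by
  have hn' : n / p < p ^ r := by
    rw [Nat.div_lt_iff_lt_mul (Fact.out : p.Prime).pos, ← pow_succ]
    exact hn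
  have h := Hbin_mul_Zmap (k := k) (sEff p a j) a (gPoly p (sEff p a j) 0 a j) c n
  rw [← Zmap_smul, ← Zlin_apply, ← Zlin_apply] at h
  exact (mem_carrierSub haj).mpr ⟨Ucar_le_Wsub (Hbin_mem_Ucar k _ _), _,
    Subalgebra.smul_mem _ (Hbin_mem_Asub hn' _) _, 0, zero_mem _, by rw [h, map_zero, add_zero]⟩

/-- With m = Np + q, `Cm_add` reduces to the index Np, which passes inside Z, and to q < p, which is
reached from YX by the recursion `Cm_succ`. It is YX that brings in Z^(1). -/
theorem Cm_mem_carrierSub {r m : ℕ} (hm : m < p ^ (r + 1)) :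
    Cm k m ∈ carrierSub (k := k) haj r := by
  have hP := (Fact.out : p.Prime)
  have h1 : Cm k 1 ∈ carrierSub (k := k) haj r := by
    obtain ⟨α, β, h⟩ := exists_Cm_one_mul_Zlin (k := k) haj
    exact ⟨Cm_mem 1, α • 1, Subalgebra.smul_mem _ (one_mem _) α, β • 1,
      Subalgebra.smul_mem _ (one_mem _) β, by rw [map_smul, map_smul, h]⟩
  have hq : ∀ q < p, Cm k q ∈ carrierSub (k := k) haj r := by
    intro q
    induction q with
    | zero => intro _; rw [Cm_zero]; exact one_mem _
    | succ q ih =>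
      intro hlt
      have ih := ih (by omega)
      have hu : ((q + 1 : ℕ) : k) ^ 2 ≠ 0 :=
        pow_ne_zero 2 (natCast_ne_zero_of_lt (p := p) (by omega) hlt)
      rw [← inv_smul_smul₀ hu (Cm k (q + 1)), eq_sub_of_add_eq (Cm_succ q).symm]
      exact Subalgebra.smul_mem _ (sub_mem (mul_mem ih h1) (Subalgebra.smul_mem _
        (mul_mem (Hbin_mem_carrierSub haj (Nat.one_lt_pow (Nat.succ_ne_zero r) hP.one_lt) _)
          ih) _)) _
  have hm' : m / p < p ^ r := by
    rw [Nat.div_lt_iff_lt_mul hP.pos, ← pow_succ]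
    exact hm
  rw [← Nat.div_add_mod' m p, Cm_add _ _ (Nat.mod_lt m hP.pos)]
  refine mul_mem ⟨Cm_mem _, _, Cm_mem_Asub hm', 0, zero_mem _, ?_⟩ (hq _ (Nat.mod_lt m hP.pos))
  rw [map_zero, add_zero]
  exact Cm_mul_Zmap (pairFacts haj).sEff_lt _ _ _

theorem Asub_le_carrierSub {r : ℕ} {u : Hyper k} (hu : u ∈ Asub k p (r + 1)) :
    u ∈ carrierSub (k := k) haj r := by
  have hu := mem_span_of_mem_Asub hu
  have h : Submodule.span k {v | ∃ n < p ^ (r + 1), ∃ c : ℤ, ∃ m < p ^ (r + 1),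
      v = Hbin k c n * Cm k m} ≤ (carrierSub (k := k) haj r).toSubmodule := by
    rw [Submodule.span_le]
    rintro _ ⟨n, hn, c, m, hm, rfl⟩
    show _ ∈ carrierSub (k := k) haj r
    exact mul_mem (Hbin_mem_carrierSub haj hn c) (Cm_mem_carrierSub haj hm)
  exact h hu

end Single

/-! ### The elements `B^(θ)` for tuples -/

section Tuple

variable {k : Type*} [Field k] {p : ℕ} [Fact p.Prime] [CharP k p]

omit [Fact p.Prime] in
theorem mem_Xset {r : ℕ} {a : Fin r → ℕ} {j : Fin r → ℚ} {θ : Fin r → Fin 2} :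
    θ ∈ Xset p r a j ↔ ∀ i, IsSplit p (a i) (j i) → θ i = 0 := by
  rw [Xset]
  split_ifs with h <;> simp [IsSplit, h]

theorem mem_Xset_succ {r : ℕ} {a : Fin (r + 1) → ℕ} {j : Fin (r + 1) → ℚ}
    {θ : Fin (r + 1) → Fin 2} : θ ∈ Xset p (r + 1) a j ↔
      (IsSplit p (a 0) (j 0) → θ 0 = 0) ∧ Fin.tail θ ∈ Xset p r (Fin.tail a) (Fin.tail j) := by
  rw [mem_Xset, mem_Xset, Fin.forall_fin_succ]
  rfl

-- With the empty tuple giving 1, the recursion becomes uniform in r. Membership is proved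
-- simultaneously because replacing Z by the linear map requires an argument of weight zero.
variable (k p) in
theorem bElt_mem_Asub_and_eq {r : ℕ} (a : Fin (r + 1) → ℕ) (j : Fin (r + 1) → ℚ)
    (haj : ∀ s, (a s, j s) ∈ Pairs p) (θ : Fin (r + 1) → Fin 2) :
    bElt k p (r + 1) θ a j ∈ Asub k p (r + 1) ∧ bElt k p (r + 1) θ a j =
      Zlin k p (θ 0) (a 0) (j 0) (bElt k p r (Fin.tail θ) (Fin.tail a) (Fin.tail j)) := by
  induction r with
  | zero =>
    have h : bElt k p 1 θ a j = Zlin k p (θ 0) (a 0) (j 0) 1 := bOne_eq_Zlin (haj 0) _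
    refine ⟨?_, h⟩
    rw [h]
    exact Zlin_mem_Asub _ (one_mem _)
  | succ r ih =>
    have hm := (ih (Fin.tail a) (Fin.tail j) (fun s => haj s.succ) (Fin.tail θ)).1
    have h : bElt k p (r + 2) θ a j = Zlin k p (θ 0) (a 0) (j 0)
        (bElt k p (r + 1) (Fin.tail θ) (Fin.tail a) (Fin.tail j)) :=
      Zel_eq_Zlin (haj 0) _ (Asub_le_Wsub hm)
    refine ⟨?_, h⟩
    rw [h]
    exact Zlin_mem_Asub _ hm

theorem bElt_zero (a : Fin 0 → ℕ) (j : Fin 0 → ℚ) (θ : Fin 0 → Fin 2) : bElt k p 0 θ a j = 1 := by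
  rw [bElt]

theorem bElt_mem_Asub {r : ℕ} {a : Fin r → ℕ} {j : Fin r → ℚ}
    (haj : ∀ s, (a s, j s) ∈ Pairs p) (θ : Fin r → Fin 2) : bElt k p r θ a j ∈ Asub k p r := by
  cases r with
  | zero => rw [bElt_zero]; exact one_mem _
  | succ r => exact (bElt_mem_Asub_and_eq k p a j haj θ).1

theorem bElt_mem_Wsub {r : ℕ} {a : Fin r → ℕ} {j : Fin r → ℚ}
    (haj : ∀ s, (a s, j s) ∈ Pairs p) (θ : Fin r → Fin 2) : bElt k p r θ a j ∈ Wsub k :=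
  Asub_le_Wsub (bElt_mem_Asub haj θ)

theorem bElt_succ {r : ℕ} {a : Fin (r + 1) → ℕ} {j : Fin (r + 1) → ℚ}
    (haj : ∀ s, (a s, j s) ∈ Pairs p) (θ : Fin (r + 1) → Fin 2) : bElt k p (r + 1) θ a j =
      Zlin k p (θ 0) (a 0) (j 0) (bElt k p r (Fin.tail θ) (Fin.tail a) (Fin.tail j)) :=
  (bElt_mem_Asub_and_eq k p a j haj θ).2

/-- Injectivity of each Z^(ε) carries 1 ≠ 0 through the recursion. This is what makes the bound w
sharp. -/
theorem bElt_ne_zero {r : ℕ} {a : Fin r → ℕ} {j : Fin r → ℚ}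
    (haj : ∀ s, (a s, j s) ∈ Pairs p) (θ : Fin r → Fin 2) : bElt k p r θ a j ≠ 0 := by
  induction r with
  | zero =>
    rw [bElt_zero]
    intro h
    have := congrArg (evH k 0) h
    rw [evH_one, map_zero] at this
    exact one_ne_zero this
  | succ r ih =>
    rw [bElt_succ haj]
    have hm := bElt_mem_Wsub (k := k) (a := Fin.tail a) (j := Fin.tail j) (fun s => haj s.succ)
      (Fin.tail θ)
    exact fun h => ih (fun s => haj s.succ) _ (eq_zero_of_Zlin_eq_zero (haj 0) _ hm h)

theorem bElt_mul_of_disjoint {r : ℕ} {a : Fin r → ℕ} {j : Fin r → ℚ}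
    (haj : ∀ s, (a s, j s) ∈ Pairs p) {θ θ' : Fin r → Fin 2} (h : ∀ i, θ i = 0 ∨ θ' i = 0) :
    bElt k p r θ a j * bElt k p r θ' a j = bElt k p r (θ + θ') a j := by
  induction r with
  | zero => simp only [bElt_zero, mul_one]
  | succ r ih =>
    have hm := fun θ => bElt_mem_Wsub (k := k) (a := Fin.tail a) (j := Fin.tail j)
      (fun s => haj s.succ) θ
    have ih := ih (a := Fin.tail a) (j := Fin.tail j) (fun s => haj s.succ)
      (θ := Fin.tail θ) (θ' := Fin.tail θ') (fun i => h i.succ)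
    rw [bElt_succ haj, bElt_succ haj, bElt_succ haj]
    have e : Fin.tail (θ + θ') = Fin.tail θ + Fin.tail θ' := rfl
    rw [e, ← ih, Pi.add_apply]
    rcases h 0 with h0 | h0
    · rw [h0, zero_add, Zlin_zero_mul (haj 0) _ (hm _) (hm _)]
    · rw [h0, add_zero, Zlin_mul_zero (haj 0) _ (hm _) (hm _)]

/-- At a common position of the supports the rule Z^(1)(z) Z^(1)(w) = 0 applies, since membership in
𝒳_r excludes split pairs there; injected zeros then propagate outward. -/
theorem bElt_mul_of_not_disjoint {r : ℕ} {a : Fin r → ℕ} {j : Fin r → ℚ}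
    (haj : ∀ s, (a s, j s) ∈ Pairs p) {θ θ' : Fin r → Fin 2} (hθ : θ ∈ Xset p r a j)
    {i : Fin r} (h : θ i ≠ 0) (h' : θ' i ≠ 0) : bElt k p r θ a j * bElt k p r θ' a j = 0 := by
  induction r with
  | zero => exact i.elim0
  | succ r ih =>
    have hm := fun θ => bElt_mem_Wsub (k := k) (a := Fin.tail a) (j := Fin.tail j)
      (fun s => haj s.succ) θ
    rw [mem_Xset_succ] at hθ
    rw [bElt_succ haj, bElt_succ haj]
    by_cases h0 : θ 0 ≠ 0 ∧ θ' 0 ≠ 0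
    · rw [Fin.eq_one_of_ne_zero _ h0.1, Fin.eq_one_of_ne_zero _ h0.2]
      exact Zlin_one_mul_one (haj 0) (fun hs => h0.1 (hθ.1 hs)) (hm _) (hm _)
    · have hi : i ≠ 0 := by rintro rfl; exact h0 ⟨h, h'⟩
      obtain ⟨l, rfl⟩ := Fin.exists_succ_eq.mpr hi
      have ih := ih (a := Fin.tail a) (j := Fin.tail j) (fun s => haj s.succ)
        (θ := Fin.tail θ) (θ' := Fin.tail θ') hθ.2 h h'
      rcases not_and_or.mp h0 with h0 | h0
      · rw [not_not.mp h0, Zlin_zero_mul (haj 0) _ (hm _) (hm _), ih, map_zero]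
      · rw [not_not.mp h0, Zlin_mul_zero (haj 0) _ (hm _) (hm _), ih, map_zero]

theorem mul_eElt_mem_span {r : ℕ} {a : Fin r → ℕ} {j : Fin r → ℚ}
    (haj : ∀ s, (a s, j s) ∈ Pairs p) {u : Hyper k} (hu : u ∈ Asub k p r) :
    u * eElt k p r a j ∈ Submodule.span k ((fun θ => bElt k p r θ a j) '' Xset p r a j) := by
  induction r generalizing u with
  | zero =>
    have h1 : (1 : Hyper k) ∈ Submodule.span k ((fun θ => bElt k p 0 θ a j) '' Xset p 0 a j) := by
      refine Submodule.subset_span ⟨0, mem_Xset.mpr fun i => i.elim0, ?_⟩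
      dsimp only
      rw [bElt_zero]
    rw [eElt, bElt_zero, mul_one]
    have hu := mem_span_of_mem_Asub hu
    refine Submodule.span_le.mpr ?_ hu
    rintro _ ⟨n, hn, c, m, hm, rfl⟩
    rw [pow_zero, Nat.lt_one_iff] at hn hm
    rw [hn, hm, Hbin_zero, Cm_zero, mul_one]
    exact h1
  | succ r ih =>
    have ih := fun {u} => ih (a := Fin.tail a) (j := Fin.tail j) (fun s => haj s.succ) (u := u)
    have hE : eElt k p r (Fin.tail a) (Fin.tail j) ∈ Wsub k :=
      bElt_mem_Wsub (fun s => haj s.succ) 0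
    have hE0 : eElt k p (r + 1) a j =
        Zlin k p 0 (a 0) (j 0) (eElt k p r (Fin.tail a) (Fin.tail j)) := bElt_succ haj 0
    have hspan : ∀ ε : Fin 2, (IsSplit p (a 0) (j 0) → ε = 0) → ∀ z ∈ Asub k p r,
        Zlin k p ε (a 0) (j 0) (z * eElt k p r (Fin.tail a) (Fin.tail j)) ∈
          Submodule.span k ((fun θ => bElt k p (r + 1) θ a j) '' Xset p (r + 1) a j) := by
      intro ε hε z hz
      have h : Submodule.span k ((fun θ => bElt k p r θ (Fin.tail a) (Fin.tail j)) ''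
          Xset p r (Fin.tail a) (Fin.tail j)) ≤ (Submodule.span k
            ((fun θ => bElt k p (r + 1) θ a j) '' Xset p (r + 1) a j)).comap
              (Zlin k p ε (a 0) (j 0)) := by
        rw [Submodule.span_le]
        rintro _ ⟨θ, hθ, rfl⟩
        refine Submodule.subset_span ⟨Fin.cons ε θ, mem_Xset_succ.mpr ⟨?_, ?_⟩, ?_⟩
        · rwa [Fin.cons_zero]
        · rwa [Fin.tail_cons]
        · dsimp only
          rw [bElt_succ haj, Fin.cons_zero, Fin.tail_cons]
      exact h (ih hz)
    -- Multiplying u Z^(0)(1) = Z^(0)(z) + Z^(1)(w) by E = Z^(0)(E') gives Z^(0)(zE') + Z^(1)(wE'),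
    -- and induction applies to zE' and wE'.
    obtain ⟨-, z, hz, w, hw, e⟩ := Asub_le_carrierSub (haj 0) hu
    have e1 : u * eElt k p (r + 1) a j =
        Zlin k p 0 (a 0) (j 0) (z * eElt k p r (Fin.tail a) (Fin.tail j)) +
          Zlin k p 1 (a 0) (j 0) (w * eElt k p r (Fin.tail a) (Fin.tail j)) := by
      rw [← Zlin_mul_zero (haj 0) 1 (Asub_le_Wsub hw) hE, ← Zlin_zero_mul (haj 0) 0
        (Asub_le_Wsub hz) hE, ← add_mul, ← e, mul_assoc, Zlin_zero_mul (haj 0) 0 (one_mem _) hE,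
        one_mul, hE0]
    rw [e1]
    refine add_mem (hspan 0 (fun _ => rfl) z hz) ?_
    -- For a split pair θ_0 = 1 is not allowed in 𝒳_r, but then Z^(1) coincides with Z^(0).
    by_cases hs : IsSplit p (a 0) (j 0)
    · rw [Zlin_one_eq_zero (haj 0) hs]
      exact hspan 0 (fun _ => rfl) w hw
    · exact hspan 1 (fun h => absurd h hs) w hw

end Tuple

end

section

/-! ### A criterion for the Jacobson radical of a local ring -/

section LocalRing

/-- If the complement of a proper left ideal consists of units, then this ideal is the Jacobson
radical. -/
theorem jacobson_eq_of_forall_isUnit {R : Type*} [Ring R] {N : Ideal R} (h1 : (1 : R) ∉ N)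
    (hN : ∀ x ∉ N, IsUnit x) : Ring.jacobson R = N := by
  have hle : ∀ I : Ideal R, I ≠ ⊤ → I ≤ N := fun I hI x hx => by
    by_contra hxN
    exact hI (Ideal.eq_top_of_isUnit_mem I hx (hN x hxN))
  have hmax : N.IsMaximal :=
    ⟨⟨(Ideal.ne_top_iff_one N).mpr h1, fun I hI => by
      by_contra hI'
      exact absurd (hle I hI') (not_le_of_gt hI)⟩⟩
  refine le_antisymm (Ring.jacobson_le_of_isMaximal N) ?_
  rw [Ring.jacobson_eq_sInf_isMaximal]
  refine le_sInf fun I hI => ?_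
  have hI : I.IsMaximal := hI
  exact (hI.eq_of_le hmax.ne_top (hle I hI.ne_top)).ge

end LocalRing

/-! ### Combinatorics of the index set `𝒳_r` -/

section Hamming

variable {r : ℕ}

theorem hammingNorm_add_of_disjoint {θ θ' : Fin r → Fin 2} (h : ∀ i, θ i = 0 ∨ θ' i = 0) :
    hammingNorm (θ + θ') = hammingNorm θ + hammingNorm θ' := by
  classical
  simp only [hammingNorm]
  rw [← Finset.card_union_of_disjoint]
  · congr 1
    ext i
    rcases h i with h | h <;> simp [h]
  · rw [Finset.disjoint_left]
    intro i hi hi'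
    rcases h i with h | h <;> simp [h] at hi hi'

theorem hammingNorm_single (l : Fin r) : hammingNorm (Pi.single l 1 : Fin r → Fin 2) = 1 := by
  classical
  rw [hammingNorm, Finset.card_eq_one]
  refine ⟨l, ?_⟩
  ext i
  by_cases h : i = l <;> simp [Pi.single_apply, h]

variable {p : ℕ} [Fact p.Prime] {a : Fin r → ℕ} {j : Fin r → ℚ}

theorem add_mem_Xset {θ θ' : Fin r → Fin 2} (h : θ ∈ Xset p r a j) (h' : θ' ∈ Xset p r a j) :
    θ + θ' ∈ Xset p r a j := by
  rw [mem_Xset] at h h' ⊢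
  intro i hi
  rw [Pi.add_apply, h i hi, h' i hi, add_zero]

/-- One nonzero entry is split off. On the level of the B^(θ) this factors a monomial into one of
weight smaller by one and one of weight one. -/
theorem exists_add_of_pos {θ : Fin r → Fin 2} (h : θ ∈ Xset p r a j) (h0 : 0 < hammingNorm θ) :
    ∃ θ' ∈ Xset p r a j, ∃ δ ∈ Xset p r a j, θ = θ' + δ ∧ (∀ i, θ' i = 0 ∨ δ i = 0) ∧
      hammingNorm δ = 1 := by
  rw [hammingNorm_pos_iff] at h0
  obtain ⟨l, hl⟩ := Function.ne_iff.mp h0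
  have hl : θ l = 1 := Fin.eq_one_of_ne_zero _ hl
  rw [mem_Xset] at h
  refine ⟨Function.update θ l 0, mem_Xset.mpr fun i hi => ?_, Pi.single l 1,
    mem_Xset.mpr fun i hi => ?_, ?_, fun i => ?_, hammingNorm_single l⟩
  · by_cases hil : i = l
    · subst hil; simp
    · rw [Function.update_of_ne hil, h i hi]
  · rw [Pi.single_apply, if_neg]
    rintro rfl
    rw [h i hi] at hl
    exact zero_ne_one hl
  · funext i
    by_cases hil : i = l
    · subst hil; simp [hl]
    · simp [hil]
  · by_cases hil : i = l
    · subst hil; simp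
    · exact Or.inr (Pi.single_eq_of_ne hil 1)

omit [Fact p.Prime] in
-- This treats p = 2 and p odd alike: w counts the positions where an element of 𝒳_r may be nonzero.
-- For p = 2 one uses that a_i is 0 or 1.
open Classical in
theorem wNum_eq_card (haj : ∀ s, (a s, j s) ∈ Pairs p) :
    wNum p r a j = (Finset.univ.filter fun i => ¬ IsSplit p (a i) (j i)).card := by
  rw [wNum]
  split_ifs with hp
  · have h1 : hammingNorm a = (Finset.univ.filter fun i => IsSplit p (a i) (j i)).card := by
      rw [hammingNorm]
      congr 1
      ext i
      have := haj i
      rw [Pairs, if_pos hp] at this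
      simp only [Set.mem_insert_iff, Set.mem_singleton_iff, Prod.mk.injEq] at this
      simp only [Finset.mem_filter, Finset.mem_univ, true_and, IsSplit, if_pos hp]
      omega
    have h2 := Finset.card_filter_add_card_filter_not (s := (Finset.univ : Finset (Fin r)))
      (fun i => IsSplit p (a i) (j i))
    rw [Finset.card_univ, Fintype.card_fin] at h2
    omega
  · rw [hammingNorm]
    congr 1
    ext i
    simp [IsSplit, hp]

theorem hammingNorm_le_wNum (haj : ∀ s, (a s, j s) ∈ Pairs p) {θ : Fin r → Fin 2}
    (h : θ ∈ Xset p r a j) : hammingNorm θ ≤ wNum p r a j := by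
  classical
  rw [wNum_eq_card haj, hammingNorm]
  rw [mem_Xset] at h
  refine Finset.card_le_card fun i hi => ?_
  simp only [Finset.mem_filter, Finset.mem_univ, true_and] at hi ⊢
  exact fun hs => hi (h i hs)

theorem exists_hammingNorm_eq_wNum (haj : ∀ s, (a s, j s) ∈ Pairs p) :
    ∃ θ ∈ Xset p r a j, hammingNorm θ = wNum p r a j := by
  classical
  refine ⟨fun i => if IsSplit p (a i) (j i) then 0 else 1, mem_Xset.mpr fun i hi => if_pos hi, ?_⟩
  rw [wNum_eq_card haj, hammingNorm]
  congr 1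
  ext i
  simp

end Hamming

/-! ### The filtration of `A_r E` by weight -/

section Filtration

variable {k : Type*} [Field k] {p : ℕ} [Fact p.Prime] [CharP k p]
  {r : ℕ} {a : Fin r → ℕ} {j : Fin r → ℚ}

variable (k p r a j) in
/-- The span of the elements `B^(θ)(a, j)` with `θ ∈ 𝒳_r(a, j)` of weight at least `i`. -/
def filt (i : ℕ) : Submodule k (Hyper k) :=
  Submodule.span k ((fun θ => bElt k p r θ a j) '' {θ ∈ Xset p r a j | i ≤ hammingNorm θ})

theorem bElt_mem_filt {i : ℕ} {θ : Fin r → Fin 2} (hθ : θ ∈ Xset p r a j)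
    (hi : i ≤ hammingNorm θ) : bElt k p r θ a j ∈ filt k p r a j i :=
  Submodule.subset_span ⟨θ, ⟨hθ, hi⟩, rfl⟩

theorem zero_mem_Xset : (0 : Fin r → Fin 2) ∈ Xset p r a j := mem_Xset.mpr fun _ _ => rfl

theorem eElt_mem_filt : eElt k p r a j ∈ filt k p r a j 0 :=
  bElt_mem_filt zero_mem_Xset (Nat.zero_le _)

variable (haj : ∀ s, (a s, j s) ∈ Pairs p)
include haj

theorem mul_mem_filt {i l : ℕ} {u v : Hyper k} (hu : u ∈ filt k p r a j i)
    (hv : v ∈ filt k p r a j l) : u * v ∈ filt k p r a j (i + l) := by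
  rw [filt] at hu hv
  induction hu, hv using Submodule.span_induction₂ with
  | mem_mem u v hu hv =>
    obtain ⟨θ, hθ, rfl⟩ := hu
    obtain ⟨θ', hθ', rfl⟩ := hv
    dsimp only
    by_cases h : ∀ i, θ i = 0 ∨ θ' i = 0
    · rw [bElt_mul_of_disjoint haj h]
      refine bElt_mem_filt (add_mem_Xset hθ.1 hθ'.1) ?_
      rw [hammingNorm_add_of_disjoint h]
      exact add_le_add hθ.2 hθ'.2
    · push Not at h
      obtain ⟨i, h1, h2⟩ := h
      rw [bElt_mul_of_not_disjoint haj hθ.1 h1 h2]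
      exact zero_mem _
  | zero_left v hv => rw [zero_mul]; exact zero_mem _
  | zero_right u hu => rw [mul_zero]; exact zero_mem _
  | add_left u v w _ _ _ hu hv => rw [add_mul]; exact add_mem hu hv
  | add_right u v w _ _ _ hu hv => rw [mul_add]; exact add_mem hu hv
  | smul_left c u v _ _ hu => rw [smul_mul_assoc]; exact Submodule.smul_mem _ c hu
  | smul_right c u v _ _ hu => rw [mul_smul_comm]; exact Submodule.smul_mem _ c hu

theorem filt_le_Asub {i : ℕ} {u : Hyper k} (hu : u ∈ filt k p r a j i) : u ∈ Asub k p r := by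
  have : filt k p r a j i ≤ (Asub k p r).toSubmodule := by
    rw [filt, Submodule.span_le]
    rintro _ ⟨θ, -, rfl⟩
    exact bElt_mem_Asub haj θ
  exact this hu

theorem eElt_mul_self : eElt k p r a j * eElt k p r a j = eElt k p r a j := by
  rw [eElt, bElt_mul_of_disjoint (θ := 0) haj fun _ => Or.inl rfl, add_zero]

theorem eElt_mul_filt {i : ℕ} {u : Hyper k} (hu : u ∈ filt k p r a j i) :
    eElt k p r a j * u = u := by
  rw [filt] at hu
  induction hu using Submodule.span_induction with
  | mem u hu =>
    obtain ⟨θ, hθ, rfl⟩ := hu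
    dsimp only
    rw [eElt, bElt_mul_of_disjoint (θ := 0) haj fun _ => Or.inl rfl, zero_add]
  | zero => rw [mul_zero]
  | add u v _ _ hu hv => rw [mul_add, hu, hv]
  | smul c u _ hu => rw [mul_smul_comm, hu]

/-- The maximal weight w is attained in 𝒳_r, and the corresponding B^(θ) is nonzero; linear
independence is not required. -/
theorem filt_eq_bot_iff {i : ℕ} : filt k p r a j i = ⊥ ↔ wNum p r a j < i := by
  constructor
  · intro h
    by_contra! hi
    obtain ⟨θ, hθ, e⟩ := exists_hammingNorm_eq_wNum haj
    have h1 := bElt_mem_filt (k := k) hθ (hi.trans e.ge)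
    rw [h, Submodule.mem_bot] at h1
    exact bElt_ne_zero haj θ h1
  · intro h
    rw [filt, Submodule.span_eq_bot]
    rintro _ ⟨θ, hθ, rfl⟩
    exact absurd (hθ.2.trans (hammingNorm_le_wNum haj hθ.1)) (not_le_of_gt h)

/-- Since v = Ev, the factor u may be replaced by uE, which lies in the span of the B^(θ). -/
theorem mul_mem_filt_of_mem_Asub {i : ℕ} {u v : Hyper k} (hu : u ∈ Asub k p r)
    (hv : v ∈ filt k p r a j i) : u * v ∈ filt k p r a j i := by
  have h0 : u * eElt k p r a j ∈ filt k p r a j 0 := by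
    have := mul_eElt_mem_span haj hu
    rw [filt]
    simpa using this
  have := mul_mem_filt haj h0 hv
  rwa [mul_assoc, eElt_mul_filt haj hv, zero_add] at this

theorem iSup_Aspan_eq_filt (i : ℕ) :
    (⨆ θ ∈ {θ ∈ Xset p r a j | hammingNorm θ = i}, Aspan k p r (bElt k p r θ a j)) =
      filt k p r a j i := by
  apply le_antisymm
  · refine iSup₂_le fun θ hθ => ?_
    rintro _ ⟨u, hu, rfl⟩
    exact mul_mem_filt_of_mem_Asub haj hu (bElt_mem_filt hθ.1 hθ.2.ge)
  · rw [filt, Submodule.span_le]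
    rintro _ ⟨θ, ⟨hθ, hi⟩, rfl⟩
    obtain ⟨n, hn⟩ := Nat.exists_eq_add_of_le hi
    -- Any B^(θ) of weight i + n is a multiple of some B^(θ₀) of weight exactly i, obtained by
    -- removing n entries one at a time.
    clear hi
    obtain ⟨θ₀, h₀, h₀i, u, hu, e⟩ : ∃ θ₀ ∈ Xset p r a j, hammingNorm θ₀ = i ∧
        ∃ u ∈ Asub k p r, bElt k p r θ a j = u * bElt k p r θ₀ a j := by
      induction n generalizing θ with
      | zero => exact ⟨θ, hθ, hn, 1, one_mem _, (one_mul _).symm⟩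
      | succ n ih =>
        obtain ⟨θ', hθ', δ, hδ, rfl, hd, h1⟩ := exists_add_of_pos hθ (by omega)
        rw [hammingNorm_add_of_disjoint hd, h1] at hn
        obtain ⟨θ₀, h₀, h₀i, u, hu, e⟩ := ih θ' hθ' (by omega)
        refine ⟨θ₀, h₀, h₀i, bElt k p r δ a j * u, mul_mem (bElt_mem_Asub haj δ) hu, ?_⟩
        rw [mul_assoc, ← e, bElt_mul_of_disjoint haj fun i => (hd i).symm, add_comm]
    have hle := le_iSup₂_of_le (f := fun θ (_ : θ ∈ {θ ∈ Xset p r a j | hammingNorm θ = i}) =>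
      Aspan k p r (bElt k p r θ a j)) θ₀ ⟨h₀, h₀i⟩ le_rfl
    exact hle ⟨u, hu, e.symm⟩

end Filtration

/-! ### The corner algebra `A_r E` is local; powers of its radical -/

section Corner

variable {k : Type*} [Field k] {p : ℕ} [Fact p.Prime] [CharP k p]
  {r : ℕ} {a : Fin r → ℕ} {j : Fin r → ℚ} (haj : ∀ s, (a s, j s) ∈ Pairs p)
  {hE : eElt k p r a j ∈ Asub k p r}
  (he : IsIdempotentElem (⟨eElt k p r a j, hE⟩ : Asub k p r))

variable {he} in
/-- An element of the corner algebra, as an element of the hyperalgebra. -/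
def cornerVal (x : he.Corner) : Hyper k := x.1.1

theorem cornerVal_injective : Function.Injective (cornerVal (he := he)) := fun _ _ h =>
  Subtype.ext (Subtype.ext h)

theorem cornerVal_mul (x y : he.Corner) : cornerVal (x * y) = cornerVal x * cornerVal y := rfl

theorem cornerVal_add (x y : he.Corner) : cornerVal (x + y) = cornerVal x + cornerVal y := rfl

theorem cornerVal_one : cornerVal (1 : he.Corner) = eElt k p r a j := rfl

theorem eElt_mul_cornerVal (x : he.Corner) : eElt k p r a j * cornerVal x = cornerVal x :=
  congrArg cornerVal (one_mul x)

include haj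

theorem exists_cornerVal_eq {i : ℕ} {v : Hyper k} (hv : v ∈ filt k p r a j i) :
    ∃ x : he.Corner, cornerVal x = v := by
  have h1 := eElt_mul_filt haj hv
  have hvA := filt_le_Asub haj hv
  have h2 : v * eElt k p r a j = v := by
    rw [(Wsub_comm (Asub_le_Wsub hvA) (Asub_le_Wsub hE)).eq, h1]
  exact ⟨⟨⟨v, hvA⟩, (Subsemigroup.mem_corner_iff he).mpr ⟨Subtype.ext h1, Subtype.ext h2⟩⟩, rfl⟩

theorem cornerVal_mem_filt (x : he.Corner) : cornerVal x ∈ filt k p r a j 0 := by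
  have h := mul_mem_filt_of_mem_Asub haj x.1.2 (eElt_mem_filt (k := k) (p := p) (a := a) (j := j))
  have h1 : cornerVal x * eElt k p r a j = cornerVal x := congrArg cornerVal (mul_one x)
  exact h1 ▸ h

/-- The ideal of the corner algebra corresponding to a step of the filtration. -/
def filtIdeal (i : ℕ) : Ideal he.Corner where
  carrier := {x | cornerVal x ∈ filt k p r a j i}
  add_mem' := fun hx hy => (filt k p r a j i).add_mem hx hy
  zero_mem' := (filt k p r a j i).zero_mem
  smul_mem' := fun x y hy => by
    have := mul_mem_filt haj (cornerVal_mem_filt haj he x) hy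
    rwa [zero_add] at this

theorem mem_filtIdeal {i : ℕ} {x : he.Corner} :
    x ∈ filtIdeal haj he i ↔ cornerVal x ∈ filt k p r a j i := Iff.rfl

theorem pow_mem_filtIdeal {x : he.Corner} (hx : x ∈ filtIdeal haj he 1) (n : ℕ) :
    x ^ n ∈ filtIdeal haj he n := by
  induction n with
  | zero => exact cornerVal_mem_filt haj he _
  | succ n ih => rw [pow_succ]; exact mul_mem_filt haj ih hx

theorem filtIdeal_eq_bot : filtIdeal haj he (wNum p r a j + 1) = ⊥ := by
  rw [eq_bot_iff]
  intro x hx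
  rw [mem_filtIdeal, (filt_eq_bot_iff haj).mpr (Nat.lt_succ_self _), Submodule.mem_bot] at hx
  exact (Ideal.mem_bot).mpr (cornerVal_injective he hx)

theorem isNilpotent_of_mem_filtIdeal {x : he.Corner} (hx : x ∈ filtIdeal haj he 1) :
    IsNilpotent x := by
  have h := pow_mem_filtIdeal haj he hx (wNum p r a j + 1)
  rw [filtIdeal_eq_bot, Ideal.mem_bot] at h
  exact ⟨_, h⟩

theorem one_notMem_filtIdeal : (1 : he.Corner) ∉ filtIdeal haj he 1 := fun h => by
  obtain ⟨n, hn⟩ := isNilpotent_of_mem_filtIdeal haj he h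
  rw [one_pow] at hn
  exact bElt_ne_zero haj 0 (congrArg cornerVal hn)

omit haj in
theorem filt_zero_le : filt k p r a j 0 ≤ (k ∙ eElt k p r a j) ⊔ filt k p r a j 1 := by
  rw [filt, Submodule.span_le]
  rintro _ ⟨θ, hθ, rfl⟩
  rcases Nat.eq_zero_or_pos (hammingNorm θ) with h | h
  · rw [hammingNorm_eq_zero] at h
    subst h
    exact Submodule.mem_sup_left (Submodule.mem_span_singleton_self _)
  · exact Submodule.mem_sup_right (bElt_mem_filt hθ.1 h)

/-- Such an element is cE + n with c ≠ 0 and n in the positive part, hence a unit plus a commuting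
nilpotent. -/
theorem isUnit_of_notMem_filtIdeal {x : he.Corner} (hx : x ∉ filtIdeal haj he 1) : IsUnit x := by
  obtain ⟨_, hc, v, hv, e⟩ := Submodule.mem_sup.mp
    (filt_zero_le (cornerVal_mem_filt haj he x))
  obtain ⟨c, rfl⟩ := Submodule.mem_span_singleton.mp hc
  have hE0 := eElt_mem_filt (k := k) (p := p) (a := a) (j := j)
  obtain ⟨n, rfl⟩ := exists_cornerVal_eq haj he hv
  obtain ⟨y, hy⟩ := exists_cornerVal_eq haj he (Submodule.smul_mem _ c hE0)
  obtain ⟨y', hy'⟩ := exists_cornerVal_eq haj he (Submodule.smul_mem _ c⁻¹ hE0)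
  have hc0 : c ≠ 0 := by
    rintro rfl
    rw [zero_smul, zero_add] at e
    exact hx (by rw [mem_filtIdeal, ← e]; exact hv)
  have hxy : x = y + n := cornerVal_injective he (by rw [cornerVal_add, hy, e])
  have hyu : IsUnit y := by
    refine ⟨⟨y, y', cornerVal_injective he ?_, cornerVal_injective he ?_⟩, rfl⟩
    · rw [cornerVal_mul, hy, hy', smul_mul_smul_comm, mul_inv_cancel₀ hc0, one_smul,
        eElt_mul_self haj, cornerVal_one]
    · rw [cornerVal_mul, hy, hy', smul_mul_smul_comm, inv_mul_cancel₀ hc0, one_smul,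
        eElt_mul_self haj, cornerVal_one]
  have hcomm : Commute n y := cornerVal_injective he
    (Wsub_comm (Asub_le_Wsub n.1.2) (Asub_le_Wsub y.1.2)).eq
  rw [hxy]
  exact (isNilpotent_of_mem_filtIdeal haj he hv).isUnit_add_left_of_commute hyu hcomm

theorem jacobson_corner : Ring.jacobson he.Corner = filtIdeal haj he 1 :=
  jacobson_eq_of_forall_isUnit (one_notMem_filtIdeal haj he)
    fun _ hx => isUnit_of_notMem_filtIdeal haj he hx

/-- The `k`-subspace of the hyperalgebra underlying an ideal of the corner algebra. -/
def idealVal (I : Ideal he.Corner) : Submodule k (Hyper k) where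
  carrier := cornerVal '' (I : Set he.Corner)
  add_mem' := by
    rintro _ _ ⟨x, hx, rfl⟩ ⟨y, hy, rfl⟩
    exact ⟨x + y, add_mem hx hy, rfl⟩
  zero_mem' := ⟨0, zero_mem I, rfl⟩
  smul_mem' := by
    rintro c _ ⟨x, hx, rfl⟩
    obtain ⟨y, hy⟩ := exists_cornerVal_eq haj he
      (Submodule.smul_mem _ c (eElt_mem_filt (k := k) (p := p) (a := a) (j := j)))
    exact ⟨y * x, I.mul_mem_left y hx, by
      rw [cornerVal_mul, hy, smul_mul_assoc, eElt_mul_cornerVal]⟩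

/-- A monomial of weight at least i has i factors of weight one to split off, each lying in the
radical. -/
theorem bElt_mem_idealVal (i : ℕ) {θ : Fin r → Fin 2} (hθ : θ ∈ Xset p r a j)
    (hi : i ≤ hammingNorm θ) :
    bElt k p r θ a j ∈ idealVal haj he (filtIdeal haj he 1 ^ i) := by
  induction i generalizing θ with
  | zero =>
    obtain ⟨x, hx⟩ := exists_cornerVal_eq haj he (bElt_mem_filt (k := k) hθ le_rfl)
    exact ⟨x, by rw [Submodule.pow_zero, Ideal.one_eq_top]; exact Submodule.mem_top, hx⟩
  | succ i ih =>
    obtain ⟨θ', hθ', δ, hδ, rfl, hd, h1⟩ := exists_add_of_pos hθ (by omega)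
    rw [hammingNorm_add_of_disjoint hd, h1] at hi
    obtain ⟨x, hx, e⟩ := ih hθ' (by omega)
    obtain ⟨y, hy⟩ := exists_cornerVal_eq haj he (bElt_mem_filt (k := k) hδ h1.ge)
    refine ⟨x * y, ?_, ?_⟩
    · rw [Submodule.pow_succ]
      exact Ideal.mul_mem_mul hx (by rw [mem_filtIdeal, hy]; exact bElt_mem_filt hδ h1.ge)
    · rw [cornerVal_mul, e, hy, bElt_mul_of_disjoint haj hd]

theorem filtIdeal_one_pow_le (i : ℕ) : filtIdeal haj he 1 ^ i ≤ filtIdeal haj he i := by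
  induction i with
  | zero => exact fun x _ => cornerVal_mem_filt haj he x
  | succ i ih =>
    rw [Submodule.pow_succ, Ideal.mul_le]
    exact fun x hx y hy => mul_mem_filt haj (ih hx) hy

/-- One inclusion is multiplicativity of the filtration, the other the factorization of the
monomials B^(θ). -/
theorem idealVal_jacobson_pow (i : ℕ) :
    idealVal haj he (Ring.jacobson he.Corner ^ i) = filt k p r a j i := by
  rw [jacobson_corner haj]
  apply le_antisymm
  · rintro _ ⟨x, hx, rfl⟩
    exact filtIdeal_one_pow_le haj he i hx
  · rw [filt, Submodule.span_le]
    rintro _ ⟨θ, hθ, rfl⟩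
    exact bElt_mem_idealVal haj he i hθ.1 hθ.2

theorem image_radPow (i : ℕ) : Subtype.val '' radPow he i = (filt k p r a j i : Set (Hyper k)) := by
  rw [← idealVal_jacobson_pow haj he i]
  ext v
  constructor
  · rintro ⟨_, ⟨x, hx, rfl⟩, rfl⟩
    exact ⟨x, hx, rfl⟩
  · rintro ⟨x, hx, rfl⟩
    exact ⟨_, ⟨x, hx, rfl⟩, rfl⟩

theorem radPow_eq_zero_iff (i : ℕ) : radPow he i = {0} ↔ wNum p r a j < i := by
  have h : (Subtype.val '' ({0} : Set (Asub k p r))) = ((⊥ : Submodule k (Hyper k)) : Set _) := by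
    rw [Set.image_singleton, Submodule.bot_coe]
    rfl
  rw [← (Set.image_injective.mpr Subtype.val_injective).eq_iff, image_radPow haj he, h,
    SetLike.coe_set_eq, filt_eq_bot_iff haj]

end Corner

end

end HyperSL2

end

theorem proposition3p10 (k : Type*) [Field k] [IsAlgClosed k] (p : ℕ) [Fact p.Prime] [CharP k p]
    (r : ℕ) (hr : 0 < r) (a : Fin r → ℕ) (j : Fin r → ℚ)
    (haj : ∀ s, (a s, j s) ∈ HyperSL2.Pairs p) :
    ∃ (hE : HyperSL2.eElt k p r a j ∈ HyperSL2.Asub k p r)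
      (he : IsIdempotentElem (⟨HyperSL2.eElt k p r a j, hE⟩ : HyperSL2.Asub k p r)),
      IsMulCentral (⟨HyperSL2.eElt k p r a j, hE⟩ : HyperSL2.Asub k p r) ∧
      ∀ i : ℕ, 1 ≤ i →
        (Subtype.val '' HyperSL2.radPow he i =
          ((⨆ θ ∈ {θ ∈ HyperSL2.Xset p r a j | hammingNorm θ = i},
              HyperSL2.Aspan k p r (HyperSL2.bElt k p r θ a j) :
            Submodule k (HyperSL2.Hyper k)) : Set (HyperSL2.Hyper k))) ∧
        (Subtype.val '' HyperSL2.radPow he i =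
          (Submodule.span k ((fun θ => HyperSL2.bElt k p r θ a j) ''
            {θ ∈ HyperSL2.Xset p r a j | i ≤ hammingNorm θ}) : Set (HyperSL2.Hyper k))) ∧
        (HyperSL2.radPow he i = {0} ↔ HyperSL2.wNum p r a j < i) := by
  have hE : HyperSL2.eElt k p r a j ∈ HyperSL2.Asub k p r := HyperSL2.bElt_mem_Asub haj 0
  have he : IsIdempotentElem (⟨HyperSL2.eElt k p r a j, hE⟩ : HyperSL2.Asub k p r) :=
    Subtype.ext (HyperSL2.eElt_mul_self haj)
  -- The whole algebra A_r is commutative, so E is central for free.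
  have hcomm : ∀ x y : HyperSL2.Asub k p r, x * y = y * x := fun x y => Subtype.ext
    (HyperSL2.Wsub_comm (HyperSL2.Asub_le_Wsub x.2) (HyperSL2.Asub_le_Wsub y.2)).eq
  refine ⟨hE, he, ⟨fun x => hcomm _ _, fun x y => ?_, fun x y => ?_⟩, fun i _ =>
    ⟨?_, HyperSL2.image_radPow haj he i, HyperSL2.radPow_eq_zero_iff haj he i⟩⟩
  · rw [mul_assoc]
  · rw [mul_assoc]
  · rw [HyperSL2.image_radPow haj he, HyperSL2.iSup_Aspan_eq_filt haj]
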